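/- Notation. For a window $g\in C_0^\infty(\mathbb{R}^d)$ with $\|g\|_{L^2}=1$ and a tempered distribution $f\in\mathcal S'(\mathbb{R}^d)$ let $V_gf(x,\xi)=\int e^{-2\pi i\xi\cdot y}f(y)\,g(y-x)\,dy:=\langle f, e^{-2\pi i\xi\cdot(\,\cdot\,)}g(\cdot-x)\rangle$ (bilinear pairing), that is, the Fourier transform of $f\,T_xg$, where $T_xg(y)=g(y-x)$. For $1\le p,q\le\infty$ let $$\|f\|_{W(\mathcal FL^p,L^q)}=\big\|\,x\mapsto\|f\,T_xg\|_{\mathcal FL^p}\big\|_{L^q}=\big\|\,x\mapsto\|V_gf(x,\cdot)\|_{L^p}\big\|_{L^q},$$ and let $W(\mathcal FL^p,L^q)$ be the space of all $f\in\mathcal S'(\mathbb{R}^d)$ for which this is finite. Let $\rho(a,b)\varphi(x)=e^{2\pi i x\cdot b+\pi i a\cdot b}\varphi(x+a)$ ($a,b\in\mathbb{R}^d$) be the Schrödinger representation on $L^2(\mathbb{R}^d)$. For $\mathcal A\in Sp(d,\mathbb{R})$, the metaplectic operator $\mu(\mathcal A)$ is a unitary operator on $L^2(\mathbb{R}^d)$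 with $\mu(\mathcal A)\rho(z)\mu(\mathcal A)^{-1}=\rho(\mathcal A z)$ for all $z\in\mathbb{R}^{2d}$, extended to a weak-* continuous linear operator on $\mathcal S'(\mathbb{R}^d)$. It is determined up to a constant factor of modulus one, which does not affect the estimates below; these are asserted for every choice of the factor. **Theorem 4.1.** Let $d\ge 0$, let $g$ be a window as above, used in all the norms, and write $\mathcal A=\begin{pmatrix}A&B\\ C&D\end{pmatrix}\in Sp(d,\mathbb{R})$ with $d\times d$ blocks. (i) Let $1\le p\le q\le\infty$. There is a constant $c>0$, depending only on $d,p,q,g$, such that for every $\mathcal A\in Sp(d,\mathbb{R})$ with $\det B\neq0$ the operator $\mu(\mathcal A)$ exists, maps $W(\mathcal FL^q,L^p)$ into $W(\mathcal FL^p,L^q)$, and satisfies, for all $f\in W(\mathcal FL^q,L^p)$, $$\|\mu(\mathcal A)f\|_{W(\mathcal FL^p,L^q)}\le c\,\alpha(\mathcal A,p,q)\,\|f\|_{W(\mathcal FL^q,L^p)},$$ $$\alpha(\mathcal A,p,q)=|\det B|^{1/q-1/p-3/2}\,\big|\det\big((I+B^*B)(B+iA)(B+iD)\big)\big|^{1/2},\qquad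 1/\infty=0.$$ (ii) There is a constant $c>0$, depending only on $d,g$, such that for every $\mathcal A\in Sp(d,\mathbb{R})$ with $\det A\ne0$ and $\det B\neq0$ the operator $\mu(\mathcal A)$ exists, maps $W(\mathcal FL^\infty,L^1)$ into $W(\mathcal FL^1,L^\infty)$, and satisfies, for all $f\in W(\mathcal FL^\infty,L^1)$, $$\|\mu(\mathcal A)f\|_{W(\mathcal FL^1,L^\infty)}\le c\,\beta(\mathcal A)\,\|f\|_{W(\mathcal FL^\infty,L^1)},$$ $$\beta(\mathcal A)=|\det A|^{-3/2}\,|\det B|^{-1}\,\big|\det\big((I+A^*A)(B+iA)(A+iC)\big)\big|^{1/2}.$$ -/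

import Mathlib

open MeasureTheory
open scoped SchwartzMap ENNReal

noncomputable section

namespace Metaplectic

/-- The Euclidean space `ℝᵈ`. -/
abbrev Rd (d : ℕ) : Type := EuclideanSpace ℝ (Fin d)

/-! ### Wiener amalgam spaces -/

/-- The character `y ↦ e^{-2π i y·ξ}`. -/
def char {d : ℕ} (ξ : Rd d) (y : Rd d) : ℂ :=
  Complex.exp (-(2 * Real.pi * inner ℝ y ξ : ℝ) * Complex.I)

theorem iteratedDeriv_exp_mul_I (n : ℕ) :
    iteratedDeriv n (fun t : ℝ => Complex.exp (t * Complex.I)) =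
      fun t : ℝ => Complex.I ^ n * Complex.exp (t * Complex.I) := by
  induction n with
  | zero => simp
  | succ n ih =>
    rw [iteratedDeriv_succ, ih]
    funext t
    have h : HasDerivAt (fun t : ℝ => Complex.exp (t * Complex.I))
        (Complex.exp (t * Complex.I) * (1 * Complex.I)) t :=
      ((Complex.ofRealCLM.hasDerivAt (x := t)).mul_const Complex.I).cexp
    rw [(h.const_mul (Complex.I ^ n)).deriv]
    ring

theorem exp_mul_I_hasTemperateGrowth :
    (fun t : ℝ => Complex.exp (t * Complex.I)).HasTemperateGrowth := by
  refine ⟨(Complex.ofRealCLM.contDiff.mul contDiff_const).cexp, fun n => ⟨0, 1, fun t => ?_⟩⟩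
  rw [norm_iteratedFDeriv_eq_norm_iteratedDeriv, iteratedDeriv_exp_mul_I]
  simp [Complex.norm_exp_ofReal_mul_I]

theorem char_hasTemperateGrowth {d : ℕ} (ξ : Rd d) : (char ξ).HasTemperateGrowth := by
  have h : (fun y : Rd d => -(2 * Real.pi * inner ℝ y ξ)).HasTemperateGrowth := by fun_prop
  refine (congrArg Function.HasTemperateGrowth ?_).mp (exp_mul_I_hasTemperateGrowth.comp h)
  funext y
  simp [char]

/-- The Schwartz function `y ↦ e^{-2π i y·ξ} g(y - x)`. -/
def timeFreqShift {d : ℕ} (g : 𝓢(Rd d, ℂ)) (x ξ : Rd d) : 𝓢(Rd d, ℂ) :=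
  SchwartzMap.smulLeftCLM ℂ (char ξ) (SchwartzMap.compSubConstCLM ℂ x g)

theorem timeFreqShift_apply {d : ℕ} (g : 𝓢(Rd d, ℂ)) (x ξ y : Rd d) :
    timeFreqShift g x ξ y = char ξ y * g (y - x) := by
  simp [timeFreqShift, SchwartzMap.smulLeftCLM_apply_apply (char_hasTemperateGrowth ξ)]

/-- The short-time Fourier transform `V_g f(x, ξ) = ∫ e^{-2π i ξ·y} f(y) g(y - x) dy` of a tempered
distribution: the Fourier transform of `f T_x g`, evaluated at `ξ`. -/
def stft {d : ℕ} (g : 𝓢(Rd d, ℂ)) (f : 𝓢'(Rd d, ℂ)) (x ξ : Rd d) : ℂ :=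
  f (timeFreqShift g x ξ)

/-- The local part `x ↦ ‖f T_x g‖_{𝓕L^p}`, where `‖h‖_{𝓕L^p} = ‖𝓕 h‖_{L^p}`. -/
def localNorm {d : ℕ} (g : 𝓢(Rd d, ℂ)) (p : ℝ≥0∞) (f : 𝓢'(Rd d, ℂ)) (x : Rd d) : ℝ≥0∞ :=
  eLpNorm (fun ξ : Rd d => stft g f x ξ) p volume

/-- The norm `‖f‖_{W(𝓕L^p, L^q)} = ‖ ‖f T_x g‖_{𝓕L^p} ‖_{L^q_x}` (infinite when `f` does not belong
to the space), computed with the window `g`. -/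
def amalgamNorm {d : ℕ} (g : 𝓢(Rd d, ℂ)) (p q : ℝ≥0∞) (f : 𝓢'(Rd d, ℂ)) : ℝ≥0∞ :=
  eLpNorm (fun x : Rd d => localNorm g p f x) q volume

/-- The Wiener amalgam space `W(𝓕L^p, L^q)(ℝᵈ)`, with window `g`. -/
def amalgam {d : ℕ} (g : 𝓢(Rd d, ℂ)) (p q : ℝ≥0∞) : Set 𝓢'(Rd d, ℂ) :=
  {f | amalgamNorm g p q f < ∞}

/-- Admissible windows: smooth, compactly supported, of `L²` norm one. -/
structure IsWindow {d : ℕ} (g : 𝓢(Rd d, ℂ)) : Prop where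
  compactSupport : HasCompactSupport (g : Rd d → ℂ)
  norm_one : eLpNorm (g : Rd d → ℂ) 2 volume = 1

/-! ### The metaplectic representation -/

/-- The Hilbert space `L²(ℝᵈ)`. -/
abbrev L2 (d : ℕ) : Type := Lp ℂ 2 (volume : Measure (Rd d))

/-- The unimodular factor `e^{2π i x·b + π i a·b}`. -/
def phase {d : ℕ} (a b x : Rd d) : ℂ :=
  Complex.exp ((2 * Real.pi * inner ℝ x b + Real.pi * inner ℝ a b : ℝ) * Complex.I)

theorem memLp_schrodinger {d : ℕ} (a b : Rd d) (f : L2 d) :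
    MemLp (fun x => phase a b x * f (x + a)) 2 volume := by
  have h : MemLp (fun x => f (x + a)) 2 volume :=
    (Lp.memLp f).comp_measurePreserving (measurePreserving_add_right volume a)
  have hc : Continuous (phase a b) := by unfold phase; fun_prop
  refine h.of_le (hc.aestronglyMeasurable.mul h.1) (Filter.Eventually.of_forall fun x => ?_)
  rw [norm_mul, phase, Complex.norm_exp_ofReal_mul_I, one_mul]

/-- The Schrödinger representation on `L²(ℝᵈ)`:
`ρ(a, b) f(x) = e^{2π i x·b + π i a·b} f(x + a)`, for `(a, b)` in the phase space `ℝᵈ × ℝᵈ`. -/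
def schrodinger {d : ℕ} (a b : Rd d) (f : L2 d) : L2 d :=
  (memLp_schrodinger a b f).toLp _

/-- `U` implements the symplectic matrix `M = (A B; C D)`:
`U ρ(z) U⁻¹ = ρ(M z)` for every `z = (a, b)` in phase space. -/
def Intertwines {d : ℕ} (M : Matrix (Fin d ⊕ Fin d) (Fin d ⊕ Fin d) ℝ)
    (U : L2 d ≃ₗᵢ[ℂ] L2 d) : Prop :=
  ∀ (a b : Rd d) (f : L2 d),
    U (schrodinger a b f) =
      schrodinger
        (M.toBlocks₁₁.toEuclideanLin a + M.toBlocks₁₂.toEuclideanLin b)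
        (M.toBlocks₂₁.toEuclideanLin a + M.toBlocks₂₂.toEuclideanLin b) (U f)

/-- `T` is the metaplectic operator `μ(M)`, acting on tempered distributions: the weak-* continuous
linear extension of a unitary operator on `L²(ℝᵈ)` that implements `M`. By irreducibility of the
Schrödinger representation, `M` determines this operator up to a factor of modulus one; the two
values `±μ(M)` of the representation of the double cover are among its multiples. -/
def IsMetaplectic {d : ℕ} (M : Matrix (Fin d ⊕ Fin d) (Fin d ⊕ Fin d) ℝ)
    (T : 𝓢'(Rd d, ℂ) →L[ℂ] 𝓢'(Rd d, ℂ)) : Prop :=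
  ∃ U : L2 d ≃ₗᵢ[ℂ] L2 d, Intertwines M U ∧
    ∀ f : L2 d, T (Lp.toTemperedDistribution f) = Lp.toTemperedDistribution (U f)

/-! ### The constants -/

/-- A real matrix, regarded as a complex one. -/
abbrev toC {d : ℕ} (A : Matrix (Fin d) (Fin d) ℝ) : Matrix (Fin d) (Fin d) ℂ :=
  A.map Complex.ofReal

/-- `α(𝒜,p,q) = |det B|^{1/q-1/p-3/2} |det (I+B*B)(B+iA)(B+iD)|^{1/2}`, with `1/∞ = 0`. -/
def alpha {d : ℕ} (A B D : Matrix (Fin d) (Fin d) ℝ) (p q : ℝ≥0∞) : ℝ :=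
  |B.det| ^ ((q⁻¹).toReal - (p⁻¹).toReal - 3 / 2 : ℝ) *
    ‖((1 + toC B.transpose * toC B) * (toC B + Complex.I • toC A) *
      (toC B + Complex.I • toC D)).det‖ ^ (1 / 2 : ℝ)

/-- `β(𝒜) = |det A|^{-3/2} |det B|^{-1} |det (I+A*A)(B+iA)(A+iC)|^{1/2}`. -/
def beta {d : ℕ} (A B C : Matrix (Fin d) (Fin d) ℝ) : ℝ :=
  |A.det| ^ (-3 / 2 : ℝ) * |B.det|⁻¹ *
    ‖((1 + toC A.transpose * toC A) * (toC B + Complex.I • toC A) *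
      (toC A + Complex.I • toC C)).det‖ ^ (1 / 2 : ℝ)

end Metaplectic

end

/-!
The boundedness of `μ(𝒜)` from `W(𝓕L^q, L^p)` to `W(𝓕L^p, L^q)` comes from the covariance of the
short-time Fourier transform. If `S` denotes the transpose of `μ(𝒜)`, acting on Schwartz functions,
then `S` maps time-frequency shifts to time-frequency shifts, whence
`|V_g(μ(𝒜)f)(z)| = |V_{Sg} f(N z)|` with a linear map `N` of phase space, the action of `𝒜⁻¹` up to
signs (`Implements.enorm_apply_eq`). When `B` is invertible, `N(x, ξ) = (u, -B⁻¹x + B⁻¹A u)` with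
`u = Bᵀ(ξ + DB⁻¹x)`: at fixed `x`, the inner variable `ξ` is carried to the position, and `x` then
moves the frequency. The norm `L^q_x L^p_ξ` thereby becomes the one in the opposite order, which
for `p ≤ q` is bounded by `L^p_u L^q_v` through Minkowski's inequality, and the Jacobians give
`|det B|^{1/q-1/p}` (`eLpNorm_eLpNorm_comp_le`, `amalgamNorm_apply_le`). It remains to replace the
window `Sg` by `g`. By Moyal's formula `V_{Sg} f` is dominated by a convolution of `V_g f` with
`V_{ḡ}(Sg)`, so this costs the `L¹` norm of `V_{ḡ}(Sg)` on phase space, a norm of `Sg` in the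
modulation space `M¹` (`amalgamNorm_mul_le`). The same argument replaces `g` by a Gaussian
(`Implements.modNorm_conj_le`).

For the Gaussian, these `M¹` norms are submultiplicative under composition
(`Implements.modNorm_comp_le`), so it suffices to treat the generators of the symplectic group:
chirps, dilations and the Fourier transform. Their images of the Gaussian are Gaussians with a
diagonalizable quadratic form, and the `M¹` norms are explicit (`modNorm_gaussian`): a chirp with
matrix `Q` contributes at most a constant times `|det(1 + iQ)|^{1/2}`, a dilation by `L` contributes
`det(1 + LᵀL)^{1/2} |det L|^{-1/2}`, and the Fourier transform fixes the Gaussian. The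
factorization of `𝒜` through `DB⁻¹`, `B`, `B⁻¹A` gives `α`; the factorization through `CA⁻¹`, `A`,
`A⁻¹B` gives `β`.

The factorizations also construct `μ(𝒜)` (`Implements.isMetaplectic`). Any other operator
intertwining the Schrödinger representation in the same way differs from it by a unimodular factor
(`exists_smul_of_commute`, a form of Schur's lemma that follows from Moyal's formula). To have that
formula for tempered distributions, and the uniqueness of the extension to them, a distribution is
approximated by Schwartz functions with an error controlled by one continuous seminorm
(`exists_approx`): by Hilbert space duality it is a finite sum of transposed operators applied to
`L²` functions, and these are limits of Schwartz functions.
-/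

namespace Metaplectic

open Filter Topology FourierTransform LineDeriv

/-! ### Tempered distributions as limits of Schwartz functions -/

/-- The embedding of the Schwartz space into `L²`. -/
noncomputable def toL2 {d : ℕ} : 𝓢(Rd d, ℂ) →L[ℂ] L2 d := SchwartzMap.toLpCLM ℂ ℂ 2 volume

theorem norm_toL2 {d : ℕ} (φ : 𝓢(Rd d, ℂ)) : ‖toL2 φ‖ = (eLpNorm φ 2 volume).toReal :=
  SchwartzMap.norm_toLp

theorem denseRange_toL2 {d : ℕ} : DenseRange (toL2 : 𝓢(Rd d, ℂ) → L2 d) :=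
  SchwartzMap.denseRange_toLpCLM ENNReal.ofNat_ne_top

theorem inner_toL2 {d : ℕ} (φ ψ : 𝓢(Rd d, ℂ)) :
    inner ℂ (toL2 φ) (toL2 ψ) = ∫ x, inner ℂ (φ x) (ψ x) :=
  SchwartzMap.inner_toL2_toL2_eq φ ψ

/-- The polynomial weight `(1 + ‖x‖²)ⁿ`, complex valued. -/
noncomputable def weight {d : ℕ} (n : ℕ) (x : Rd d) : ℂ := (((1 + ‖x‖ ^ 2) ^ n : ℝ) : ℂ)

theorem weight_hasTemperateGrowth {d : ℕ} (n : ℕ) : (weight n : Rd d → ℂ).HasTemperateGrowth := by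
  have h : (fun x : Rd d => (1 + ‖x‖ ^ 2) ^ n).HasTemperateGrowth :=
    ((Function.HasTemperateGrowth.const 1).add
      (Function.hasTemperateGrowth_norm_sq (Rd d))).pow n
  exact (Function.RCLike.hasTemperateGrowth_ofReal ℂ).comp h

theorem norm_weight {d : ℕ} (n : ℕ) (x : Rd d) : ‖weight n x‖ = (1 + ‖x‖ ^ 2) ^ n := by
  rw [weight, Complex.norm_real, Real.norm_of_nonneg (by positivity)]

/-- An operator on Schwartz functions that has a transpose for the bilinear pairing
`∫ u φ` and preserves the Schwartz class. -/
def HasTranspose {d : ℕ} (L : 𝓢(Rd d, ℂ) →L[ℂ] 𝓢(Rd d, ℂ)) : Prop :=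
  ∃ L' : 𝓢(Rd d, ℂ) → 𝓢(Rd d, ℂ), ∀ u φ : 𝓢(Rd d, ℂ), ∫ x, u x * L φ x = ∫ x, L' u x * φ x

theorem HasTranspose.comp {d : ℕ} {L₁ L₂ : 𝓢(Rd d, ℂ) →L[ℂ] 𝓢(Rd d, ℂ)}
    (h₁ : HasTranspose L₁) (h₂ : HasTranspose L₂) : HasTranspose (L₁ ∘L L₂) := by
  obtain ⟨L₁', h₁⟩ := h₁
  obtain ⟨L₂', h₂⟩ := h₂
  exact ⟨fun u => L₂' (L₁' u), fun u φ => by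
    rw [ContinuousLinearMap.comp_apply, h₁, h₂]⟩

theorem hasTranspose_smulLeftCLM {d : ℕ} {w : Rd d → ℂ} (hw : w.HasTemperateGrowth) :
    HasTranspose (SchwartzMap.smulLeftCLM ℂ w) := by
  refine ⟨fun u => SchwartzMap.smulLeftCLM ℂ w u, fun u φ => ?_⟩
  simp only [SchwartzMap.smulLeftCLM_apply_apply hw, smul_eq_mul]
  congr with x
  ring

theorem hasTranspose_fourierInv {d : ℕ} :
    HasTranspose (fourierInvCLM ℂ 𝓢(Rd d, ℂ)) :=
  ⟨fun u => 𝓕⁻ u, fun u φ => by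
    simpa using (SchwartzMap.integral_fourierInv_mul_eq u φ).symm⟩

theorem hasTranspose_lineDerivOp {d : ℕ} (m : Rd d) :
    HasTranspose (lineDerivOpCLM ℂ 𝓢(Rd d, ℂ) m) :=
  ⟨fun u => -∂_{m} u, fun u φ => by
    simp [SchwartzMap.integral_mul_lineDerivOp_right_eq_neg_left, integral_neg]⟩

theorem hasTranspose_id {d : ℕ} : HasTranspose (ContinuousLinearMap.id ℂ 𝓢(Rd d, ℂ)) :=
  ⟨fun u => u, fun _ _ => rfl⟩

theorem hasTranspose_iteratedLineDerivOp {d : ℕ} {n : ℕ} (m : Fin n → Rd d) :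
    HasTranspose (iteratedLineDerivOpCLM ℂ 𝓢(Rd d, ℂ) m) := by
  induction n with
  | zero =>
    refine (congrArg HasTranspose ?_).mpr hasTranspose_id
    ext φ x
    simp
  | succ n ih =>
    refine (congrArg HasTranspose ?_).mpr
      ((hasTranspose_lineDerivOp (m 0)).comp (ih (Fin.tail m)))
    ext φ x
    simp [iteratedLineDerivOp_succ_left]

/-- Schwartz functions are bounded by a weighted `L²` norm of their Fourier transform. -/
theorem exists_norm_le_toLp_weight_fourierInv (d : ℕ) :
    ∃ C : ℝ, 0 ≤ C ∧ ∀ (φ : 𝓢(Rd d, ℂ)) (x : Rd d),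
      ‖φ x‖ ≤ C * ‖toL2 (SchwartzMap.smulLeftCLM ℂ (weight (d + 1)) (𝓕⁻ φ))‖ := by
  have hint : MemLp (fun x : Rd d => (((1 + ‖x‖ ^ 2) ^ (d + 1) : ℝ)⁻¹ : ℝ)) 2 volume := by
    rw [memLp_two_iff_integrable_sq (Measurable.aestronglyMeasurable (by fun_prop))]
    have h : (Module.finrank ℝ (Rd d) : ℝ) < 4 * (d + 1) := by
      simp only [finrank_euclideanSpace, Fintype.card_fin]
      have : (0 : ℝ) ≤ d := by positivity
      linarith
    refine (integrable_rpow_neg_one_add_norm_sq h).congr (Filter.Eventually.of_forall fun x => ?_)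
    have hx : 0 < 1 + ‖x‖ ^ 2 := by positivity
    have he : (-(4 * ((d : ℝ) + 1)) / 2) = -(((d + 1) * 2 : ℕ) : ℝ) := by push_cast; ring
    simp only
    rw [he, Real.rpow_neg hx.le, Real.rpow_natCast, inv_pow, ← pow_mul]
  refine ⟨(eLpNorm (fun x : Rd d => (((1 + ‖x‖ ^ 2) ^ (d + 1) : ℝ)⁻¹ : ℝ)) 2 volume).toReal,
    ENNReal.toReal_nonneg, fun φ x => ?_⟩
  have h1 : ‖φ x‖ ≤ ‖(𝓕⁻ φ).toLp 1‖ := by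
    have := SchwartzMap.norm_fourier_apply_le_toLp_one (𝓕⁻ φ) x
    rwa [fourier_fourierInv_eq] at this
  refine h1.trans ?_
  rw [SchwartzMap.norm_toLp, norm_toL2, ← ENNReal.toReal_mul]
  refine ENNReal.toReal_mono (ENNReal.mul_ne_top hint.2.ne (SchwartzMap.eLpNorm_lt_top _ _ _).ne) ?_
  have h2 : ((𝓕⁻ φ : 𝓢(Rd d, ℂ)) : Rd d → ℂ) =
      (fun x : Rd d => (((1 + ‖x‖ ^ 2) ^ (d + 1) : ℝ)⁻¹ : ℝ)) •
      (SchwartzMap.smulLeftCLM ℂ (weight (d + 1)) (𝓕⁻ φ) : Rd d → ℂ) := by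
    funext y
    have hy : (1 + ‖y‖ ^ 2) ^ (d + 1) ≠ 0 := by positivity
    simp only [Pi.smul_apply', SchwartzMap.smulLeftCLM_apply_apply (weight_hasTemperateGrowth _),
      weight, smul_eq_mul, Complex.real_smul]
    rw [← mul_assoc, ← Complex.ofReal_mul, inv_mul_cancel₀ hy, Complex.ofReal_one, one_mul]
  conv_lhs => rw [h2]
  exact eLpNorm_smul_le_mul_eLpNorm (SchwartzMap.memLp _ 2 volume).1 hint.1

/-- A multilinear map on Euclidean space is bounded by the sum of its values at tuples of basis
vectors. -/
theorem norm_continuousMultilinearMap_le_sum {d n : ℕ}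
    (M : ContinuousMultilinearMap ℝ (fun _ : Fin n => Rd d) ℂ) :
    ‖M‖ ≤ ∑ m : Fin n → Fin d, ‖M fun i => EuclideanSpace.single (m i) 1‖ := by
  refine ContinuousMultilinearMap.opNorm_le_bound (by positivity) fun v => ?_
  have hv : v = fun i => ∑ j : Fin d, v i j • (EuclideanSpace.single j 1 : Rd d) := by
    funext i
    ext k
    simp [Finset.sum_apply, Pi.single_apply]
  have h : M v = ∑ m : Fin n → Fin d,
      (∏ i, v i (m i)) • M fun i => EuclideanSpace.single (m i) 1 := by
    conv_lhs => rw [hv]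
    rw [ContinuousMultilinearMap.map_sum]
    refine Finset.sum_congr rfl fun m _ => ?_
    rw [ContinuousMultilinearMap.map_smul_univ]
  rw [h, Finset.sum_mul]
  refine (norm_sum_le _ _).trans (Finset.sum_le_sum fun m _ => ?_)
  rw [norm_smul, mul_comm, norm_prod]
  gcongr with i
  exact PiLp.norm_apply_le (v i) (m i)

/-- The operators `φ ↦ (1 + ‖·‖²)ᵈ⁺¹ 𝓕⁻((1 + ‖·‖²)ᵏ ∂^m φ)`, whose `L²` norms generate the topology
of the Schwartz space. -/
noncomputable def sobolevOp {d : ℕ} (k : ℕ) {n : ℕ} (m : Fin n → Fin d) :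
    𝓢(Rd d, ℂ) →L[ℂ] 𝓢(Rd d, ℂ) :=
  (SchwartzMap.smulLeftCLM ℂ (weight (d + 1))) ∘L (fourierInvCLM ℂ 𝓢(Rd d, ℂ)) ∘L
    (SchwartzMap.smulLeftCLM ℂ (weight k)) ∘L
      (iteratedLineDerivOpCLM ℂ 𝓢(Rd d, ℂ) fun i => (EuclideanSpace.single (m i) 1 : Rd d))

theorem sobolevOp_apply {d : ℕ} (k : ℕ) {n : ℕ} (m : Fin n → Fin d) (φ : 𝓢(Rd d, ℂ)) :
    sobolevOp k m φ = SchwartzMap.smulLeftCLM ℂ (weight (d + 1)) (𝓕⁻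
      (SchwartzMap.smulLeftCLM ℂ (weight k)
        (∂^{fun i => (EuclideanSpace.single (m i) 1 : Rd d)} φ))) := by
  simp [sobolevOp]

theorem hasTranspose_sobolevOp {d : ℕ} (k : ℕ) {n : ℕ} (m : Fin n → Fin d) :
    HasTranspose (sobolevOp k m) :=
  (hasTranspose_smulLeftCLM (weight_hasTemperateGrowth _)).comp
    (hasTranspose_fourierInv.comp
      ((hasTranspose_smulLeftCLM (weight_hasTemperateGrowth _)).comp
        (hasTranspose_iteratedLineDerivOp _)))

/-- The seminorms of the Schwartz space are bounded by `L²` norms, which makes Hilbert space duality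
available. -/
theorem exists_seminorm_le_sobolevOp (d k n : ℕ) :
    ∃ C : ℝ, 0 ≤ C ∧ ∀ φ : 𝓢(Rd d, ℂ),
      SchwartzMap.seminorm ℂ k n φ ≤
        C * ∑ m : Fin n → Fin d, ‖toL2 (sobolevOp k m φ)‖ := by
  obtain ⟨C, hC, h⟩ := exists_norm_le_toLp_weight_fourierInv d
  refine ⟨C, hC, fun φ => SchwartzMap.seminorm_le_bound ℂ k n φ (by positivity) fun x => ?_⟩
  have hx : ‖x‖ ^ k ≤ ‖weight k x‖ := by
    rw [norm_weight]
    refine pow_le_pow_left₀ (norm_nonneg _) ?_ k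
    nlinarith [sq_nonneg (‖x‖ - 1)]
  calc ‖x‖ ^ k * ‖iteratedFDeriv ℝ n φ x‖
      ≤ ‖weight k x‖ * ∑ m : Fin n → Fin d,
          ‖iteratedFDeriv ℝ n φ x fun i => EuclideanSpace.single (m i) 1‖ := by
        gcongr
        exact norm_continuousMultilinearMap_le_sum _
    _ = ∑ m : Fin n → Fin d, ‖SchwartzMap.smulLeftCLM ℂ (weight k)
          (∂^{fun i => (EuclideanSpace.single (m i) 1 : Rd d)} φ) x‖ := by
        rw [Finset.mul_sum]
        refine Finset.sum_congr rfl fun m _ => ?_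
        rw [SchwartzMap.smulLeftCLM_apply_apply (weight_hasTemperateGrowth _), norm_smul,
          SchwartzMap.iteratedLineDerivOp_eq_iteratedFDeriv]
    _ ≤ ∑ m : Fin n → Fin d, C * ‖toL2 (sobolevOp k m φ)‖ := by
        refine Finset.sum_le_sum fun m _ => ?_
        rw [sobolevOp_apply]
        exact h _ x
    _ = _ := by rw [Finset.mul_sum]

/-- The complex conjugate of a Schwartz function. -/
noncomputable def conj {d : ℕ} (φ : 𝓢(Rd d, ℂ)) : 𝓢(Rd d, ℂ) :=
  SchwartzMap.postcompCLM (𝕜 := ℝ) (Complex.conjCLE : ℂ →L[ℝ] ℂ) φ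

@[simp]
theorem conj_apply {d : ℕ} (φ : 𝓢(Rd d, ℂ)) (x : Rd d) : conj φ x = starRingEnd ℂ (φ x) := by
  simp [conj]

theorem seminorm_sum_apply {𝕜 E ι : Type*} [NormedField 𝕜] [AddCommGroup E] [Module 𝕜 E]
    (p : ι → Seminorm 𝕜 E) (s : Finset ι) (x : E) : (∑ i ∈ s, p i) x = ∑ i ∈ s, p i x := by
  rw [FunLike.coe_sum, Finset.sum_apply]

/-- A tempered distribution is bounded by finitely many of the `L²` norms of Sobolev type. -/
theorem exists_norm_le_sum_sobolev {d : ℕ} (f : 𝓢'(Rd d, ℂ)) :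
    ∃ (ι : Type) (_ : Fintype ι) (L : ι → 𝓢(Rd d, ℂ) →L[ℂ] 𝓢(Rd d, ℂ)) (C : ℝ),
      0 ≤ C ∧ (∀ i, HasTranspose (L i)) ∧ ∀ φ, ‖f φ‖ ≤ C * ∑ i, ‖toL2 (L i φ)‖ := by
  let fl : 𝓢(Rd d, ℂ) →ₗ[ℂ] ℂ := (f : 𝓢(Rd d, ℂ) →ₗ[ℂ] ℂ)
  have hcont : Continuous ((normSeminorm ℂ ℂ).comp fl) :=
    continuous_norm.comp (map_continuous f)
  obtain ⟨s, C, -, hC⟩ := Seminorm.bound_of_continuous (schwartz_withSeminorms ℂ (Rd d) ℂ) _ hcont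
  choose D hD0 hD using fun kn : ℕ × ℕ => exists_seminorm_le_sobolevOp d kn.1 kn.2
  refine ⟨Σ kn : s, (Fin kn.1.2 → Fin d), inferInstance, fun i => sobolevOp i.1.1.1 i.2,
    C * ∑ kn ∈ s, D kn, mul_nonneg C.2 (Finset.sum_nonneg fun _ _ => hD0 _),
    fun i => hasTranspose_sobolevOp _ _, fun φ => ?_⟩
  have h1 : ‖f φ‖ ≤ C * (s.sup (schwartzSeminormFamily ℂ (Rd d) ℂ)) φ := hC φ
  refine h1.trans ?_
  rw [mul_assoc]
  refine mul_le_mul_of_nonneg_left ?_ C.2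
  rw [Finset.sum_mul]
  refine (Seminorm.le_def.1 (Seminorm.finset_sup_le_sum _ s) φ).trans ?_
  rw [seminorm_sum_apply]
  refine Finset.sum_le_sum fun kn hkn => (hD kn φ).trans ?_
  refine mul_le_mul_of_nonneg_left ?_ (hD0 kn)
  rw [Fintype.sum_sigma]
  exact Finset.single_le_sum (f := fun kn : s =>
    ∑ m : Fin kn.1.2 → Fin d, ‖toL2 (sobolevOp kn.1.1 m φ)‖)
    (fun _ _ => Finset.sum_nonneg fun _ _ => norm_nonneg _) (Finset.mem_univ (⟨kn, hkn⟩ : s))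

/-- A functional bounded by finitely many `L²` norms is represented by `L²` functions. -/
theorem exists_eq_sum_inner {d : ℕ} (f : 𝓢'(Rd d, ℂ)) {ι : Type} [Fintype ι]
    (L : ι → 𝓢(Rd d, ℂ) →L[ℂ] 𝓢(Rd d, ℂ)) {C : ℝ} (hC : 0 ≤ C)
    (h : ∀ φ, ‖f φ‖ ≤ C * ∑ i, ‖toL2 (L i φ)‖) :
    ∃ F : ι → L2 d, ∀ φ, f φ = ∑ i, inner ℂ (F i) (toL2 (L i φ)) := by
  let J : 𝓢(Rd d, ℂ) →ₗ[ℂ] PiLp 2 (fun _ : ι => L2 d) :=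
    { toFun := fun φ => WithLp.toLp 2 fun i => toL2 (L i φ)
      map_add' := fun a b => by ext1 i; simp
      map_smul' := fun c a => by ext1 i; simp }
  let fl : 𝓢(Rd d, ℂ) →ₗ[ℂ] ℂ := (f : 𝓢(Rd d, ℂ) →ₗ[ℂ] ℂ)
  have hdense : DenseRange J.rangeRestrict := J.surjective_rangeRestrict.denseRange
  have hb : ∀ φ, ‖fl φ‖ ≤ (C * Fintype.card ι) * ‖J.rangeRestrict φ‖ := fun φ => by
    refine (h φ).trans ?_
    rw [mul_assoc]
    refine mul_le_mul_of_nonneg_left ?_ hC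
    rw [← nsmul_eq_mul, ← Finset.card_univ]
    refine Finset.sum_le_card_nsmul _ _ _ fun i _ => ?_
    exact PiLp.norm_apply_le (J φ) i
  obtain ⟨G, hG, -⟩ := exists_extension_norm_eq (𝕜 := ℂ) _ (fl.extendOfNorm J.rangeRestrict)
  refine ⟨fun i => (InnerProductSpace.toDual ℂ _).symm G i, fun φ => ?_⟩
  have h1 : G (J φ) = f φ := by
    have := hG (J.rangeRestrict φ)
    rw [LinearMap.extendOfNorm_eq hdense ⟨_, hb⟩] at this
    exact this
  have h2 : G (J φ) = inner ℂ ((InnerProductSpace.toDual ℂ _).symm G) (J φ) :=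
    (InnerProductSpace.toDual_symm_apply).symm
  rw [← h1, h2, PiLp.inner_apply]
  rfl

/-- Schwartz functions are dense in the tempered distributions, with an error controlled by a
single continuous seminorm. -/
theorem exists_approx {d : ℕ} (f : 𝓢'(Rd d, ℂ)) :
    ∃ q : Seminorm ℂ 𝓢(Rd d, ℂ), Continuous q ∧
      ∀ ε : ℝ, 0 < ε → ∃ u : 𝓢(Rd d, ℂ), ∀ φ : 𝓢(Rd d, ℂ),
        ‖f φ - ∫ x, u x * φ x‖ ≤ ε * q φ := by
  obtain ⟨ι, _, L, C, hC, hL, hf⟩ := exists_norm_le_sum_sobolev f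
  obtain ⟨F, hF⟩ := exists_eq_sum_inner f L hC hf
  choose L' hL' using hL
  let q : Seminorm ℂ 𝓢(Rd d, ℂ) := ∑ i, (normSeminorm ℂ (L2 d)).comp
    ((toL2 ∘L L i : 𝓢(Rd d, ℂ) →L[ℂ] L2 d) : 𝓢(Rd d, ℂ) →ₗ[ℂ] L2 d)
  have hq : ∀ φ, q φ = ∑ i, ‖toL2 (L i φ)‖ := fun φ => by
    rw [seminorm_sum_apply]; rfl
  refine ⟨q, ?_, fun ε hε => ?_⟩
  · rw [show (⇑q : 𝓢(Rd d, ℂ) → ℝ) = _ from funext hq]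
    exact continuous_finsetSum _ fun i _ => continuous_norm.comp (toL2 ∘L L i).continuous
  have hu : ∀ i, ∃ u : 𝓢(Rd d, ℂ), ‖F i - toL2 u‖ ≤ ε := fun i => by
    obtain ⟨u, hu⟩ := denseRange_toL2.exists_dist_lt (F i) hε
    exact ⟨u, by rw [← dist_eq_norm]; exact hu.le⟩
  choose u hu using hu
  refine ⟨∑ i, L' i (conj (u i)), fun φ => ?_⟩
  have h1 : ∫ x, (∑ i, L' i (conj (u i))) x * φ x =
      ∑ i, inner ℂ (toL2 (u i)) (toL2 (L i φ)) := by
    simp only [inner_toL2]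
    have : ∀ i, ∫ x, inner ℂ (u i x) (L i φ x) = ∫ x, L' i (conj (u i)) x * φ x := fun i => by
      rw [← hL']
      congr with x
      simp [mul_comm]
    simp only [this]
    rw [← integral_finsetSum]
    · congr with x
      rw [FunLike.coe_sum, Finset.sum_apply, Finset.sum_mul]
    · intro i _
      exact ((L' i (conj (u i))).memLp 2 volume).integrable_mul (φ.memLp 2 volume)
  rw [h1, hF, ← Finset.sum_sub_distrib, hq, Finset.mul_sum]
  refine (norm_sum_le _ _).trans (Finset.sum_le_sum fun i _ => ?_)
  rw [← inner_sub_left]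
  refine (norm_inner_le_norm _ _).trans ?_
  gcongr
  exact hu i

/-! ### Time-frequency shifts of Schwartz functions -/

theorem norm_char {d : ℕ} (ξ y : Rd d) : ‖char ξ y‖ = 1 := by
  have : char ξ y = Complex.exp (((-(2 * Real.pi * inner ℝ y ξ) : ℝ) : ℂ) * Complex.I) := by
    simp [char]
  rw [this, Complex.norm_exp_ofReal_mul_I]

theorem norm_iteratedFDeriv_char_le {d : ℕ} (ξ y : Rd d) (n : ℕ) :
    ‖iteratedFDeriv ℝ n (char ξ) y‖ ≤ (2 * Real.pi * ‖ξ‖) ^ n := by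
  let ℓ : Rd d →L[ℝ] ℝ := (-(2 * Real.pi)) • innerSL ℝ ξ
  have hχ : char ξ = (fun t : ℝ => Complex.exp (t * Complex.I)) ∘ ℓ := by
    funext y
    simp [char, ℓ, real_inner_comm]
  have hℓ : ‖ℓ‖ = 2 * Real.pi * ‖ξ‖ := by
    rw [norm_smul, norm_neg, innerSL_apply_norm, Real.norm_of_nonneg (by positivity)]
  rw [hχ, ContinuousLinearMap.iteratedFDeriv_comp_right ℓ (n := n)
    (exp_mul_I_hasTemperateGrowth.1.of_le (mod_cast le_top)) y le_rfl]
  refine (ContinuousMultilinearMap.norm_compContinuousLinearMap_le _ _).trans ?_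
  rw [norm_iteratedFDeriv_eq_norm_iteratedDeriv, iteratedDeriv_exp_mul_I]
  simp [Complex.norm_exp_ofReal_mul_I, hℓ]

/-- Time-frequency shifts grow polynomially in the topology of the Schwartz space. -/
theorem exists_seminorm_timeFreqShift_le {d : ℕ} (g : 𝓢(Rd d, ℂ)) (k n : ℕ) :
    ∃ C : ℝ, 0 ≤ C ∧ ∀ y η : Rd d, SchwartzMap.seminorm ℂ k n (timeFreqShift g y η) ≤
      C * ((1 + ‖y‖) ^ k * (1 + ‖η‖) ^ n) := by
  obtain ⟨M, hM⟩ : ∃ M : ℝ, ∀ j ≤ n, ∀ x, (1 + ‖x‖) ^ k * ‖iteratedFDeriv ℝ j g x‖ ≤ M :=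
    ⟨_, fun j hj x =>
      SchwartzMap.one_add_le_sup_seminorm_apply (𝕜 := ℂ) (m := (k, n)) le_rfl hj g x⟩
  have hM0 : 0 ≤ M := le_trans (by positivity) (hM 0 (Nat.zero_le _) 0)
  refine ⟨∑ i ∈ Finset.range (n + 1), (n.choose i : ℝ) * ((2 * Real.pi) ^ i * M),
    by positivity, fun y η => ?_⟩
  refine SchwartzMap.seminorm_le_bound ℂ k n _ (by positivity) fun x => ?_
  have hfun : (timeFreqShift g y η : Rd d → ℂ) = fun x => char η x * g (x - y) :=
    funext fun x => timeFreqShift_apply g y η x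
  have hg : ContDiff ℝ n fun x => g (x - y) := (g.smooth n).comp (by fun_prop)
  have h := norm_iteratedFDeriv_mul_le (n := n)
    ((char_hasTemperateGrowth η).1.of_le (by exact_mod_cast le_top)) hg x le_rfl
  have hx : ‖x‖ ^ k ≤ (1 + ‖y‖) ^ k * (1 + ‖x - y‖) ^ k := by
    rw [← mul_pow]
    refine pow_le_pow_left₀ (norm_nonneg _) ?_ k
    have := norm_add_le (x - y) y
    rw [sub_add_cancel] at this
    nlinarith [mul_nonneg (norm_nonneg y) (norm_nonneg (x - y))]
  rw [hfun]
  refine (mul_le_mul_of_nonneg_left h (by positivity)).trans ?_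
  rw [Finset.mul_sum, Finset.sum_mul]
  refine Finset.sum_le_sum fun i hi => ?_
  have hi' : i ≤ n := Nat.lt_succ_iff.1 (Finset.mem_range.1 hi)
  rw [iteratedFDeriv_comp_sub]
  calc ‖x‖ ^ k * (n.choose i * ‖iteratedFDeriv ℝ i (char η) x‖ *
        ‖iteratedFDeriv ℝ (n - i) g (x - y)‖)
      ≤ ((1 + ‖y‖) ^ k * (1 + ‖x - y‖) ^ k) * (n.choose i * (2 * Real.pi * ‖η‖) ^ i *
        ‖iteratedFDeriv ℝ (n - i) g (x - y)‖) := by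
        gcongr
        exact norm_iteratedFDeriv_char_le η x i
    _ = n.choose i * ((2 * Real.pi) ^ i * ((1 + ‖x - y‖) ^ k *
        ‖iteratedFDeriv ℝ (n - i) g (x - y)‖)) * ((1 + ‖y‖) ^ k * ‖η‖ ^ i) := by ring
    _ ≤ n.choose i * ((2 * Real.pi) ^ i * M) * ((1 + ‖y‖) ^ k * (1 + ‖η‖) ^ n) := by
        gcongr
        · exact hM _ (Nat.sub_le _ _) _
        · calc ‖η‖ ^ i ≤ (1 + ‖η‖) ^ i := by gcongr; linarith
            _ ≤ (1 + ‖η‖) ^ n := pow_le_pow_right₀ (by linarith [norm_nonneg η]) hi'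

theorem exists_continuous_seminorm_timeFreqShift_le {d : ℕ} (g : 𝓢(Rd d, ℂ))
    {q : Seminorm ℂ 𝓢(Rd d, ℂ)} (hq : Continuous q) :
    ∃ (C : ℝ) (k : ℕ), 0 ≤ C ∧ ∀ y η : Rd d,
      q (timeFreqShift g y η) ≤ C * ((1 + ‖y‖) ^ k * (1 + ‖η‖) ^ k) := by
  obtain ⟨s, C, -, hC⟩ := Seminorm.bound_of_continuous (schwartz_withSeminorms ℂ (Rd d) ℂ) _ hq
  choose D hD0 hD using fun kn : ℕ × ℕ => exists_seminorm_timeFreqShift_le g kn.1 kn.2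
  refine ⟨C * ∑ kn ∈ s, D kn, ∑ kn ∈ s, (kn.1 + kn.2),
    mul_nonneg C.2 (Finset.sum_nonneg fun _ _ => hD0 _), fun y η => ?_⟩
  refine (hC _).trans ?_
  rw [mul_assoc]
  refine mul_le_mul_of_nonneg_left ?_ C.2
  refine (Seminorm.le_def.1 (Seminorm.finset_sup_le_sum _ s) _).trans ?_
  rw [seminorm_sum_apply, Finset.sum_mul]
  refine Finset.sum_le_sum fun kn hkn => (hD kn y η).trans ?_
  refine mul_le_mul_of_nonneg_left ?_ (hD0 kn)
  have hle : kn.1 + kn.2 ≤ ∑ kn ∈ s, (kn.1 + kn.2) :=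
    Finset.single_le_sum (f := fun kn : ℕ × ℕ => kn.1 + kn.2) (fun _ _ => Nat.zero_le _) hkn
  have h1 : ∀ z : Rd d, 1 ≤ 1 + ‖z‖ := fun z => by linarith [norm_nonneg z]
  gcongr
  · exact h1 y
  · omega
  · exact h1 η
  · omega

/-! ### The short-time Fourier transform of Schwartz functions -/

/-- The product `u · T_x g` as a Schwartz function. -/
noncomputable def mulShift {d : ℕ} (u g : 𝓢(Rd d, ℂ)) (x : Rd d) : 𝓢(Rd d, ℂ) :=
  SchwartzMap.pairing (ContinuousLinearMap.mul ℂ ℂ) u (SchwartzMap.compSubConstCLM ℂ x g)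

theorem mulShift_apply {d : ℕ} (u g : 𝓢(Rd d, ℂ)) (x t : Rd d) :
    mulShift u g x t = u t * g (t - x) := by
  simp [mulShift, SchwartzMap.pairing_apply_apply]

/-- The short-time Fourier transform of a Schwartz function, as a function on phase space. -/
noncomputable def schwartzStft {d : ℕ} (g u : 𝓢(Rd d, ℂ)) (z : Rd d × Rd d) : ℂ :=
  ∫ t, u t * timeFreqShift g z.1 z.2 t

theorem stft_coe {d : ℕ} (g u : 𝓢(Rd d, ℂ)) (x ξ : Rd d) :
    stft g (SchwartzMap.toTemperedDistributionCLM (Rd d) ℂ volume u) x ξ =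
      schwartzStft g u (x, ξ) := by
  refine (SchwartzMap.toTemperedDistributionCLM_apply_apply volume u _).trans ?_
  refine integral_congr_ae (Filter.Eventually.of_forall fun t => ?_)
  simp only [smul_eq_mul, mul_comm]

theorem fourier_apply_eq {d : ℕ} (u : 𝓢(Rd d, ℂ)) (ξ : Rd d) :
    𝓕 u ξ = ∫ t, char ξ t * u t := by
  rw [SchwartzMap.fourier_coe, Real.fourier_eq']
  congr with t
  rw [smul_eq_mul, char]
  congr 2
  push_cast
  ring

theorem fourierInv_apply_eq {d : ℕ} (u : 𝓢(Rd d, ℂ)) (ξ : Rd d) :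
    𝓕⁻ u ξ = ∫ t, char (-ξ) t * u t := by
  rw [SchwartzMap.fourierInv_apply_eq, SchwartzMap.compCLMOfContinuousLinearEquiv_apply]
  exact fourier_apply_eq u (-ξ)

theorem schwartzStft_eq_fourier {d : ℕ} (g u : 𝓢(Rd d, ℂ)) (x ξ : Rd d) :
    schwartzStft g u (x, ξ) = 𝓕 (mulShift u g x) ξ := by
  rw [fourier_apply_eq, schwartzStft]
  congr with t
  rw [timeFreqShift_apply, mulShift_apply]
  ring

theorem char_add_left {d : ℕ} (ξ η y : Rd d) : char (ξ + η) y = char ξ y * char η y := by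
  rw [char, char, char, ← Complex.exp_add]
  congr 1
  rw [inner_add_right]
  push_cast
  ring

theorem char_add_right {d : ℕ} (ξ y z : Rd d) : char ξ (y + z) = char ξ y * char ξ z := by
  rw [char, char, char, ← Complex.exp_add]
  congr 1
  rw [inner_add_left]
  push_cast
  ring

theorem char_comm {d : ℕ} (ξ y : Rd d) : char ξ y = char y ξ := by
  rw [char, char, real_inner_comm]

theorem char_neg_left {d : ℕ} (ξ y : Rd d) : char (-ξ) y = char ξ (-y) := by
  rw [char, char, inner_neg_right, inner_neg_left]

theorem continuous_timeFreqShift_apply {d : ℕ} (g : 𝓢(Rd d, ℂ)) (t : Rd d) :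
    Continuous fun z : Rd d × Rd d => timeFreqShift g z.1 z.2 t := by
  simp only [timeFreqShift_apply]
  have h1 : Continuous fun z : Rd d × Rd d => char z.2 t :=
    by unfold char; fun_prop
  have h2 : Continuous fun z : Rd d × Rd d => g (t - z.1) :=
    (map_continuous g).comp (continuous_const.sub continuous_fst)
  exact h1.mul h2

theorem norm_timeFreqShift_apply {d : ℕ} (g : 𝓢(Rd d, ℂ)) (x ξ t : Rd d) :
    ‖timeFreqShift g x ξ t‖ = ‖g (t - x)‖ := by
  rw [timeFreqShift_apply, norm_mul, norm_char, one_mul]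

theorem continuous_schwartzStft {d : ℕ} (g u : 𝓢(Rd d, ℂ)) : Continuous (schwartzStft g u) := by
  refine continuous_of_dominated (bound := fun t => SchwartzMap.seminorm ℂ 0 0 g * ‖u t‖)
    (fun z => ?_) (fun z => Filter.Eventually.of_forall fun t => ?_) ?_
    (Filter.Eventually.of_forall fun t => ?_)
  · exact (u.continuous.mul (timeFreqShift g z.1 z.2).continuous).aestronglyMeasurable
  · rw [norm_mul, norm_timeFreqShift_apply, mul_comm]
    gcongr
    exact SchwartzMap.norm_le_seminorm ℂ g _
  · exact u.integrable.norm.const_mul _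
  · exact continuous_const.mul (continuous_timeFreqShift_apply g t)

/-- The inverse Fourier transform rotates time-frequency shifts. -/
theorem fourierInv_timeFreqShift {d : ℕ} (g : 𝓢(Rd d, ℂ)) (x ξ : Rd d) :
    𝓕⁻ (timeFreqShift g x ξ) = char ξ x • timeFreqShift (𝓕⁻ g) ξ (-x) := by
  ext s
  rw [smul_apply, timeFreqShift_apply, fourierInv_apply_eq, fourierInv_apply_eq,
    smul_eq_mul, ← integral_const_mul, ← integral_const_mul]
  rw [← integral_add_right_eq_self _ x]
  congr with t
  simp only [timeFreqShift_apply, add_sub_cancel_right, char_add_right]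
  rw [show -(s - ξ) = -s + ξ by abel, char_add_left, char_comm (-x) s, char_neg_left s x]
  ring

/-- The Fourier transform rotates time-frequency shifts. -/
theorem fourier_timeFreqShift {d : ℕ} (g : 𝓢(Rd d, ℂ)) (x ξ : Rd d) :
    𝓕 (timeFreqShift g x ξ) = char ξ x • timeFreqShift (𝓕 g) (-ξ) x := by
  ext s
  rw [smul_apply, timeFreqShift_apply, fourier_apply_eq, fourier_apply_eq,
    smul_eq_mul, ← integral_const_mul, ← integral_const_mul]
  rw [← integral_add_right_eq_self _ x]
  congr with t
  simp only [timeFreqShift_apply, add_sub_cancel_right, char_add_right]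
  rw [show s - -ξ = s + ξ by abel, char_add_left, char_comm x s]
  ring

theorem norm_schwartzStft_eq_fourier {d : ℕ} (g u : 𝓢(Rd d, ℂ)) (x ξ : Rd d) :
    ‖schwartzStft g u (x, ξ)‖ = ‖schwartzStft (𝓕⁻ g) (𝓕 u) (ξ, -x)‖ := by
  have h := SchwartzMap.integral_fourier_mul_eq u (𝓕⁻ (timeFreqShift g x ξ))
  rw [fourier_fourierInv_eq] at h
  rw [schwartzStft, ← h, schwartzStft, fourierInv_timeFreqShift]
  simp only [smul_apply, smul_eq_mul, mul_left_comm _ (char ξ x)]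
  rw [integral_const_mul, norm_mul, norm_char, one_mul]

theorem exists_one_add_norm_pow_le {d : ℕ} (u : 𝓢(Rd d, ℂ)) (k : ℕ) :
    ∃ C : ℝ, 0 ≤ C ∧ ∀ x, (1 + ‖x‖) ^ k * ‖u x‖ ≤ C := by
  have h := fun x =>
    SchwartzMap.one_add_le_sup_seminorm_apply (𝕜 := ℂ) (m := (k, 0)) le_rfl le_rfl u x
  simp only [norm_iteratedFDeriv_zero] at h
  exact ⟨_, le_trans (by positivity) (h 0), h⟩

theorem integrable_one_add_norm_pow_mul {d : ℕ} (u : 𝓢(Rd d, ℂ)) (k : ℕ) :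
    Integrable fun x => (1 + ‖x‖) ^ k * ‖u x‖ := by
  have h : ∀ x : Rd d, (1 + ‖x‖) ^ k * ‖u x‖ =
      ∑ i ∈ Finset.range (k + 1), (k.choose i : ℝ) * (‖x‖ ^ i * ‖u x‖) := fun x => by
    rw [add_comm, add_pow, Finset.sum_mul]
    refine Finset.sum_congr rfl fun i _ => ?_
    rw [one_pow]
    ring
  simp only [h]
  exact integrable_finsetSum _ fun i _ => (u.integrable_pow_mul volume i).const_mul _

/-- Peetre's inequality. -/
theorem one_add_norm_le_mul {d : ℕ} (t x : Rd d) :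
    1 + ‖x‖ ≤ (1 + ‖t‖) * (1 + ‖t - x‖) := by
  have := norm_sub_le t (t - x)
  rw [sub_sub_cancel] at this
  nlinarith [mul_nonneg (norm_nonneg t) (norm_nonneg (t - x))]

theorem exists_norm_schwartzStft_le_fst {d : ℕ} (g u : 𝓢(Rd d, ℂ)) (k : ℕ) :
    ∃ C : ℝ, 0 ≤ C ∧ ∀ x ξ, (1 + ‖x‖) ^ k * ‖schwartzStft g u (x, ξ)‖ ≤ C := by
  obtain ⟨M, hM0, hM⟩ := exists_one_add_norm_pow_le g k
  refine ⟨∫ t, M * ((1 + ‖t‖) ^ k * ‖u t‖), integral_nonneg fun t => by positivity,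
    fun x ξ => ?_⟩
  have h1 : (1 + ‖x‖) ^ k * ‖schwartzStft g u (x, ξ)‖ ≤
      ∫ t, (1 + ‖x‖) ^ k * ‖u t * timeFreqShift g x ξ t‖ := by
    rw [integral_const_mul]
    gcongr
    exact norm_integral_le_integral_norm _
  refine h1.trans (integral_mono_of_nonneg (Filter.Eventually.of_forall fun t => by positivity)
    ((integrable_one_add_norm_pow_mul u k).const_mul M) (Filter.Eventually.of_forall fun t => ?_))
  simp only
  rw [norm_mul, norm_timeFreqShift_apply]
  calc (1 + ‖x‖) ^ k * (‖u t‖ * ‖g (t - x)‖)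
      ≤ ((1 + ‖t‖) * (1 + ‖t - x‖)) ^ k * (‖u t‖ * ‖g (t - x)‖) := by
        gcongr
        exact one_add_norm_le_mul t x
    _ = ((1 + ‖t - x‖) ^ k * ‖g (t - x)‖) * ((1 + ‖t‖) ^ k * ‖u t‖) := by
        rw [mul_pow]; ring
    _ ≤ _ := by
        gcongr
        exact hM _

theorem exists_norm_schwartzStft_le_snd {d : ℕ} (g u : 𝓢(Rd d, ℂ)) (k : ℕ) :
    ∃ C : ℝ, 0 ≤ C ∧ ∀ x ξ, (1 + ‖ξ‖) ^ k * ‖schwartzStft g u (x, ξ)‖ ≤ C := by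
  obtain ⟨C, hC, h⟩ := exists_norm_schwartzStft_le_fst (𝓕⁻ g) (𝓕 u) k
  exact ⟨C, hC, fun x ξ => by rw [norm_schwartzStft_eq_fourier]; exact h ξ (-x)⟩

/-- The short-time Fourier transform of a Schwartz function decays rapidly on phase space. It is
enough to have decay in each variable separately, by taking geometric means. -/
theorem exists_norm_schwartzStft_le {d : ℕ} (g u : 𝓢(Rd d, ℂ)) (k : ℕ) :
    ∃ C : ℝ, 0 ≤ C ∧ ∀ x ξ,
      ((1 + ‖x‖) ^ k * (1 + ‖ξ‖) ^ k) * ‖schwartzStft g u (x, ξ)‖ ≤ C := by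
  obtain ⟨C₁, hC₁, h₁⟩ := exists_norm_schwartzStft_le_fst g u (2 * k)
  obtain ⟨C₂, hC₂, h₂⟩ := exists_norm_schwartzStft_le_snd g u (2 * k)
  refine ⟨Real.sqrt (C₁ * C₂), Real.sqrt_nonneg _, fun x ξ => Real.le_sqrt_of_sq_le ?_⟩
  refine le_trans (le_of_eq ?_) (mul_le_mul (h₁ x ξ) (h₂ x ξ) (by positivity) hC₁)
  rw [pow_mul', pow_mul']
  ring

theorem integrable_pow_mul_schwartzStft {d : ℕ} (g u : 𝓢(Rd d, ℂ)) (k : ℕ) :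
    Integrable fun z : Rd d × Rd d =>
      ((1 + ‖z.1‖) ^ k * (1 + ‖z.2‖) ^ k) * ‖schwartzStft g u z‖ := by
  obtain ⟨C, hC, h⟩ := exists_norm_schwartzStft_le g u (k + (d + 1))
  have hI : Integrable fun x : Rd d => ((1 + ‖x‖) ^ (d + 1))⁻¹ := by
    have : (Module.finrank ℝ (Rd d) : ℝ) < ((d + 1 : ℕ) : ℝ) := by simp
    refine (integrable_one_add_norm this).congr (Filter.Eventually.of_forall fun x => ?_)
    have : 0 ≤ 1 + ‖x‖ := by positivity
    simp only
    rw [Real.rpow_neg this, Real.rpow_natCast]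
  refine ((hI.mul_prod hI).const_mul C).mono' ?_ (Filter.Eventually.of_forall fun z => ?_)
  · exact Continuous.aestronglyMeasurable (by
      have := continuous_schwartzStft g u
      fun_prop)
  · have hz := h z.1 z.2
    rw [Real.norm_of_nonneg (by positivity), ← mul_inv, ← div_eq_mul_inv,
      le_div_iff₀ (by positivity)]
    refine le_trans (le_of_eq ?_) hz
    rw [pow_add, pow_add]
    ring

theorem integrable_schwartzStft {d : ℕ} (g u : 𝓢(Rd d, ℂ)) : Integrable (schwartzStft g u) := by
  refine (integrable_norm_iff (continuous_schwartzStft g u).aestronglyMeasurable).1 ?_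
  simpa using integrable_pow_mul_schwartzStft g u 0

/-- Moyal's formula: the short-time Fourier transform is inverted by integrating against
time-frequency shifts of any dual window. -/
theorem integral_schwartzStft_mul {d : ℕ} (g h u ψ : 𝓢(Rd d, ℂ)) :
    ∫ z : Rd d × Rd d, schwartzStft g u z * schwartzStft h ψ (z.1, -z.2) =
      (∫ t, u t * ψ t) * ∫ t, g t * h t := by
  have hint : Integrable fun z : Rd d × Rd d =>
      schwartzStft g u z * schwartzStft h ψ (z.1, -z.2) := by
    obtain ⟨C, -, hC⟩ := exists_norm_schwartzStft_le h ψ 0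
    refine (integrable_schwartzStft g u).mul_bdd (c := C) ?_
      (Filter.Eventually.of_forall fun z => ?_)
    · exact ((continuous_schwartzStft h ψ).comp (by fun_prop)).aestronglyMeasurable
    · simpa using hC z.1 (-z.2)
  have hgh : Integrable fun t => g (-t) * h (-t) :=
    ((g.memLp 2 volume).integrable_mul (h.memLp 2 volume)).comp_neg
  have huψ : Integrable fun t => u t * ψ t :=
    (u.memLp 2 volume).integrable_mul (ψ.memLp 2 volume)
  rw [Measure.volume_eq_prod, integral_prod _ hint]
  have h1 : ∀ x : Rd d, ∫ ξ, schwartzStft g u (x, ξ) * schwartzStft h ψ (x, -ξ) =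
      ∫ t, (u t * ψ t) * (g (t - x) * h (t - x)) := fun x => by
    have : ∀ ξ, schwartzStft g u (x, ξ) * schwartzStft h ψ (x, -ξ) =
        𝓕 (mulShift u g x) ξ * 𝓕⁻ (mulShift ψ h x) ξ := fun ξ => by
      rw [schwartzStft_eq_fourier, schwartzStft_eq_fourier, fourierInv_apply_eq, fourier_apply_eq,
        fourier_apply_eq]
    simp only [this]
    rw [SchwartzMap.integral_fourier_mul_eq, fourier_fourierInv_eq]
    congr with t
    rw [mulShift_apply, mulShift_apply]
    ring
  simp only [h1]
  rw [integral_integral_swap]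
  · rw [← integral_mul_const]
    congr with t
    rw [integral_const_mul]
    congr 1
    exact integral_sub_left_eq_self (fun s => g s * h s) volume t
  · have := Integrable.convolution_integrand (ContinuousLinearMap.mul ℂ ℂ) huψ hgh
    simpa [Function.uncurry_def] using this

/-! ### Inversion of the short-time Fourier transform of tempered distributions -/

/-- A sequence of Schwartz functions approximating a tempered distribution, with error controlled
by a single continuous seminorm. -/
theorem exists_seq_approx {d : ℕ} (f : 𝓢'(Rd d, ℂ)) :
    ∃ (q : Seminorm ℂ 𝓢(Rd d, ℂ)) (u : ℕ → 𝓢(Rd d, ℂ)), Continuous q ∧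
      ∀ (n : ℕ) (φ : 𝓢(Rd d, ℂ)), ‖f φ - ∫ x, u n x * φ x‖ ≤ 1 / (n + 1) * q φ := by
  obtain ⟨q, hq, h⟩ := exists_approx f
  choose u hu using fun n : ℕ => h (1 / (n + 1)) (by positivity)
  exact ⟨q, u, hq, hu⟩

theorem tendsto_of_norm_sub_le {a : ℂ} {b : ℕ → ℂ} {K : ℝ}
    (h : ∀ n : ℕ, ‖a - b n‖ ≤ 1 / (n + 1) * K) : Tendsto b atTop (𝓝 a) := by
  rw [tendsto_iff_norm_sub_tendsto_zero]
  refine squeeze_zero (fun _ => norm_nonneg _) (fun n => ?_)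
    (by simpa using (tendsto_one_div_add_atTop_nhds_zero_nat (𝕜 := ℝ)).mul_const K)
  rw [norm_sub_rev]
  simpa using h n

theorem measurable_stft {d : ℕ} (g : 𝓢(Rd d, ℂ)) (f : 𝓢'(Rd d, ℂ)) :
    Measurable fun z : Rd d × Rd d => stft g f z.1 z.2 := by
  obtain ⟨q, u, -, hu⟩ := exists_seq_approx f
  refine measurable_of_tendsto_metrizable
    (fun n => (continuous_schwartzStft g (u n)).measurable) (tendsto_pi_nhds.2 fun z => ?_)
  exact tendsto_of_norm_sub_le fun n => hu n (timeFreqShift g z.1 z.2)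

/-- Moyal's formula for a tempered distribution. -/
theorem integral_stft_mul {d : ℕ} (g h ψ : 𝓢(Rd d, ℂ)) (f : 𝓢'(Rd d, ℂ)) :
    ∫ z : Rd d × Rd d, stft g f z.1 z.2 * schwartzStft h ψ (z.1, -z.2) =
      f ψ * ∫ t, g t * h t := by
  obtain ⟨q, u, hq, hu⟩ := exists_seq_approx f
  obtain ⟨C, k, hC, hqk⟩ := exists_continuous_seminorm_timeFreqShift_le g hq
  have hmp : MeasurePreserving (fun z : Rd d × Rd d => (z.1, -z.2)) :=
    (MeasurePreserving.id volume).prod (Measure.measurePreserving_neg volume)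
  have hwc : Continuous fun z : Rd d × Rd d => schwartzStft h ψ (z.1, -z.2) :=
    (continuous_schwartzStft h ψ).comp (by fun_prop)
  have hW : Integrable fun z : Rd d × Rd d =>
      ((1 + ‖z.1‖) ^ k * (1 + ‖z.2‖) ^ k) * ‖schwartzStft h ψ (z.1, -z.2)‖ := by
    have := hmp.integrable_comp_of_integrable (integrable_pow_mul_schwartzStft h ψ k)
    simpa [Function.comp_def] using this
  have hun : ∀ n, Integrable fun z : Rd d × Rd d =>
      schwartzStft g (u n) z * schwartzStft h ψ (z.1, -z.2) := fun n => by
    obtain ⟨D, -, hD⟩ := exists_norm_schwartzStft_le h ψ 0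
    refine (integrable_schwartzStft g (u n)).mul_bdd (c := D) hwc.aestronglyMeasurable
      (Eventually.of_forall fun z => ?_)
    simpa using hD z.1 (-z.2)
  have hdiff : ∀ n : ℕ, ∀ z : Rd d × Rd d,
      ‖(stft g f z.1 z.2 - schwartzStft g (u n) z) * schwartzStft h ψ (z.1, -z.2)‖ ≤
        1 / (n + 1) * (C * (((1 + ‖z.1‖) ^ k * (1 + ‖z.2‖) ^ k) *
          ‖schwartzStft h ψ (z.1, -z.2)‖)) := fun n z => by
    rw [norm_mul, ← mul_assoc C, ← mul_assoc]
    gcongr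
    refine (hu n (timeFreqShift g z.1 z.2)).trans ?_
    gcongr
    exact hqk z.1 z.2
  have hdi : ∀ n, Integrable fun z : Rd d × Rd d =>
      (stft g f z.1 z.2 - schwartzStft g (u n) z) * schwartzStft h ψ (z.1, -z.2) := fun n =>
    ((hW.const_mul C).const_mul (1 / ((n : ℝ) + 1))).mono'
      (((measurable_stft g f).sub (continuous_schwartzStft g (u n)).measurable).mul
        hwc.measurable).aestronglyMeasurable (Eventually.of_forall (hdiff n))
  have hlim₁ : Tendsto (fun n => (∫ t, u n t * ψ t) * ∫ t, g t * h t) atTop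
      (𝓝 (f ψ * ∫ t, g t * h t)) :=
    (tendsto_of_norm_sub_le fun n => hu n ψ).mul_const _
  refine tendsto_nhds_unique (tendsto_of_norm_sub_le (K := ∫ z : Rd d × Rd d,
    C * (((1 + ‖z.1‖) ^ k * (1 + ‖z.2‖) ^ k) * ‖schwartzStft h ψ (z.1, -z.2)‖)) fun n => ?_) hlim₁
  rw [← integral_schwartzStft_mul, ← integral_sub]
  · rw [← integral_const_mul]
    simp only [← sub_mul]
    exact norm_integral_le_of_norm_le ((hW.const_mul C).const_mul _)
      (Eventually.of_forall (hdiff n))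
  · refine ((hdi n).add (hun n)).congr (Eventually.of_forall fun z => ?_)
    simp only [Pi.add_apply]
    ring
  · exact hun n

/-- The short-time Fourier transform of a time-frequency shift, up to a unimodular factor. -/
theorem norm_schwartzStft_timeFreqShift {d : ℕ} (h γ : 𝓢(Rd d, ℂ)) (x ξ y η : Rd d) :
    ‖schwartzStft h (timeFreqShift γ x ξ) (y, -η)‖ = ‖schwartzStft h γ (y - x, ξ - η)‖ := by
  have : schwartzStft h (timeFreqShift γ x ξ) (y, -η) =
      char (ξ - η) x * schwartzStft h γ (y - x, ξ - η) := by
    rw [schwartzStft, schwartzStft, ← integral_const_mul, ← integral_add_right_eq_self _ x]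
    congr with t
    simp only [timeFreqShift_apply, add_sub_cancel_right, char_add_right]
    rw [show t + x - y = t - (y - x) by abel, show ξ - η = ξ + -η by abel, char_add_left,
      char_add_left]
    ring
  rw [this, norm_mul, norm_char, one_mul]

/-- Change of window: the short-time Fourier transform with window `γ` is dominated by the
convolution of the one with window `g` with the short-time Fourier transform of `γ`. -/
theorem enorm_stft_mul_le {d : ℕ} (g h γ : 𝓢(Rd d, ℂ)) (f : 𝓢'(Rd d, ℂ)) (x ξ : Rd d) :
    ‖stft γ f x ξ‖ₑ * ‖∫ t, g t * h t‖ₑ ≤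
      ∫⁻ z : Rd d × Rd d, ‖stft g f z.1 z.2‖ₑ * ‖schwartzStft h γ (z.1 - x, ξ - z.2)‖ₑ := by
  rw [stft, ← enorm_mul, ← integral_stft_mul g h]
  refine (enorm_integral_le_lintegral_enorm _).trans (le_of_eq ?_)
  refine lintegral_congr fun z => ?_
  rw [enorm_mul]
  congr 1
  rw [← ofReal_norm, ← ofReal_norm, norm_schwartzStft_timeFreqShift]

/-! ### Minkowski's integral inequality and mixed norms -/

section Minkowski

variable {X Y Z : Type*} [MeasurableSpace X] [MeasurableSpace Y] [MeasurableSpace Z]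
  {μ : Measure X} {ν : Measure Y} {ρ : Measure Z}

theorem eLpNorm_eq_lintegral_rpow {r : ℝ≥0∞} (hr : r ≠ 0) (hr' : r ≠ ∞) (f : X → ℝ≥0∞) :
    eLpNorm f r μ = (∫⁻ x, f x ^ r.toReal ∂μ) ^ (1 / r.toReal) := by
  simp [eLpNorm_eq_lintegral_rpow_enorm_toReal hr hr']

theorem essSup_le_iff_ae (f : X → ℝ≥0∞) (c : ℝ≥0∞) : essSup f μ ≤ c ↔ ∀ᵐ x ∂μ, f x ≤ c :=
  ⟨fun h => (ENNReal.ae_le_essSup f).mono fun _ hx => hx.trans h, fun h => essSup_le_of_ae_le c h⟩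

theorem eLpNorm_top_eq_essSup (f : X → ℝ≥0∞) : eLpNorm f ∞ μ = essSup f μ := by
  simp [eLpNorm_exponent_top, eLpNormEssSup]

theorem measurable_eLpNorm_right [SFinite μ] {F : X × Y → ℝ≥0∞} (hF : Measurable F) {r : ℝ≥0∞}
    (hr : r ≠ 0) : Measurable fun y => eLpNorm (fun x => F (x, y)) r μ := by
  rcases eq_or_ne r ∞ with rfl | hr'
  · simp only [eLpNorm_top_eq_essSup]
    refine measurable_of_Iic fun c => ?_
    have : (fun y => essSup (fun x => F (x, y)) μ) ⁻¹' Set.Iic c =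
        {y | μ ((fun x => (x, y)) ⁻¹' {z | c < F z}) = 0} := by
      ext y
      simp only [Set.mem_preimage, Set.mem_Iic, essSup_le_iff_ae, ae_iff, not_le, Set.mem_ofPred_eq,
        Set.preimage_ofPred_eq]
    rw [this]
    exact measurable_measure_prodMk_right (measurableSet_lt measurable_const hF)
      (measurableSet_singleton 0)
  · simp only [eLpNorm_eq_lintegral_rpow hr hr']
    exact ((hF.pow_const _).lintegral_prod_left').pow_const _

theorem measurable_eLpNorm_left [SFinite ν] {F : X × Y → ℝ≥0∞} (hF : Measurable F) {r : ℝ≥0∞}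
    (hr : r ≠ 0) : Measurable fun x => eLpNorm (fun y => F (x, y)) r ν :=
  measurable_eLpNorm_right (hF.comp measurable_swap) hr

theorem ae_ae_le_essSup [SFinite μ] [SFinite ν] {F : X × Y → ℝ≥0∞} (hF : Measurable F) :
    ∀ᵐ x ∂μ, ∀ᵐ y ∂ν, F (x, y) ≤ essSup (fun x => F (x, y)) μ := by
  have hM : Measurable fun y => essSup (fun x => F (x, y)) μ := by
    simpa only [eLpNorm_top_eq_essSup] using
      measurable_eLpNorm_right (μ := μ) hF (r := ∞) ENNReal.top_ne_zero
  refine (Measure.ae_ae_comm (p := fun x y => F (x, y) ≤ essSup (fun x => F (x, y)) μ) ?_).2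
    (Eventually.of_forall fun y => ENNReal.ae_le_essSup _)
  exact measurableSet_le hF (hM.comp measurable_snd)

/-- Hölder's inequality in the form that yields Minkowski's integral inequality: it bounds a
truncation `H` of `∫ F(·, y) dν(y)` with finite `Lᵖ` norm. -/
theorem lintegral_rpow_le_of_le_lintegral [SFinite μ] [SFinite ν] {F : X × Y → ℝ≥0∞}
    (hF : Measurable F) {p q : ℝ} (hpq : p.HolderConjugate q) {H : X → ℝ≥0∞} (hH : Measurable H)
    (hle : ∀ x, H x ≤ ∫⁻ y, F (x, y) ∂ν) (hfin : ∫⁻ x, H x ^ p ∂μ ≠ ∞) :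
    (∫⁻ x, H x ^ p ∂μ) ^ (1 / p) ≤ ∫⁻ y, (∫⁻ x, F (x, y) ^ p ∂μ) ^ (1 / p) ∂ν := by
  set I := ∫⁻ x, H x ^ p ∂μ with hI
  have hp := hpq.lt
  have hpos := hpq.pos
  rcases eq_or_ne I 0 with h0 | h0
  · rw [h0, ENNReal.zero_rpow_of_pos (by positivity)]
    exact bot_le
  have key : I ≤ (∫⁻ y, (∫⁻ x, F (x, y) ^ p ∂μ) ^ (1 / p) ∂ν) * I ^ (1 / q) := by
    calc I ≤ ∫⁻ x, ∫⁻ y, F (x, y) * H x ^ (p - 1) ∂ν ∂μ := by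
          refine lintegral_mono fun x => ?_
          rw [lintegral_mul_const _
            (show Measurable fun y => F (x, y) from hF.comp measurable_prodMk_left)]
          calc H x ^ p = H x * H x ^ (p - 1) := by
                conv_lhs => rw [show p = 1 + (p - 1) by ring]
                rw [ENNReal.rpow_add_of_nonneg _ _ zero_le_one (by linarith), ENNReal.rpow_one]
            _ ≤ _ := by gcongr; exact hle x
      _ = ∫⁻ y, ∫⁻ x, F (x, y) * H x ^ (p - 1) ∂μ ∂ν :=
          lintegral_lintegral_swap (Measurable.aemeasurable
            (hF.mul ((hH.comp measurable_fst).pow_const _)))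
      _ ≤ ∫⁻ y, (∫⁻ x, F (x, y) ^ p ∂μ) ^ (1 / p) * I ^ (1 / q) ∂ν := by
          refine lintegral_mono fun y => ?_
          refine (ENNReal.lintegral_mul_le_Lp_mul_Lq μ hpq
            (hF.comp measurable_prodMk_right).aemeasurable
            (hH.pow_const _).aemeasurable).trans (le_of_eq ?_)
          simp only [← ENNReal.rpow_mul, hpq.sub_one_mul_conj, hI]
          rfl
      _ = _ := lintegral_mul_const _ (((hF.pow_const p).lintegral_prod_left').pow_const _)
  have hq0 : I ^ (1 / q) ≠ 0 := by
    simp [ENNReal.rpow_eq_zero_iff, h0, hfin]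
  have hqt : I ^ (1 / q) ≠ ∞ :=
    ENNReal.rpow_ne_top_of_nonneg (by have := hpq.symm.pos; positivity) hfin
  refine (ENNReal.mul_le_mul_iff_left hq0 hqt).1 ?_
  rw [← ENNReal.rpow_add _ _ h0 hfin]
  have : 1 / p + 1 / q = 1 := by
    simpa using hpq.inv_add_inv_eq_one
  rwa [this, ENNReal.rpow_one]

/-- Minkowski's integral inequality. -/
theorem eLpNorm_lintegral_le [SigmaFinite μ] [SFinite ν] {F : X × Y → ℝ≥0∞} (hF : Measurable F)
    {r : ℝ≥0∞} (hr : 1 ≤ r) :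
    eLpNorm (fun x => ∫⁻ y, F (x, y) ∂ν) r μ ≤ ∫⁻ y, eLpNorm (fun x => F (x, y)) r μ ∂ν := by
  rcases eq_or_ne r ∞ with rfl | hr'
  · simp only [eLpNorm_top_eq_essSup]
    rw [essSup_le_iff_ae]
    exact (ae_ae_le_essSup hF).mono fun x hx => lintegral_mono_ae hx
  rcases eq_or_ne r 1 with rfl | hr1
  · simp only [eLpNorm_one_eq_lintegral_enorm, enorm_eq_self]
    exact (lintegral_lintegral_swap (f := fun x y => F (x, y)) hF.aemeasurable).le
  have hr0 : r ≠ 0 := (zero_lt_one.trans_le hr).ne'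
  simp only [eLpNorm_eq_lintegral_rpow hr0 hr']
  set p := r.toReal with hp
  have hp1 : 1 < p := by
    rw [hp, ← ENNReal.toReal_one]
    exact (ENNReal.toReal_lt_toReal ENNReal.one_ne_top hr').2 (lt_of_le_of_ne hr hr1.symm)
  have hp0 : 0 < p := by linarith
  let H : X → ℝ≥0∞ := fun x => ∫⁻ y, F (x, y) ∂ν
  have hH : Measurable H := hF.lintegral_prod_right'
  let Hn : ℕ → X → ℝ≥0∞ := fun n => (spanningSets μ n).indicator fun x => min (H x) n
  have hHn : ∀ n, Measurable (Hn n) := fun n =>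
    (hH.min measurable_const).indicator (measurableSet_spanningSets μ n)
  have hbound : ∀ n, (∫⁻ x, Hn n x ^ p ∂μ) ^ (1 / p) ≤
      ∫⁻ y, (∫⁻ x, F (x, y) ^ p ∂μ) ^ (1 / p) ∂ν := fun n => by
    refine lintegral_rpow_le_of_le_lintegral hF (Real.HolderConjugate.conjExponent hp1) (hHn n)
      (fun x => (Set.indicator_le_self _ _ x).trans (min_le_left _ _)) ?_
    have : ∫⁻ x, Hn n x ^ p ∂μ ≤
        ∫⁻ x, (spanningSets μ n).indicator (fun _ => (n : ℝ≥0∞) ^ p) x ∂μ := by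
      refine lintegral_mono fun x => ?_
      by_cases hx : x ∈ spanningSets μ n
      · simp only [Hn, Set.indicator_of_mem hx]
        gcongr
        exact min_le_right _ _
      · simp [Hn, Set.indicator_of_notMem hx, hp0]
    refine ne_top_of_le_ne_top ?_ this
    rw [lintegral_indicator_const (measurableSet_spanningSets μ n)]
    exact ENNReal.mul_ne_top (ENNReal.rpow_ne_top_of_nonneg hp0.le (ENNReal.natCast_ne_top n))
      (measure_spanningSets_lt_top μ n).ne
  have hmono : Monotone Hn := fun m n hmn x => by
    simp only [Hn]
    refine (Set.indicator_le_indicator_of_subset (monotone_spanningSets μ hmn)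
      (fun _ => bot_le) x).trans ?_
    refine Set.indicator_le_indicator ?_
    gcongr
  have hlim : ∀ x, Tendsto (fun n => Hn n x) atTop (𝓝 (H x)) := fun x => by
    have h1 : Tendsto (fun n : ℕ => min (H x) n) atTop (𝓝 (min (H x) ∞)) :=
      tendsto_const_nhds.min ENNReal.tendsto_nat_nhds_top
    rw [min_eq_left le_top] at h1
    refine h1.congr' ?_
    filter_upwards [eventually_ge_atTop (spanningSetsIndex μ x)] with n hn
    simp [Hn, Set.indicator_of_mem (mem_spanningSets_of_index_le μ x hn)]
  have hconv : Tendsto (fun n => (∫⁻ x, Hn n x ^ p ∂μ) ^ (1 / p)) atTop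
      (𝓝 ((∫⁻ x, H x ^ p ∂μ) ^ (1 / p))) := by
    refine (ENNReal.continuous_rpow_const.tendsto _).comp ?_
    refine lintegral_tendsto_of_tendsto_of_monotone (fun n => ((hHn n).pow_const p).aemeasurable)
      (Eventually.of_forall fun x m n hmn => ?_) (Eventually.of_forall fun x => ?_)
    · exact ENNReal.rpow_le_rpow (hmono hmn x) hp0.le
    · exact (ENNReal.continuous_rpow_const.tendsto _).comp (hlim x)
  exact le_of_tendsto' hconv hbound

/-- Mixed norms decrease when the smaller exponent is moved inside. -/
theorem eLpNorm_eLpNorm_swap_le [SFinite μ] [SigmaFinite ν] {F : X × Y → ℝ≥0∞} (hF : Measurable F)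
    {p q : ℝ≥0∞} (hp : 1 ≤ p) (hpq : p ≤ q) :
    eLpNorm (fun y => eLpNorm (fun x => F (x, y)) p μ) q ν ≤
      eLpNorm (fun x => eLpNorm (fun y => F (x, y)) q ν) p μ := by
  rcases eq_or_ne p ∞ with rfl | hp'
  · obtain rfl : q = ∞ := top_le_iff.1 hpq
    simp only [eLpNorm_top_eq_essSup]
    rw [essSup_le_iff_ae]
    have h := ae_ae_le_essSup (μ := ν) (ν := μ) (hF.comp measurable_swap)
    filter_upwards [h] with y hy
    exact essSup_mono_ae hy
  have hp0 : p ≠ 0 := (zero_lt_one.trans_le hp).ne'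
  have hr0 : 0 < p.toReal := ENNReal.toReal_pos hp0 hp'
  have hpow : ∀ (h : Y → ℝ≥0∞) (a : ℝ) (s : ℝ≥0∞), 0 < a →
      eLpNorm (fun y => h y ^ a) s ν = eLpNorm h (s * ENNReal.ofReal a) ν ^ a := fun h a s ha => by
    simpa using eLpNorm_enorm_rpow (p := s) (μ := ν) h ha
  simp only [eLpNorm_eq_lintegral_rpow hp0 hp']
  rw [hpow _ _ _ (by positivity)]
  have hq : q * ENNReal.ofReal (1 / p.toReal) = q / p := by
    rw [one_div, ENNReal.ofReal_inv_of_pos hr0, ENNReal.ofReal_toReal hp', ENNReal.div_eq_inv_mul,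
      mul_comm]
  rw [hq]
  refine ENNReal.rpow_le_rpow ?_ (by positivity)
  have h1 : (1 : ℝ≥0∞) ≤ q / p := by
    rw [ENNReal.le_div_iff_mul_le (Or.inl hp0) (Or.inl hp'), one_mul]
    exact hpq
  refine (eLpNorm_lintegral_le (F := fun z : Y × X => F (z.2, z.1) ^ p.toReal)
    ((hF.comp measurable_swap).pow_const _) h1).trans (le_of_eq ?_)
  refine lintegral_congr fun x => ?_
  rw [hpow _ _ _ hr0, ENNReal.ofReal_toReal hp', ENNReal.div_mul_cancel hp0 hp']

theorem eLpNorm_const_mul_ennreal (c : ℝ≥0∞) {r : ℝ≥0∞} (hr : r ≠ 0) {f : X → ℝ≥0∞}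
    (hf : Measurable f) : eLpNorm (fun x => c * f x) r μ = c * eLpNorm f r μ := by
  rcases eq_or_ne r ∞ with rfl | hr'
  · simp only [eLpNorm_top_eq_essSup]
    exact ENNReal.essSup_const_mul
  · have := ENNReal.toReal_pos hr hr'
    simp only [eLpNorm_eq_lintegral_rpow hr hr', ENNReal.mul_rpow_of_nonneg _ _ this.le]
    rw [lintegral_const_mul _ (hf.pow_const _), ENNReal.mul_rpow_of_nonneg _ _ (by positivity),
      ← ENNReal.rpow_mul, mul_one_div_cancel this.ne', ENNReal.rpow_one]

/-- Minkowski's integral inequality for mixed norms. -/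
theorem eLpNorm_eLpNorm_lintegral_le [SigmaFinite μ] [SigmaFinite ν] [SFinite ρ]
    {F : (X × Y) × Z → ℝ≥0∞} (hF : Measurable F) {p q : ℝ≥0∞} (hp : 1 ≤ p) (hq : 1 ≤ q) :
    eLpNorm (fun x => eLpNorm (fun y => ∫⁻ w, F ((x, y), w) ∂ρ) q ν) p μ ≤
      ∫⁻ w, eLpNorm (fun x => eLpNorm (fun y => F ((x, y), w)) q ν) p μ ∂ρ := by
  have hq0 : q ≠ 0 := (zero_lt_one.trans_le hq).ne'
  have hG : Measurable fun z : X × Z => eLpNorm (fun y => F ((z.1, y), z.2)) q ν :=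
    measurable_eLpNorm_left (F := fun z : (X × Z) × Y => F ((z.1.1, z.2), z.1.2))
      (hF.comp (by fun_prop)) hq0
  refine le_trans ?_ (eLpNorm_lintegral_le hG hp)
  refine eLpNorm_mono_enorm fun x => ?_
  simp only [enorm_eq_self]
  exact eLpNorm_lintegral_le (F := fun z : Y × Z => F ((x, z.1), z.2)) (hF.comp (by fun_prop)) hq

end Minkowski

section Phase

variable {d : ℕ}

theorem eLpNorm_comp_linear (L : Rd d →ₗ[ℝ] Rd d) (hL : LinearMap.det L ≠ 0) {h : Rd d → ℝ≥0∞}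
    (hh : Measurable h) (p : ℝ≥0∞) :
    eLpNorm (fun x => h (L x)) p volume =
      ENNReal.ofReal |LinearMap.det L| ^ (-(p⁻¹).toReal) * eLpNorm h p volume := by
  have hLm : Measurable L := L.continuous_of_finiteDimensional.measurable
  have h1 := eLpNorm_map_measure (μ := volume) (f := L) (g := h) (p := p)
    hh.aestronglyMeasurable hLm.aemeasurable
  rw [Measure.map_linearMap_addHaar_eq_smul_addHaar volume hL,
    eLpNorm_smul_measure_of_ne_zero (by simpa using hL)] at h1
  rw [show (fun x => h (L x)) = h ∘ L from rfl, ← h1, smul_eq_mul, abs_inv,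
    ENNReal.ofReal_inv_of_pos (abs_pos.2 hL), ENNReal.inv_rpow, ENNReal.rpow_neg, one_div]

theorem eLpNorm_comp_add_right (a : Rd d) {h : Rd d → ℝ≥0∞} (hh : Measurable h) (p : ℝ≥0∞) :
    eLpNorm (fun x => h (x + a)) p volume = eLpNorm h p volume :=
  eLpNorm_comp_measurePreserving hh.aestronglyMeasurable (measurePreserving_add_right volume a)

/-- The change of variables `(x, ξ) ↦ (M(ξ + Qx), Nx + Pu)`, `u = M(ξ + Qx)`, of phase space
interchanges the two mixed norms, at the price of the two Jacobians. -/
theorem eLpNorm_eLpNorm_comp_le (M N P Q : Rd d →ₗ[ℝ] Rd d) (hM : LinearMap.det M ≠ 0)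
    (hN : LinearMap.det N ≠ 0) {G : Rd d × Rd d → ℝ≥0∞} (hG : Measurable G) {p q : ℝ≥0∞}
    (hp : 1 ≤ p) (hpq : p ≤ q) :
    eLpNorm (fun x => eLpNorm (fun ξ => G (M (ξ + Q x), N x + P (M (ξ + Q x)))) p volume) q volume ≤
      ENNReal.ofReal |LinearMap.det M| ^ (-(p⁻¹).toReal) *
        (ENNReal.ofReal |LinearMap.det N| ^ (-(q⁻¹).toReal) *
        eLpNorm (fun u => eLpNorm (fun v => G (u, v)) q volume) p volume) := by
  have hMm : Measurable M := M.continuous_of_finiteDimensional.measurable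
  have hNm : Measurable N := N.continuous_of_finiteDimensional.measurable
  have hPm : Measurable P := P.continuous_of_finiteDimensional.measurable
  have hp0 : p ≠ 0 := (zero_lt_one.trans_le hp).ne'
  have hq0 : q ≠ 0 := (zero_lt_one.trans_le (hp.trans hpq)).ne'
  have hG' : Measurable fun z : Rd d × Rd d => G (z.1, N z.2 + P z.1) := hG.comp (by fun_prop)
  have h1 : ∀ x, eLpNorm (fun ξ => G (M (ξ + Q x), N x + P (M (ξ + Q x)))) p volume =
      ENNReal.ofReal |LinearMap.det M| ^ (-(p⁻¹).toReal) *
        eLpNorm (fun u => G (u, N x + P u)) p volume := fun x => by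
    have hm : Measurable fun u => G (u, N x + P u) := hG'.comp measurable_prodMk_right
    rw [eLpNorm_comp_add_right (Q x) (h := fun ξ => G (M ξ, N x + P (M ξ))) (hm.comp hMm)]
    exact eLpNorm_comp_linear M hM hm p
  simp only [h1]
  rw [eLpNorm_const_mul_ennreal _ hq0 (measurable_eLpNorm_right hG' hp0)]
  gcongr
  refine (eLpNorm_eLpNorm_swap_le hG' hp hpq).trans (le_of_eq ?_)
  rw [← eLpNorm_const_mul_ennreal _ hp0 (measurable_eLpNorm_left hG hq0)]
  congr 1
  funext u
  have hm : Measurable fun v => G (u, v) := hG.comp measurable_prodMk_left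
  have h2 := eLpNorm_comp_linear N hN (hm.comp (measurable_add_const (P u))) q
  exact h2.trans (congrArg _ (eLpNorm_comp_add_right (P u) hm q))

end Phase

/-! ### The modulation space `M¹` pairing -/

section Pairing

variable {d : ℕ}

/-- The `L¹` norm of the short-time Fourier transform of `ψ` with window `φ`, a version of the norm
of `ψ` in the modulation space `M¹`. -/
noncomputable def modNorm (φ ψ : 𝓢(Rd d, ℂ)) : ℝ≥0∞ := ∫⁻ z, ‖schwartzStft φ ψ z‖ₑ

theorem modNorm_lt_top (φ ψ : 𝓢(Rd d, ℂ)) : modNorm φ ψ < ∞ :=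
  (integrable_schwartzStft φ ψ).2

theorem measurable_enorm_schwartzStft (φ ψ : 𝓢(Rd d, ℂ)) :
    Measurable fun z => ‖schwartzStft φ ψ z‖ₑ :=
  (continuous_schwartzStft φ ψ).measurable.enorm

theorem schwartzStft_comm (φ ψ : 𝓢(Rd d, ℂ)) (x ξ : Rd d) :
    schwartzStft φ ψ (x, ξ) = char ξ x * schwartzStft ψ φ (-x, ξ) := by
  rw [schwartzStft, schwartzStft, ← integral_const_mul, ← integral_add_right_eq_self _ x]
  congr with t
  simp only [timeFreqShift_apply, add_sub_cancel_right, char_add_right, sub_neg_eq_add]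
  ring

theorem enorm_schwartzStft_comm (φ ψ : 𝓢(Rd d, ℂ)) (x ξ : Rd d) :
    ‖schwartzStft φ ψ (x, ξ)‖ₑ = ‖schwartzStft ψ φ (-x, ξ)‖ₑ := by
  rw [schwartzStft_comm, ← ofReal_norm, ← ofReal_norm, norm_mul, norm_char, one_mul]

theorem measurePreserving_neg_fst :
    MeasurePreserving (fun z : Rd d × Rd d => (-z.1, z.2)) :=
  (Measure.measurePreserving_neg volume).prod (MeasurePreserving.id volume)

theorem modNorm_comm (φ ψ : 𝓢(Rd d, ℂ)) : modNorm φ ψ = modNorm ψ φ := by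
  rw [modNorm, modNorm, ← measurePreserving_neg_fst.lintegral_comp
    (measurable_enorm_schwartzStft ψ φ)]
  exact lintegral_congr fun z => enorm_schwartzStft_comm φ ψ z.1 z.2

/-- The substitution relating the base point of a time-frequency shift to its displacement. -/
theorem lintegral_sub_sub_eq (F : Rd d × Rd d → ℝ≥0∞) (hF : Measurable F) (x ξ : Rd d) :
    ∫⁻ z : Rd d × Rd d, F (z.1 - x, ξ - z.2) = ∫⁻ z, F z :=
  ((measurePreserving_sub_right volume x).prod
    (Measure.measurePreserving_sub_left volume ξ)).lintegral_comp hF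

theorem lintegral_sub_sub_eq' (F : Rd d × Rd d → ℝ≥0∞) (hF : Measurable F) (y η : Rd d) :
    ∫⁻ z : Rd d × Rd d, F (y - z.1, z.2 - η) = ∫⁻ z, F z :=
  ((Measure.measurePreserving_sub_left volume y).prod
    (measurePreserving_sub_right volume η)).lintegral_comp hF

/-- Change of window in `M¹`. -/
theorem modNorm_mul_le (g h γ ψ : 𝓢(Rd d, ℂ)) :
    modNorm γ ψ * ‖∫ t, g t * h t‖ₑ ≤ modNorm g ψ * modNorm h γ := by
  have h1 : ∀ z : Rd d × Rd d, ‖schwartzStft γ ψ z‖ₑ * ‖∫ t, g t * h t‖ₑ ≤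
      ∫⁻ w : Rd d × Rd d, ‖schwartzStft g ψ w‖ₑ * ‖schwartzStft h γ (w.1 - z.1, z.2 - w.2)‖ₑ :=
    fun z => by
      have := enorm_stft_mul_le g h γ (SchwartzMap.toTemperedDistributionCLM (Rd d) ℂ volume ψ)
        z.1 z.2
      simpa only [stft_coe] using this
  rw [modNorm, ← lintegral_mul_const _ (measurable_enorm_schwartzStft γ ψ)]
  refine (lintegral_mono h1).trans ?_
  rw [lintegral_lintegral_swap]
  · rw [modNorm, ← lintegral_mul_const _ (measurable_enorm_schwartzStft g ψ)]
    refine lintegral_mono fun w => ?_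
    simp only
    rw [lintegral_const_mul]
    · rw [lintegral_sub_sub_eq' _ (measurable_enorm_schwartzStft h γ), modNorm]
    · exact (measurable_enorm_schwartzStft h γ).comp (by fun_prop)
  · refine Measurable.aemeasurable ?_
    exact ((measurable_enorm_schwartzStft g ψ).comp measurable_snd).mul
      ((measurable_enorm_schwartzStft h γ).comp (by fun_prop))

end Pairing

/-! ### Operators implementing symplectic matrices -/

section Implements

variable {d : ℕ}

/-- The action of a block matrix on phase space. -/
noncomputable def phaseAct (M : Matrix (Fin d ⊕ Fin d) (Fin d ⊕ Fin d) ℝ) (z : Rd d × Rd d) :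
    Rd d × Rd d :=
  (M.toBlocks₁₁.toEuclideanLin z.1 + M.toBlocks₁₂.toEuclideanLin z.2,
    M.toBlocks₂₁.toEuclideanLin z.1 + M.toBlocks₂₂.toEuclideanLin z.2)

theorem toEuclideanLin_mul_apply (A B : Matrix (Fin d) (Fin d) ℝ) (x : Rd d) :
    (A * B).toEuclideanLin x = A.toEuclideanLin (B.toEuclideanLin x) := by
  ext i
  simp [Matrix.mulVec_mulVec]

theorem toEuclideanLin_one_apply (x : Rd d) :
    (1 : Matrix (Fin d) (Fin d) ℝ).toEuclideanLin x = x := by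
  ext i
  simp

theorem phaseAct_fromBlocks (A B C D : Matrix (Fin d) (Fin d) ℝ) (z : Rd d × Rd d) :
    phaseAct (Matrix.fromBlocks A B C D) z =
      (A.toEuclideanLin z.1 + B.toEuclideanLin z.2,
        C.toEuclideanLin z.1 + D.toEuclideanLin z.2) := by
  simp [phaseAct]

theorem phaseAct_mul (M₁ M₂ : Matrix (Fin d ⊕ Fin d) (Fin d ⊕ Fin d) ℝ) (z : Rd d × Rd d) :
    phaseAct (M₁ * M₂) z = phaseAct M₁ (phaseAct M₂ z) := by
  rw [← Matrix.fromBlocks_toBlocks M₁, ← Matrix.fromBlocks_toBlocks M₂,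
    Matrix.fromBlocks_multiply]
  simp only [phaseAct_fromBlocks, map_add, toEuclideanLin_mul_apply, LinearMap.add_apply]
  ext i <;> simp <;> ring

/-- The transpose of `ρ(a, b)` on Schwartz functions, `φ ↦ e^{-π i a·b} e^{2π i b·y} φ(y - a)`. -/
noncomputable def schrodingerTranspose (z : Rd d × Rd d) (φ : 𝓢(Rd d, ℂ)) : 𝓢(Rd d, ℂ) :=
  Complex.exp ((-(Real.pi * inner ℝ z.1 z.2) : ℝ) * Complex.I) • timeFreqShift φ z.1 (-z.2)

theorem norm_exp_inner (r : ℝ) : ‖Complex.exp ((r : ℝ) * Complex.I)‖ = 1 :=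
  Complex.norm_exp_ofReal_mul_I r

theorem schrodingerTranspose_apply (z : Rd d × Rd d) (φ : 𝓢(Rd d, ℂ)) (y : Rd d) :
    schrodingerTranspose z φ y =
      Complex.exp ((2 * Real.pi * inner ℝ y z.2 - Real.pi * inner ℝ z.1 z.2 : ℝ) * Complex.I) *
        φ (y - z.1) := by
  rw [schrodingerTranspose, smul_apply, timeFreqShift_apply, smul_eq_mul, ← mul_assoc, char,
    ← Complex.exp_add]
  congr 2
  rw [inner_neg_right]
  push_cast
  ring

/-- The pair `(S, R)` of mutually transposed operators on Schwartz functions implements `M`: the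
operator `R` extends to a unitary operator on `L²` implementing `M` and to the operator `f ↦ f ∘ S`
on tempered distributions. The covariance is recorded for `S`, because distributions are tested
against `S φ`; transposition reverses the order of composition. The map `N` is the action of the
inverse of `M` on the points of phase space, with the frequency reversed on both sides to match the
sign in `timeFreqShift`. -/
structure Implements (M : Matrix (Fin d ⊕ Fin d) (Fin d ⊕ Fin d) ℝ)
    (S R : 𝓢(Rd d, ℂ) →L[ℂ] 𝓢(Rd d, ℂ)) (N : Rd d × Rd d → Rd d × Rd d) : Prop where
  transpose : ∀ u φ : 𝓢(Rd d, ℂ), ∫ x, R u x * φ x = ∫ x, u x * S φ x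
  bijective : Function.Bijective R
  norm_eq : ∀ u, ‖toL2 (R u)‖ = ‖toL2 u‖
  intertwine : ∀ z φ, schrodingerTranspose z (S φ) = S (schrodingerTranspose (phaseAct M z) φ)
  act_eq : ∀ z, phaseAct M ((N z).1, -(N z).2) = (z.1, -z.2)
  measurePreserving : MeasurePreserving N

variable {M M₁ M₂ : Matrix (Fin d ⊕ Fin d) (Fin d ⊕ Fin d) ℝ}
  {S S₁ S₂ R R₁ R₂ : 𝓢(Rd d, ℂ) →L[ℂ] 𝓢(Rd d, ℂ)} {N N₁ N₂ : Rd d × Rd d → Rd d × Rd d}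

/-- Metaplectic operators compose; the transposes do so in the opposite order. -/
theorem Implements.comp (h₁ : Implements M₁ S₁ R₁ N₁) (h₂ : Implements M₂ S₂ R₂ N₂) :
    Implements (M₁ * M₂) (S₂ ∘L S₁) (R₁ ∘L R₂) (N₂ ∘ N₁) where
  transpose u φ := by
    rw [ContinuousLinearMap.comp_apply, ContinuousLinearMap.comp_apply, h₁.transpose, h₂.transpose]
  bijective := h₁.bijective.comp h₂.bijective
  norm_eq u := by rw [ContinuousLinearMap.comp_apply, h₁.norm_eq, h₂.norm_eq]
  intertwine z φ := by
    rw [ContinuousLinearMap.comp_apply, ContinuousLinearMap.comp_apply, h₂.intertwine,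
      h₁.intertwine, phaseAct_mul]
  act_eq z := by rw [phaseAct_mul, Function.comp_apply, h₂.act_eq, h₁.act_eq]
  measurePreserving := h₂.measurePreserving.comp h₁.measurePreserving

/-- The operator `S` maps the time-frequency shifts of `φ` to those of `S φ`, up to phases. -/
theorem Implements.map_timeFreqShift (h : Implements M S R N) (φ : 𝓢(Rd d, ℂ)) (z : Rd d × Rd d) :
    ∃ c : ℂ, ‖c‖ = 1 ∧
      S (timeFreqShift φ z.1 z.2) = c • timeFreqShift (S φ) (N z).1 (N z).2 := by
  have h1 := h.intertwine ((N z).1, -(N z).2) φ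
  rw [h.act_eq, schrodingerTranspose, schrodingerTranspose, map_smul] at h1
  simp only [neg_neg] at h1
  set c₁ := Complex.exp ((-(Real.pi * inner ℝ (N z).1 (-(N z).2)) : ℝ) * Complex.I) with hc₁
  set c₂ := Complex.exp ((-(Real.pi * inner ℝ z.1 (-z.2)) : ℝ) * Complex.I) with hc₂
  have h₁ : ‖c₁‖ = 1 := norm_exp_inner _
  have h₂ : ‖c₂‖ = 1 := norm_exp_inner _
  refine ⟨c₂⁻¹ * c₁, by simp [h₁, h₂], ?_⟩
  have h0 : c₂ ≠ 0 := by
    intro h0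
    simp [h0] at h₂
  rw [mul_smul, h1, inv_smul_smul₀ h0]

theorem Implements.enorm_apply_eq (h : Implements M S R N) (f : 𝓢'(Rd d, ℂ)) (φ : 𝓢(Rd d, ℂ))
    (z : Rd d × Rd d) :
    ‖f (S (timeFreqShift φ z.1 z.2))‖ₑ = ‖stft (S φ) f (N z).1 (N z).2‖ₑ := by
  obtain ⟨c, hc, hS⟩ := h.map_timeFreqShift φ z
  rw [hS, map_smul, stft, ← ofReal_norm, ← ofReal_norm, norm_smul, hc, one_mul]

theorem Implements.modNorm_eq (h : Implements M S R N) (φ ψ : 𝓢(Rd d, ℂ)) :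
    modNorm φ (R ψ) = modNorm (S φ) ψ := by
  rw [modNorm, modNorm, ← h.measurePreserving.lintegral_comp
    (measurable_enorm_schwartzStft (S φ) ψ)]
  refine lintegral_congr fun z => ?_
  rw [schwartzStft, h.transpose]
  have := h.enorm_apply_eq (SchwartzMap.toTemperedDistributionCLM (Rd d) ℂ volume ψ) φ z
  rw [stft_coe] at this
  rw [← this]
  congr 1
  refine (integral_congr_ae (Eventually.of_forall fun t => ?_)).trans
    (SchwartzMap.toTemperedDistributionCLM_apply_apply volume ψ _).symm
  simp only [smul_eq_mul, mul_comm]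

/-- The `M¹` norms of implementing operators are submultiplicative. -/
theorem Implements.modNorm_comp_le (h₂ : Implements M₂ S₂ R₂ N₂) (φ : 𝓢(Rd d, ℂ)) :
    modNorm φ (S₂ (S₁ φ)) * ‖∫ t, φ t * φ t‖ₑ ≤ modNorm φ (S₁ φ) * modNorm φ (S₂ φ) := by
  rw [modNorm_comm φ (S₂ (S₁ φ)), ← h₂.modNorm_eq, modNorm_comm _ (R₂ φ)]
  refine (modNorm_mul_le φ φ (R₂ φ) (S₁ φ)).trans (le_of_eq ?_)
  rw [h₂.modNorm_eq, modNorm_comm (S₂ φ)]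

/-- Comparison of the `M¹` norm of the image of a window with that of the image of `φ`. -/
theorem Implements.modNorm_window_le (h : Implements M S R N) (φ γ g : 𝓢(Rd d, ℂ)) :
    modNorm γ (S g) * ‖∫ t, φ t * φ t‖ₑ ^ 2 ≤
      (modNorm φ γ * modNorm φ g) * modNorm φ (S φ) := by
  have h1 : modNorm γ (S g) * ‖∫ t, φ t * φ t‖ₑ ≤ modNorm φ (S g) * modNorm φ γ :=
    modNorm_mul_le φ φ γ (S g)
  have h2 : modNorm φ (S g) * ‖∫ t, φ t * φ t‖ₑ ≤ modNorm φ g * modNorm φ (S φ) := by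
    rw [modNorm_comm φ (S g), ← h.modNorm_eq, modNorm_comm g]
    refine (modNorm_mul_le φ φ (R φ) g).trans (le_of_eq ?_)
    rw [h.modNorm_eq, modNorm_comm (S φ)]
  calc modNorm γ (S g) * ‖∫ t, φ t * φ t‖ₑ ^ 2
      = (modNorm γ (S g) * ‖∫ t, φ t * φ t‖ₑ) * ‖∫ t, φ t * φ t‖ₑ := by ring
    _ ≤ (modNorm φ (S g) * modNorm φ γ) * ‖∫ t, φ t * φ t‖ₑ := by gcongr
    _ = modNorm φ γ * (modNorm φ (S g) * ‖∫ t, φ t * φ t‖ₑ) := by ring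
    _ ≤ modNorm φ γ * (modNorm φ g * modNorm φ (S φ)) := by gcongr
    _ = _ := by ring

/-- The unitary operator on `L²` extending `R`. -/
noncomputable def Implements.unitary (h : Implements M S R N) : L2 d ≃ₗᵢ[ℂ] L2 d :=
  (LinearEquiv.ofBijective (R : 𝓢(Rd d, ℂ) →ₗ[ℂ] 𝓢(Rd d, ℂ)) h.bijective).extendOfIsometry
    (toL2 : 𝓢(Rd d, ℂ) →L[ℂ] L2 d).toLinearMap (toL2 : 𝓢(Rd d, ℂ) →L[ℂ] L2 d).toLinearMap
    denseRange_toL2 denseRange_toL2 h.norm_eq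

theorem Implements.unitary_toL2 (h : Implements M S R N) (u : 𝓢(Rd d, ℂ)) :
    h.unitary (toL2 u) = toL2 (R u) :=
  LinearEquiv.extendOfIsometry_eq _ _ _ _ _ _ u

/-- The action `f ↦ f ∘ S` on tempered distributions. -/
noncomputable def distribution (S : 𝓢(Rd d, ℂ) →L[ℂ] 𝓢(Rd d, ℂ)) : 𝓢'(Rd d, ℂ) →L[ℂ] 𝓢'(Rd d, ℂ) :=
  PointwiseConvergenceCLM.precomp ℂ S

theorem distribution_apply (S : 𝓢(Rd d, ℂ) →L[ℂ] 𝓢(Rd d, ℂ)) (f : 𝓢'(Rd d, ℂ))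
    (φ : 𝓢(Rd d, ℂ)) : distribution S f φ = f (S φ) := rfl

theorem toTemperedDistribution_toL2 (u : 𝓢(Rd d, ℂ)) :
    Lp.toTemperedDistribution (toL2 u) = SchwartzMap.toTemperedDistributionCLM (Rd d) ℂ volume u :=
  Lp.toTemperedDistribution_toLp_eq u

theorem Implements.distribution_eq (h : Implements M S R N) (f : L2 d) :
    distribution S (Lp.toTemperedDistribution f) = Lp.toTemperedDistribution (h.unitary f) := by
  refine denseRange_toL2.induction_on (p := fun f : L2 d => distribution S
    (Lp.toTemperedDistribution f) = Lp.toTemperedDistribution (h.unitary f)) f ?_ fun u => ?_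
  · exact isClosed_eq
      ((distribution S).continuous.comp (Lp.toTemperedDistributionCLM ℂ volume 2).continuous)
      ((Lp.toTemperedDistributionCLM ℂ volume 2).continuous.comp h.unitary.continuous)
  · rw [h.unitary_toL2, toTemperedDistribution_toL2, toTemperedDistribution_toL2]
    ext φ
    rw [distribution_apply]
    refine (SchwartzMap.toTemperedDistributionCLM_apply_apply volume u _).trans
      (Eq.trans ?_ (SchwartzMap.toTemperedDistributionCLM_apply_apply volume (R u) _).symm)
    simp only [smul_eq_mul]
    simpa only [mul_comm] using (h.transpose u φ).symm

theorem toTemperedDistribution_schrodinger (a b : Rd d) (f : L2 d) (φ : 𝓢(Rd d, ℂ)) :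
    Lp.toTemperedDistribution (schrodinger a b f) φ =
      Lp.toTemperedDistribution f (schrodingerTranspose (a, b) φ) := by
  rw [Lp.toTemperedDistribution_apply, Lp.toTemperedDistribution_apply]
  have h1 : ∫ x, φ x • (schrodinger a b f) x = ∫ x, φ x • (phase a b x * f (x + a)) := by
    refine integral_congr_ae ?_
    filter_upwards [(memLp_schrodinger a b f).coeFn_toLp] with x hx
    rw [schrodinger, hx]
  rw [h1, ← integral_add_right_eq_self (fun x => schrodingerTranspose (a, b) φ x • f x) a]
  congr with x
  rw [schrodingerTranspose_apply, phase, smul_eq_mul, smul_eq_mul]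
  simp only [add_sub_cancel_right, inner_add_left]
  rw [show 2 * Real.pi * (inner ℝ x b + inner ℝ a b) - Real.pi * inner ℝ a b =
    2 * Real.pi * inner ℝ x b + Real.pi * inner ℝ a b by ring]
  ring

theorem toTemperedDistribution_injective {f g : L2 d}
    (h : Lp.toTemperedDistribution f = Lp.toTemperedDistribution g) : f = g := by
  have hker := Lp.ker_toTemperedDistributionCLM_eq_bot (E := Rd d) (F := ℂ) (μ := volume) (p := 2)
  exact LinearMap.ker_eq_bot.1 hker h

theorem Implements.intertwines (h : Implements M S R N) : Intertwines M h.unitary := by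
  intro a b f
  refine toTemperedDistribution_injective ?_
  rw [← h.distribution_eq]
  ext φ
  rw [distribution_apply, toTemperedDistribution_schrodinger, toTemperedDistribution_schrodinger,
    h.intertwine, ← h.distribution_eq, distribution_apply]
  rfl

theorem Implements.isMetaplectic (h : Implements M S R N) : IsMetaplectic M (distribution S) :=
  ⟨h.unitary, h.intertwines, h.distribution_eq⟩

end Implements

/-! ### Gaussians -/

section Gaussian

variable {d : ℕ}

theorem norm_iteratedFDeriv_exp (n : ℕ) (t : ℝ) : ‖iteratedFDeriv ℝ n Real.exp t‖ = Real.exp t := by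
  rw [norm_iteratedFDeriv_eq_norm_iteratedDeriv, iteratedDeriv_eq_iterate, Real.iter_deriv_exp,
    Real.norm_of_nonneg (Real.exp_pos t).le]

theorem one_add_pow_mul_exp_le (m : ℕ) {r : ℝ} (hr : 0 ≤ r) :
    (1 + r) ^ m * Real.exp (-(Real.pi * r ^ 2)) ≤ m.factorial * Real.exp 2 := by
  have h1 : (1 + r) ^ m ≤ m.factorial * Real.exp (1 + r) := by
    have := Real.pow_div_factorial_le_exp (1 + r) (by linarith) m
    rwa [div_le_iff₀' (by positivity)] at this
  have h2 : 1 + r ≤ 2 + Real.pi * r ^ 2 := by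
    nlinarith [Real.pi_gt_three, sq_nonneg (r - 1), sq_nonneg r]
  calc (1 + r) ^ m * Real.exp (-(Real.pi * r ^ 2))
      ≤ (m.factorial * Real.exp (2 + Real.pi * r ^ 2)) * Real.exp (-(Real.pi * r ^ 2)) := by
        gcongr
        exact h1.trans (by gcongr)
    _ = m.factorial * Real.exp 2 := by
        rw [mul_assoc, ← Real.exp_add]
        congr 2
        ring

/-- The Gaussian `e^{-π|x|²}` as a real-valued Schwartz function. -/
noncomputable def realGaussian : 𝓢(Rd d, ℝ) where
  toFun x := Real.exp (-(Real.pi * ‖x‖ ^ 2))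
  smooth' := Real.contDiff_exp.comp ((contDiff_const.mul (contDiff_norm_sq ℝ)).neg)
  decay' := by
    intro k n
    have hq : (fun x : Rd d => -(Real.pi * ‖x‖ ^ 2)).HasTemperateGrowth :=
      ((Function.HasTemperateGrowth.const Real.pi).mul
        (Function.hasTemperateGrowth_norm_sq (Rd d))).neg
    obtain ⟨l, C, hC, hD⟩ := hq.norm_iteratedFDeriv_le_uniform n
    refine ⟨n.factorial * (C + 1) ^ n * ((l * n + k).factorial * Real.exp 2), fun x => ?_⟩
    have h1 : 1 ≤ (C + 1) * (1 + ‖x‖) ^ l :=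
      one_le_mul_of_one_le_of_one_le (by linarith) (one_le_pow₀ (by linarith [norm_nonneg x]))
    have h := norm_iteratedFDeriv_comp_le (N := n) Real.contDiff_exp
      (hq.1.of_le (mod_cast le_top)) le_rfl x
      (C := Real.exp (-(Real.pi * ‖x‖ ^ 2))) (D := (C + 1) * (1 + ‖x‖) ^ l)
      (fun i _ => (norm_iteratedFDeriv_exp i _).le) (fun i hi hin => by
        refine (hD i hin x).trans (le_trans ?_ (le_self_pow₀ h1 (by omega)))
        gcongr
        linarith)
    calc ‖x‖ ^ k * ‖iteratedFDeriv ℝ n (fun x => Real.exp (-(Real.pi * ‖x‖ ^ 2))) x‖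
        ≤ (1 + ‖x‖) ^ k * (n.factorial * Real.exp (-(Real.pi * ‖x‖ ^ 2)) *
            ((C + 1) * (1 + ‖x‖) ^ l) ^ n) := by
          gcongr
          · linarith
          · exact h
      _ = n.factorial * (C + 1) ^ n *
          ((1 + ‖x‖) ^ (l * n + k) * Real.exp (-(Real.pi * ‖x‖ ^ 2))) := by
          rw [mul_pow, pow_add, pow_mul]; ring
      _ ≤ _ := by
          exact mul_le_mul_of_nonneg_left (one_add_pow_mul_exp_le _ (norm_nonneg x))
            (by positivity)

/-- The Gaussian `e^{-π|x|²}` as a complex-valued Schwartz function. -/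
noncomputable def gaussian : 𝓢(Rd d, ℂ) :=
  SchwartzMap.postcompCLM (𝕜 := ℝ) Complex.ofRealCLM realGaussian

theorem gaussian_apply (x : Rd d) : gaussian x = Complex.exp (-(Real.pi * ‖x‖ ^ 2 : ℝ)) := by
  rw [gaussian, SchwartzMap.postcompCLM_apply]
  change ((Real.exp (-(Real.pi * ‖x‖ ^ 2)) : ℝ) : ℂ) = _
  push_cast
  rfl

theorem fourierInv_gaussian : FourierTransform.fourierInv (gaussian : 𝓢(Rd d, ℂ)) = gaussian := by
  ext x
  rw [SchwartzMap.fourierInv_apply_eq, SchwartzMap.compCLMOfContinuousLinearEquiv_apply,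
    SchwartzMap.fourier_coe]
  have h := fourier_gaussian_innerProductSpace (V := Rd d) (b := Real.pi)
    (by simpa using Real.pi_pos) (-x)
  have hg : (gaussian : Rd d → ℂ) = fun v => Complex.exp (-(Real.pi : ℂ) * (‖v‖ : ℂ) ^ 2) := by
    funext v
    rw [gaussian_apply]
    push_cast
    ring_nf
  have hpi : (Real.pi : ℂ) ≠ 0 := by exact_mod_cast Real.pi_ne_zero
  rw [hg]
  refine h.trans ?_
  rw [div_self hpi, Complex.one_cpow, one_mul, norm_neg]
  congr 1
  field_simp

theorem fourier_gaussian : FourierTransform.fourier (gaussian : 𝓢(Rd d, ℂ)) = gaussian := by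
  conv_lhs => rw [← fourierInv_gaussian]
  exact FourierTransform.fourier_fourierInv_eq _

/-- The modulus of the one-dimensional short-time Fourier transform of `e^{-πzt²}` with Gaussian
window, at the point `(a, b)` of the phase plane. -/
noncomputable def gaussKernel (z : ℂ) (a b : ℝ) : ℝ :=
  ‖(z + 1)⁻¹‖ ^ (1 / 2 : ℝ) * Real.exp (Real.pi * ((z + 1)⁻¹.re * (a ^ 2 - b ^ 2) +
    2 * a * b * (z + 1)⁻¹.im) - Real.pi * a ^ 2)

/-- The value of the Gaussian integral that defines the short-time Fourier transform of
`e^{-πzt²}`. -/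
theorem norm_gaussian_integral_eq {z : ℂ} (hz : 0 < z.re) (a b : ℝ) :
    ‖((Real.pi : ℂ) / (Real.pi * (z + 1))) ^ (1 / 2 : ℂ) *
      Complex.exp ((2 * Real.pi * (a - Complex.I * b)) ^ 2 / (4 * (Real.pi * (z + 1))))‖ *
        Real.exp (-(Real.pi * a ^ 2)) = gaussKernel z a b := by
  have hpi : (Real.pi : ℂ) ≠ 0 := by exact_mod_cast Real.pi_ne_zero
  have hz1 : z + 1 ≠ 0 := fun h => by
    have := congrArg Complex.re h
    simp at this
    linarith
  have h1 : (Real.pi : ℂ) / (Real.pi * (z + 1)) = (z + 1)⁻¹ := by field_simp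
  have h2 : (2 * Real.pi * (a - Complex.I * b)) ^ 2 / (4 * (Real.pi * (z + 1))) =
      Real.pi * ((a - Complex.I * b) ^ 2 * (z + 1)⁻¹) := by field_simp; ring
  have h3 : ((1 / 2 : ℂ)) = ((1 / 2 : ℝ) : ℂ) := by push_cast; rfl
  rw [h1, h2, h3, norm_mul, Complex.norm_cpow_real, Complex.norm_exp, gaussKernel, mul_assoc,
    ← Real.exp_add]
  congr 2
  have h4 : (a - Complex.I * b) ^ 2 =
      ((a ^ 2 - b ^ 2 : ℝ) : ℂ) + ((-2 * a * b : ℝ) : ℂ) * Complex.I := by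
    push_cast
    linear_combination (b : ℂ) ^ 2 * Complex.I_sq
  rw [h4]
  simp only [Complex.mul_re, Complex.add_re, Complex.add_im, Complex.mul_im, Complex.ofReal_re,
    Complex.ofReal_im, Complex.I_re, Complex.I_im]
  ring

/-- The integral of `gaussKernel z` over the phase plane, by two Gaussian integrations. The
hypothesis makes the quadratic form in the exponent negative definite. -/
theorem integral_integral_gaussKernel {z : ℂ} (hz : 0 < z.re) :
    ∫ a : ℝ, ∫ b : ℝ, gaussKernel z a b = Real.sqrt (‖z + 1‖ / z.re) := by
  set u := (z + 1)⁻¹.re with hu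
  set v := (z + 1)⁻¹.im with hv
  have hz1 : z + 1 ≠ 0 := fun h => by
    have := congrArg Complex.re h
    simp at this
    linarith
  have hn : 0 < Complex.normSq (z + 1) := Complex.normSq_pos.2 hz1
  have hu' : u = (z.re + 1) / Complex.normSq (z + 1) := by
    rw [hu, Complex.inv_re]; simp
  have hu0 : 0 < u := by rw [hu']; positivity
  have huv : u ^ 2 + v ^ 2 = 1 / Complex.normSq (z + 1) := by
    rw [one_div, ← Complex.normSq_inv, Complex.normSq_apply]; ring
  have hdisc : u - u ^ 2 - v ^ 2 = z.re / Complex.normSq (z + 1) := by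
    have : u - u ^ 2 - v ^ 2 = u - (u ^ 2 + v ^ 2) := by ring
    rw [this, huv, hu', ← sub_div]
    congr 1
    ring
  have hd0 : 0 < u - u ^ 2 - v ^ 2 := by rw [hdisc]; positivity
  set e := 1 - u - v ^ 2 / u with he
  have he' : e = (u - u ^ 2 - v ^ 2) / u := by rw [he]; field_simp
  have he0 : 0 < e := by rw [he']; positivity
  have h1 : ∀ a, ∫ b : ℝ, gaussKernel z a b =
      (‖(z + 1)⁻¹‖ ^ (1 / 2 : ℝ) * Real.sqrt (1 / u)) *
        Real.exp (-(Real.pi * e) * a ^ 2) := fun a => by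
    -- Complete the square in `b`.
    have : ∀ b, gaussKernel z a b =
        (‖(z + 1)⁻¹‖ ^ (1 / 2 : ℝ) * Real.exp (-(Real.pi * e) * a ^ 2)) *
          Real.exp (-(Real.pi * u) * (b - v * a / u) ^ 2) := fun b => by
      rw [gaussKernel, mul_assoc (‖(z + 1)⁻¹‖ ^ (1 / 2 : ℝ)), ← Real.exp_add, ← hu, ← hv]
      congr 2
      rw [he]
      field_simp
      ring
    simp only [this]
    rw [integral_const_mul, integral_sub_right_eq_self (fun b => Real.exp (-(Real.pi * u) * b ^ 2)),
      integral_gaussian, show Real.pi / (Real.pi * u) = 1 / u by field_simp]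
    ring
  simp only [h1]
  rw [integral_const_mul, integral_gaussian, show Real.pi / (Real.pi * e) = 1 / e by field_simp,
    ← Real.sqrt_eq_rpow, ← Real.sqrt_mul (norm_nonneg _), ← Real.sqrt_mul (by positivity)]
  congr 1
  rw [he', hdisc, norm_inv, Complex.normSq_eq_norm_sq]
  have : ‖z + 1‖ ≠ 0 := norm_ne_zero_iff.2 hz1
  field_simp

theorem integral_comp_isometry (O : Rd d ≃ₗᵢ[ℝ] Rd d) {E : Type*} [NormedAddCommGroup E]
    [NormedSpace ℝ E] (F : Rd d → E) : ∫ x, F (O x) = ∫ x, F x :=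
  O.measurePreserving.integral_comp O.toHomeomorph.measurableEmbedding F

theorem integral_toLp {E : Type*} [NormedAddCommGroup E]
    [NormedSpace ℝ E] (F : Rd d → E) : ∫ x, F x = ∫ v : Fin d → ℝ, F (WithLp.toLp 2 v) :=
  ((PiLp.volume_preserving_toLp (Fin d)).integral_comp
    (MeasurableEquiv.toLp 2 _).measurableEmbedding F).symm

/-- The short-time Fourier transform of a generalized Gaussian factors in rotated coordinates. -/
theorem norm_schwartzStft_gaussian {F : 𝓢(Rd d, ℂ)} (O : Rd d ≃ₗᵢ[ℝ] Rd d) {ζ : Fin d → ℂ}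
    (hζ : ∀ j, 0 < (ζ j).re)
    (hF : ∀ y, F y = Complex.exp (-(Real.pi * ∑ j, ζ j * ((O y j : ℝ) : ℂ) ^ 2))) (x ξ : Rd d) :
    ‖schwartzStft gaussian F (x, ξ)‖ = ∏ j, gaussKernel (ζ j) (O x j) (O ξ j) := by
  have h1 : schwartzStft gaussian F (x, ξ) =
      (∏ j, Complex.exp (-(Real.pi * (O x j) ^ 2 : ℝ))) *
      ∫ v : Fin d → ℝ, Complex.exp (-∑ j, (Real.pi * (ζ j + 1)) * ((v j : ℝ) : ℂ) ^ 2 +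
        ∑ j, (2 * Real.pi * ((O x j : ℝ) - Complex.I * (O ξ j : ℝ))) * ((v j : ℝ) : ℂ)) := by
    rw [schwartzStft, ← integral_comp_isometry O.symm, integral_toLp, ← integral_const_mul]
    congr with v
    set y : Rd d := O.symm (WithLp.toLp 2 v) with hy
    have hOy : ∀ j, O y j = v j := fun j => by rw [hy, O.apply_symm_apply]
    have hn : ‖y - x‖ ^ 2 = ∑ j, (v j - O x j) ^ 2 := by
      rw [← O.norm_map (y - x), EuclideanSpace.norm_sq_eq, map_sub]
      simp [hOy]
    have hi : inner ℝ y ξ = ∑ j, v j * O ξ j := by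
      rw [← O.inner_map_map y ξ, PiLp.inner_apply]
      refine Finset.sum_congr rfl fun j _ => ?_
      rw [hOy, real_inner_eq_re_inner]
      simp [mul_comm]
    rw [hF, timeFreqShift_apply, gaussian_apply, char, hn, hi, ← Complex.exp_sum, ← Complex.exp_add,
      ← Complex.exp_add, ← Complex.exp_add]
    congr 1
    simp only [hOy]
    push_cast
    simp only [Finset.mul_sum, Finset.sum_mul, ← Finset.sum_neg_distrib, ← Finset.sum_add_distrib]
    refine Finset.sum_congr rfl fun j _ => ?_
    ring
  have hb : ∀ j, 0 < ((Real.pi : ℂ) * (ζ j + 1)).re := fun j => by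
    rw [Complex.re_ofReal_mul, Complex.add_re, Complex.one_re]
    have := hζ j
    positivity
  rw [h1, GaussianFourier.integral_cexp_neg_sum_mul_add hb, ← Finset.prod_mul_distrib, norm_prod]
  refine Finset.prod_congr rfl fun j _ => ?_
  rw [← norm_gaussian_integral_eq (hζ j), norm_mul, mul_comm, ← Complex.ofReal_neg,
    ← Complex.ofReal_exp, Complex.norm_real, Real.norm_of_nonneg (Real.exp_pos _).le]

/-- The `M¹` norm of the generalized Gaussian `e^{-π ∑ ζⱼ yⱼ²}` in the rotated coordinates `O y`. -/
theorem modNorm_gaussian {F : 𝓢(Rd d, ℂ)} (O : Rd d ≃ₗᵢ[ℝ] Rd d) {ζ : Fin d → ℂ}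
    (hζ : ∀ j, 0 < (ζ j).re)
    (hF : ∀ y, F y = Complex.exp (-(Real.pi * ∑ j, ζ j * ((O y j : ℝ) : ℂ) ^ 2))) :
    modNorm gaussian F = ENNReal.ofReal (∏ j, Real.sqrt (‖ζ j + 1‖ / (ζ j).re)) := by
  rw [modNorm, ← ofReal_integral_norm_eq_lintegral_enorm (integrable_schwartzStft _ _)]
  congr 1
  rw [Measure.volume_eq_prod, integral_prod _ (integrable_schwartzStft _ _).norm]
  simp only [norm_schwartzStft_gaussian O hζ hF]
  have h1 : ∀ x : Rd d, ∫ ξ : Rd d, ∏ j, gaussKernel (ζ j) (O x j) (O ξ j) =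
      ∏ j, ∫ b, gaussKernel (ζ j) (O x j) b := fun x => by
    rw [integral_comp_isometry O (fun ξ => ∏ j, gaussKernel (ζ j) (O x j) (ξ j)), integral_toLp]
    exact integral_fintype_prod_volume_eq_prod fun j b => gaussKernel (ζ j) (O x j) b
  simp only [h1]
  rw [integral_comp_isometry O (fun x => ∏ j, ∫ b, gaussKernel (ζ j) (x j) b), integral_toLp]
  refine (integral_fintype_prod_volume_eq_prod
    fun j (a : ℝ) => ∫ b, gaussKernel (ζ j) a b).trans ?_
  exact Finset.prod_congr rfl fun j _ => integral_integral_gaussKernel (hζ j)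

end Gaussian

/-! ### Generators of the symplectic group -/

section Generators

variable {d : ℕ}

theorem inner_toEuclideanLin_left (A : Matrix (Fin d) (Fin d) ℝ) (x y : Rd d) :
    inner ℝ (A.toEuclideanLin x) y = inner ℝ x (A.transpose.toEuclideanLin y) := by
  rw [← Matrix.conjTranspose_eq_transpose_of_trivial,
    Matrix.toEuclideanLin_conjTranspose_eq_adjoint, LinearMap.adjoint_inner_right]

theorem continuous_toEuclideanLin (A : Matrix (Fin d) (Fin d) ℝ) : Continuous A.toEuclideanLin :=
  LinearMap.continuous_of_finiteDimensional _

theorem det_toEuclideanLin (A : Matrix (Fin d) (Fin d) ℝ) :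
    LinearMap.det A.toEuclideanLin = A.det :=
  LinearMap.det_toLpLin 2 A

/-- The phase `-π ⟨x, Q x⟩` of a chirp. -/
noncomputable def chirpPhase (Q : Matrix (Fin d) (Fin d) ℝ) (x : Rd d) : ℝ :=
  -(Real.pi * inner ℝ x (Q.toEuclideanLin x))

theorem chirp_hasTemperateGrowth (Q : Matrix (Fin d) (Fin d) ℝ) :
    (fun x : Rd d => Complex.exp (chirpPhase Q x * Complex.I)).HasTemperateGrowth := by
  have h : (fun x : Rd d => inner ℝ x (Q.toEuclideanLin x)).HasTemperateGrowth :=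
    (innerSL ℝ).bilinear_hasTemperateGrowth Function.HasTemperateGrowth.id'
      (Q.toEuclideanLin.toContinuousLinearMap.hasTemperateGrowth)
  exact exp_mul_I_hasTemperateGrowth.comp
    (((Function.HasTemperateGrowth.const Real.pi).mul h).neg)

/-- Multiplication by the chirp `e^{-π i ⟨x, Q x⟩}`. -/
noncomputable def chirp (Q : Matrix (Fin d) (Fin d) ℝ) : 𝓢(Rd d, ℂ) →L[ℂ] 𝓢(Rd d, ℂ) :=
  SchwartzMap.smulLeftCLM ℂ fun x : Rd d => Complex.exp (chirpPhase Q x * Complex.I)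

theorem chirp_apply (Q : Matrix (Fin d) (Fin d) ℝ) (φ : 𝓢(Rd d, ℂ)) (x : Rd d) :
    chirp Q φ x = Complex.exp (chirpPhase Q x * Complex.I) * φ x := by
  rw [chirp, SchwartzMap.smulLeftCLM_apply_apply (chirp_hasTemperateGrowth Q), smul_eq_mul]

theorem chirp_neg_chirp (Q : Matrix (Fin d) (Fin d) ℝ) (φ : 𝓢(Rd d, ℂ)) :
    chirp (-Q) (chirp Q φ) = φ := by
  ext x
  rw [chirp_apply, chirp_apply, ← mul_assoc, ← Complex.exp_add]
  simp [chirpPhase]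

theorem implements_chirp {Q : Matrix (Fin d) (Fin d) ℝ} (hQ : Q.IsSymm) :
    Implements (Matrix.fromBlocks 1 0 Q 1) (chirp Q) (chirp Q)
      (fun z => (z.1, z.2 + Q.toEuclideanLin z.1)) where
  transpose u φ := by
    congr with x
    rw [chirp_apply, chirp_apply]
    ring
  bijective := Function.bijective_iff_has_inverse.2 ⟨chirp (-Q), chirp_neg_chirp Q, fun φ => by
    simpa using chirp_neg_chirp (-Q) φ⟩
  norm_eq u := by
    rw [norm_toL2, norm_toL2]
    congr 1
    refine eLpNorm_congr_norm_ae (Eventually.of_forall fun x => ?_)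
    rw [chirp_apply, norm_mul, Complex.norm_exp_ofReal_mul_I, one_mul]
  intertwine z φ := by
    ext y
    have h1 : inner ℝ z.1 (Q.toEuclideanLin y) = inner ℝ y (Q.toEuclideanLin z.1) := by
      rw [← real_inner_comm, inner_toEuclideanLin_left, hQ]
    rw [schrodingerTranspose_apply, chirp_apply, chirp_apply, schrodingerTranspose_apply,
      phaseAct_fromBlocks]
    simp only [toEuclideanLin_one_apply, map_zero, LinearMap.zero_apply, add_zero]
    rw [← mul_assoc, ← mul_assoc, ← Complex.exp_add, ← Complex.exp_add]
    congr 2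
    simp only [chirpPhase, map_sub, inner_sub_left, inner_sub_right, inner_add_right, h1]
    push_cast
    ring
  act_eq z := by
    rw [phaseAct_fromBlocks]
    simp
  measurePreserving := by
    refine (MeasurePreserving.id volume).skew_product (g := fun x ξ => ξ + Q.toEuclideanLin x) ?_
      (Eventually.of_forall fun x => map_add_right_eq_self _ _)
    exact (measurable_snd.add ((continuous_toEuclideanLin Q).measurable.comp measurable_fst))

/-- The inverse Fourier transform implements the quarter turn `(a, b) ↦ (b, -a)`. -/
theorem implements_fourierInv :
    Implements (d := d) (Matrix.fromBlocks 0 1 (-1) 0)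
      (FourierTransform.fourierInvCLM ℂ 𝓢(Rd d, ℂ)) (FourierTransform.fourierInvCLM ℂ 𝓢(Rd d, ℂ))
      (fun z => (z.2, -z.1)) where
  transpose u φ := by
    simpa using (SchwartzMap.integral_fourierInv_mul_eq u φ)
  bijective := Function.bijective_iff_has_inverse.2
    ⟨FourierTransform.fourierCLM ℂ 𝓢(Rd d, ℂ), fun φ => by simp, fun φ => by simp⟩
  norm_eq u := by
    have h := SchwartzMap.norm_fourier_toL2_eq (FourierTransform.fourierInv u)
    rw [FourierTransform.fourier_fourierInv_eq] at h
    exact h.symm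
  intertwine z φ := by
    rw [phaseAct_fromBlocks, schrodingerTranspose, schrodingerTranspose]
    simp only [FourierTransform.fourierInvCLM_apply, map_smul, fourierInv_timeFreqShift, smul_smul,
      toEuclideanLin_one_apply, map_zero, LinearMap.zero_apply, add_zero, zero_add, map_neg,
      LinearMap.neg_apply, neg_neg]
    congr 1
    rw [char, ← Complex.exp_add]
    congr 1
    simp only [inner_neg_right, real_inner_comm z.1 z.2]
    push_cast
    ring
  act_eq z := by
    rw [phaseAct_fromBlocks]
    simp
  measurePreserving :=
    ((MeasurePreserving.id volume).prod (Measure.measurePreserving_neg volume)).comp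
      Measure.measurePreserving_swap

/-- The Fourier transform implements the quarter turn `(a, b) ↦ (-b, a)`. -/
theorem implements_fourier :
    Implements (d := d) (Matrix.fromBlocks 0 (-1) 1 0)
      (FourierTransform.fourierCLM ℂ 𝓢(Rd d, ℂ)) (FourierTransform.fourierCLM ℂ 𝓢(Rd d, ℂ))
      (fun z => (-z.2, z.1)) where
  transpose u φ := by
    simpa using (SchwartzMap.integral_fourier_mul_eq u φ)
  bijective := Function.bijective_iff_has_inverse.2
    ⟨FourierTransform.fourierInvCLM ℂ 𝓢(Rd d, ℂ), fun φ => by simp, fun φ => by simp⟩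
  norm_eq u := SchwartzMap.norm_fourier_toL2_eq u
  intertwine z φ := by
    rw [phaseAct_fromBlocks, schrodingerTranspose, schrodingerTranspose]
    simp only [FourierTransform.fourierCLM_apply, map_smul, fourier_timeFreqShift, smul_smul,
      toEuclideanLin_one_apply, map_zero, LinearMap.zero_apply, add_zero, zero_add, map_neg,
      LinearMap.neg_apply, neg_neg]
    congr 1
    rw [char, ← Complex.exp_add]
    congr 1
    simp only [inner_neg_right, inner_neg_left, real_inner_comm z.1 z.2]
    push_cast
    ring
  act_eq z := by
    rw [phaseAct_fromBlocks]
    simp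
  measurePreserving :=
    ((Measure.measurePreserving_neg volume).prod (MeasurePreserving.id volume)).comp
      Measure.measurePreserving_swap

theorem toEuclideanLin_inv_apply {L : Matrix (Fin d) (Fin d) ℝ} (hL : L.det ≠ 0) (x : Rd d) :
    L⁻¹.toEuclideanLin (L.toEuclideanLin x) = x := by
  rw [← toEuclideanLin_mul_apply, Matrix.nonsing_inv_mul _ (isUnit_iff_ne_zero.2 hL),
    toEuclideanLin_one_apply]

theorem toEuclideanLin_apply_inv {L : Matrix (Fin d) (Fin d) ℝ} (hL : L.det ≠ 0) (x : Rd d) :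
    L.toEuclideanLin (L⁻¹.toEuclideanLin x) = x := by
  rw [← toEuclideanLin_mul_apply, Matrix.mul_nonsing_inv _ (isUnit_iff_ne_zero.2 hL),
    toEuclideanLin_one_apply]

/-- An invertible matrix, as a continuous linear automorphism of Euclidean space. -/
noncomputable def matrixEquiv {L : Matrix (Fin d) (Fin d) ℝ} (hL : L.det ≠ 0) : Rd d ≃L[ℝ] Rd d :=
  ContinuousLinearEquiv.equivOfInverse L.toEuclideanLin.toContinuousLinearMap
    L⁻¹.toEuclideanLin.toContinuousLinearMap (toEuclideanLin_inv_apply hL)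
    (toEuclideanLin_apply_inv hL)

/-- The normalized dilation `φ ↦ |det L|^{1/2} φ(L ·)`. -/
noncomputable def dilation {L : Matrix (Fin d) (Fin d) ℝ} (hL : L.det ≠ 0) :
    𝓢(Rd d, ℂ) →L[ℂ] 𝓢(Rd d, ℂ) :=
  ((|L.det| ^ (1 / 2 : ℝ) : ℝ) : ℂ) •
    SchwartzMap.compCLMOfContinuousLinearEquiv ℂ (matrixEquiv hL)

theorem dilation_apply {L : Matrix (Fin d) (Fin d) ℝ} (hL : L.det ≠ 0) (φ : 𝓢(Rd d, ℂ))
    (x : Rd d) :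
    dilation hL φ x = ((|L.det| ^ (1 / 2 : ℝ) : ℝ) : ℂ) * φ (L.toEuclideanLin x) := rfl

theorem det_inv_ne_zero {L : Matrix (Fin d) (Fin d) ℝ} (hL : L.det ≠ 0) : L⁻¹.det ≠ 0 := by
  rw [Matrix.det_nonsing_inv, Ring.inverse_eq_inv]
  exact inv_ne_zero hL

theorem rpow_det_mul {L : Matrix (Fin d) (Fin d) ℝ} (hL : L.det ≠ 0) :
    |L.det| ^ (1 / 2 : ℝ) * |L⁻¹.det| ^ (1 / 2 : ℝ) = 1 := by
  rw [← Real.mul_rpow (abs_nonneg _) (abs_nonneg _), Matrix.det_nonsing_inv, Ring.inverse_eq_inv,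
    abs_inv, mul_inv_cancel₀ (abs_ne_zero.2 hL), Real.one_rpow]

theorem dilation_dilation_inv {L : Matrix (Fin d) (Fin d) ℝ} (hL : L.det ≠ 0) (φ : 𝓢(Rd d, ℂ)) :
    dilation hL (dilation (det_inv_ne_zero hL) φ) = φ := by
  ext x
  rw [dilation_apply, dilation_apply, toEuclideanLin_inv_apply hL, ← mul_assoc,
    ← Complex.ofReal_mul, rpow_det_mul hL, Complex.ofReal_one, one_mul]

theorem dilation_inv_dilation {L : Matrix (Fin d) (Fin d) ℝ} (hL : L.det ≠ 0) (φ : 𝓢(Rd d, ℂ)) :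
    dilation (det_inv_ne_zero hL) (dilation hL φ) = φ := by
  ext x
  rw [dilation_apply, dilation_apply, toEuclideanLin_apply_inv hL, ← mul_assoc,
    ← Complex.ofReal_mul, mul_comm (|L⁻¹.det| ^ (1 / 2 : ℝ)), rpow_det_mul hL, Complex.ofReal_one,
    one_mul]

theorem integral_dilation_inv_mul {L : Matrix (Fin d) (Fin d) ℝ} (hL : L.det ≠ 0)
    (u φ : 𝓢(Rd d, ℂ)) :
    ∫ x, dilation (det_inv_ne_zero hL) u x * φ x = ∫ x, u x * dilation hL φ x := by
  have h1 : LinearMap.det L.toEuclideanLin ≠ 0 := by rwa [det_toEuclideanLin]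
  have h := (matrixEquiv hL).toHomeomorph.measurableEmbedding.integral_map (μ := volume)
    fun x => dilation (det_inv_ne_zero hL) u x * φ x
  have h2 : (volume : Measure (Rd d)).map (matrixEquiv hL).toHomeomorph =
      ENNReal.ofReal |L.det⁻¹| • volume := by
    rw [← det_toEuclideanLin]
    exact Measure.map_linearMap_addHaar_eq_smul_addHaar volume h1
  rw [h2, integral_smul_measure, ENNReal.toReal_ofReal (abs_nonneg _)] at h
  have h3 : ∫ x, u x * dilation hL φ x = |L.det| • ∫ x,
      dilation (det_inv_ne_zero hL) u (L.toEuclideanLin x) * φ (L.toEuclideanLin x) := by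
    rw [← integral_smul]
    congr with x
    rw [dilation_apply, dilation_apply, toEuclideanLin_inv_apply hL, Complex.real_smul]
    have h4 : |L.det| * |L⁻¹.det| ^ (1 / 2 : ℝ) = |L.det| ^ (1 / 2 : ℝ) := by
      nth_rewrite 1 [← Real.rpow_one |L.det|]
      rw [show (1 : ℝ) = 1 / 2 + 1 / 2 by norm_num, Real.rpow_add (abs_pos.2 hL), mul_assoc]
      rw [show (1 / 2 + 1 / 2 : ℝ) = 1 by norm_num, rpow_det_mul hL, mul_one]
    rw [← h4]
    push_cast
    ring
  rw [h3]
  refine Eq.trans ?_ (congrArg (fun w : ℂ => |L.det| • w) h)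
  rw [smul_smul, ← abs_mul, mul_inv_cancel₀ hL, abs_one, one_smul]

/-- The Jacobians of `L⁻¹` and `Lᵀ` cancel. -/
theorem measurePreserving_dilation {L : Matrix (Fin d) (Fin d) ℝ} (hL : L.det ≠ 0) :
    MeasurePreserving fun z : Rd d × Rd d =>
      (L⁻¹.toEuclideanLin z.1, L.transpose.toEuclideanLin z.2) := by
  have h1 : LinearMap.det L⁻¹.toEuclideanLin ≠ 0 := by
    rw [det_toEuclideanLin]; exact det_inv_ne_zero hL
  have h2 : LinearMap.det L.transpose.toEuclideanLin ≠ 0 := by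
    rw [det_toEuclideanLin, Matrix.det_transpose]; exact hL
  have m1 := (continuous_toEuclideanLin L⁻¹).measurable
  have m2 := (continuous_toEuclideanLin L.transpose).measurable
  refine ⟨(m1.comp measurable_fst).prodMk (m2.comp measurable_snd), ?_⟩
  rw [Measure.volume_eq_prod]
  refine (Measure.map_prod_map volume volume m1 m2).symm.trans ?_
  rw [Measure.map_linearMap_addHaar_eq_smul_addHaar volume h1,
    Measure.map_linearMap_addHaar_eq_smul_addHaar volume h2, Measure.prod_smul_left,
    Measure.prod_smul_right, smul_smul, ← ENNReal.ofReal_mul (abs_nonneg _), ← abs_mul,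
    det_toEuclideanLin, det_toEuclideanLin, Matrix.det_transpose, Matrix.det_nonsing_inv,
    Ring.inverse_eq_inv, inv_inv, mul_inv_cancel₀ hL]
  simp

theorem implements_dilation {L : Matrix (Fin d) (Fin d) ℝ} (hL : L.det ≠ 0) :
    Implements (Matrix.fromBlocks L 0 0 (L⁻¹).transpose) (dilation hL)
      (dilation (det_inv_ne_zero hL))
      (fun z => (L⁻¹.toEuclideanLin z.1, L.transpose.toEuclideanLin z.2)) where
  transpose u φ := integral_dilation_inv_mul hL u φ
  bijective := Function.bijective_iff_has_inverse.2 ⟨dilation hL, dilation_dilation_inv hL,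
    dilation_inv_dilation hL⟩
  norm_eq u := by
    -- Apply the transpose identity to the complex conjugate of `u`.
    have h1 : inner ℂ (toL2 (dilation (det_inv_ne_zero hL) u))
        (toL2 (dilation (det_inv_ne_zero hL) u)) = inner ℂ (toL2 u) (toL2 u) := by
      rw [inner_toL2, inner_toL2]
      have h := integral_dilation_inv_mul hL u (dilation (det_inv_ne_zero hL) (conj u))
      rw [dilation_dilation_inv] at h
      refine Eq.trans (integral_congr_ae (Eventually.of_forall fun x => ?_)) (h.trans
        (integral_congr_ae (Eventually.of_forall fun x => ?_)))
      · simp only [RCLike.inner_apply, dilation_apply, conj_apply, map_mul, Complex.conj_ofReal]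
      · simp only [RCLike.inner_apply, conj_apply]
    rw [norm_eq_sqrt_re_inner (𝕜 := ℂ), h1, ← norm_eq_sqrt_re_inner]
  intertwine z φ := by
    have hb : ∀ x b : Rd d, inner ℝ (L.toEuclideanLin x) ((L⁻¹).transpose.toEuclideanLin b) =
        inner ℝ x b := fun x b => by
      rw [← inner_toEuclideanLin_left, toEuclideanLin_inv_apply hL]
    ext y
    rw [schrodingerTranspose_apply, dilation_apply, dilation_apply, schrodingerTranspose_apply,
      phaseAct_fromBlocks]
    simp only [map_zero, LinearMap.zero_apply, add_zero, zero_add, hb, map_sub]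
    ring
  act_eq z := by
    rw [phaseAct_fromBlocks]
    have h : (L⁻¹).transpose.toEuclideanLin (L.transpose.toEuclideanLin z.2) = z.2 := by
      rw [← toEuclideanLin_mul_apply, ← Matrix.transpose_mul,
        Matrix.mul_nonsing_inv _ (isUnit_iff_ne_zero.2 hL), Matrix.transpose_one,
        toEuclideanLin_one_apply]
    simp only [map_zero, LinearMap.zero_apply, neg_zero, add_zero, zero_add, map_neg, h,
      toEuclideanLin_apply_inv hL]
  measurePreserving := measurePreserving_dilation hL

end Generators

/-! ### Images of the Gaussian under the generators -/

section GaussianImages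

variable {d : ℕ}

theorem modNorm_smul (c : ℂ) (φ ψ : 𝓢(Rd d, ℂ)) : modNorm φ (c • ψ) = ‖c‖ₑ * modNorm φ ψ := by
  rw [modNorm, modNorm, ← lintegral_const_mul _ (measurable_enorm_schwartzStft φ ψ)]
  refine lintegral_congr fun z => ?_
  rw [← enorm_mul, schwartzStft, schwartzStft, ← integral_const_mul]
  congr 2 with t
  rw [smul_apply, smul_eq_mul, mul_assoc]

/-- Diagonalization of a symmetric quadratic form in an orthonormal basis of eigenvectors. -/
theorem inner_toEuclideanLin_eq_sum {H : Matrix (Fin d) (Fin d) ℝ} (hH : H.IsHermitian)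
    (y : Rd d) :
    inner ℝ y (H.toEuclideanLin y) =
      ∑ j, hH.eigenvalues j * (hH.eigenvectorBasis.repr y j) ^ 2 := by
  rw [← hH.eigenvectorBasis.sum_inner_mul_inner]
  refine Finset.sum_congr rfl fun j _ => ?_
  have h1 : inner ℝ (hH.eigenvectorBasis j) (H.toEuclideanLin y) =
      hH.eigenvalues j * inner ℝ (hH.eigenvectorBasis j) y := by
    have h2 : H.toEuclideanLin (hH.eigenvectorBasis j) =
        hH.eigenvalues j • hH.eigenvectorBasis j := by
      have := hH.mulVec_eigenvectorBasis j
      ext i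
      simpa [Matrix.toLpLin_apply] using congrFun this i
    have h3 : H.transpose = H := by rw [← Matrix.conjTranspose_eq_transpose_of_trivial]; exact hH
    have h4 := inner_toEuclideanLin_left H (hH.eigenvectorBasis j) y
    rw [h3, h2, inner_smul_left] at h4
    exact h4.symm
  rw [h1, hH.eigenvectorBasis.repr_apply_apply, real_inner_comm]
  ring

theorem norm_sq_eq_sum {H : Matrix (Fin d) (Fin d) ℝ} (hH : H.IsHermitian) (y : Rd d) :
    ‖y‖ ^ 2 = ∑ j, (hH.eigenvectorBasis.repr y j) ^ 2 := by
  rw [← hH.eigenvectorBasis.repr.norm_map y, EuclideanSpace.norm_sq_eq]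
  simp

/-- The characteristic polynomial of a real symmetric matrix at a complex point. -/
theorem norm_det_sub {H : Matrix (Fin d) (Fin d) ℝ} (hH : H.IsHermitian) (z : ℂ) :
    ‖(Matrix.scalar (Fin d) z - toC H).det‖ = ∏ j, ‖z - hH.eigenvalues j‖ := by
  rw [← norm_prod, ← Matrix.eval_charpoly]
  have h : (toC H).charpoly = H.charpoly.map Complex.ofRealHom :=
    H.charpoly_map Complex.ofRealHom
  rw [h, hH.charpoly_eq]
  simp [Polynomial.eval_prod, Polynomial.map_prod]

theorem prod_norm_one_add {H : Matrix (Fin d) (Fin d) ℝ} (hH : H.IsHermitian) :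
    ∏ j, ‖1 + Complex.I * (hH.eigenvalues j : ℂ)‖ = ‖(1 + Complex.I • toC H).det‖ := by
  -- `i - H = i (1 + i H)`
  have h1 : Matrix.scalar (Fin d) Complex.I - toC H =
      Complex.I • (1 + Complex.I • toC H) := by
    rw [smul_add, smul_smul, Complex.I_mul_I, neg_one_smul, ← sub_eq_add_neg,
      Matrix.smul_one_eq_diagonal]
    rfl
  have h2 := norm_det_sub hH Complex.I
  rw [h1, Matrix.det_smul, norm_mul, norm_pow, Complex.norm_I, one_pow, one_mul] at h2
  rw [h2]
  refine Finset.prod_congr rfl fun j _ => ?_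
  have h3 : 1 + Complex.I * (hH.eigenvalues j : ℂ) =
      -Complex.I * (Complex.I - hH.eigenvalues j) := by
    linear_combination Complex.I_mul_I
  rw [h3, norm_mul, norm_neg, Complex.norm_I, one_mul]

/-- The image of the Gaussian under a chirp has the parameters `1 + iλⱼ`, where `λⱼ` are the
eigenvalues of `Q`. -/
theorem modNorm_chirp_le {Q : Matrix (Fin d) (Fin d) ℝ} (hQ : Q.IsSymm) :
    modNorm gaussian (chirp Q gaussian) ≤
      ENNReal.ofReal (Real.sqrt 2 ^ d * ‖(1 + Complex.I • toC Q).det‖ ^ (1 / 2 : ℝ)) := by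
  have hH : Q.IsHermitian := by
    rw [Matrix.IsHermitian, Matrix.conjTranspose_eq_transpose_of_trivial]; exact hQ
  rw [modNorm_gaussian (F := chirp Q gaussian) hH.eigenvectorBasis.repr
    (ζ := fun j => 1 + Complex.I * (hH.eigenvalues j : ℂ)) (fun j => by simp) (fun y => ?_)]
  · refine ENNReal.ofReal_le_ofReal ?_
    rw [← prod_norm_one_add hH, ← Real.sqrt_eq_rpow, Real.sqrt_prod _ fun _ _ => norm_nonneg _]
    have h0 : Real.sqrt 2 ^ d = ∏ _j : Fin d, Real.sqrt 2 := by simp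
    rw [h0, ← Finset.prod_mul_distrib]
    refine Finset.prod_le_prod (fun _ _ => Real.sqrt_nonneg _) fun j _ => ?_
    rw [← Real.sqrt_mul (by norm_num)]
    refine Real.sqrt_le_sqrt ?_
    have h1 : (1 : ℝ) ≤ ‖1 + Complex.I * (hH.eigenvalues j : ℂ)‖ := by
      simpa using Complex.abs_re_le_norm (1 + Complex.I * (hH.eigenvalues j : ℂ))
    have h2 := norm_add_le (1 + Complex.I * (hH.eigenvalues j : ℂ)) 1
    have h3 : (1 + Complex.I * (hH.eigenvalues j : ℂ)).re = 1 := by simp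
    rw [h3, div_one]
    -- `‖2 + iλ‖ ≤ ‖1 + iλ‖ + 1 ≤ 2 ‖1 + iλ‖`
    rw [norm_one] at h2
    linarith
  · rw [chirp_apply, gaussian_apply, ← Complex.exp_add, chirpPhase, inner_toEuclideanLin_eq_sum hH,
      norm_sq_eq_sum hH]
    congr 1
    push_cast
    simp only [add_mul, one_mul, Finset.sum_add_distrib, mul_assoc, ← Finset.mul_sum]
    ring

/-- The image of the Gaussian under a dilation has as parameters the eigenvalues of `Lᵀ L`, and the
product of these is `(det L)²`. -/
theorem modNorm_dilation_le {L : Matrix (Fin d) (Fin d) ℝ} (hL : L.det ≠ 0) :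
    modNorm gaussian (dilation hL gaussian) ≤ ENNReal.ofReal
      (‖(1 + toC L.transpose * toC L).det‖ ^ (1 / 2 : ℝ) * |L.det| ^ (-(1 / 2) : ℝ)) := by
  have hH : (L.transpose * L).IsHermitian := by
    rw [← Matrix.conjTranspose_eq_transpose_of_trivial]
    exact Matrix.isHermitian_conjTranspose_mul_self L
  have hpos : ∀ j, 0 < hH.eigenvalues j := by
    have h := Matrix.posSemidef_conjTranspose_mul_self L
    rw [Matrix.conjTranspose_eq_transpose_of_trivial] at h
    refine hH.posDef_iff_eigenvalues_pos.1 (h.posDef_iff_det_ne_zero.2 ?_)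
    rw [Matrix.det_mul, Matrix.det_transpose]
    exact mul_ne_zero hL hL
  have hprod : ∏ j, hH.eigenvalues j = L.det ^ 2 := by
    have := hH.det_eq_prod_eigenvalues
    rw [Matrix.det_mul, Matrix.det_transpose] at this
    rw [sq, this]
    simp
  have hF : dilation hL gaussian = ((|L.det| ^ (1 / 2 : ℝ) : ℝ) : ℂ) •
      SchwartzMap.compCLMOfContinuousLinearEquiv ℂ (matrixEquiv hL) gaussian := rfl
  rw [hF, modNorm_smul, modNorm_gaussian hH.eigenvectorBasis.repr
    (ζ := fun j => (hH.eigenvalues j : ℂ)) (fun j => by simpa using hpos j) (fun y => ?_)]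
  · rw [← ofReal_norm, ← ENNReal.ofReal_mul (norm_nonneg _), Complex.norm_real,
      Real.norm_of_nonneg (by positivity)]
    refine ENNReal.ofReal_le_ofReal (le_of_eq ?_)
    have h1 : ‖(1 + toC L.transpose * toC L).det‖ = ∏ j, ‖(hH.eigenvalues j : ℂ) + 1‖ := by
      have h2 := norm_det_sub hH (-1)
      have h3 : Matrix.scalar (Fin d) (-1 : ℂ) - toC (L.transpose * L) =
          -(1 + toC L.transpose * toC L) := by
        rw [map_neg, map_one, neg_add, sub_eq_add_neg]
        congr 2
        exact Matrix.map_mul (f := Complex.ofRealHom)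
      rw [h3, Matrix.det_neg, norm_mul, norm_pow, norm_neg, norm_one, one_pow, one_mul] at h2
      rw [h2]
      refine Finset.prod_congr rfl fun j _ => ?_
      rw [← norm_neg]
      congr 1
      ring
    have h4 : 0 < |L.det| := abs_pos.2 hL
    rw [h1, ← Real.sqrt_eq_rpow (∏ j, _), Real.sqrt_prod _ fun _ _ => norm_nonneg _]
    simp only [Complex.ofReal_re, Real.sqrt_div (norm_nonneg _)]
    rw [Finset.prod_div_distrib, ← Real.sqrt_prod _ fun j _ => (hpos j).le, hprod,
      Real.sqrt_sq_eq_abs, show (-(1 / 2) : ℝ) = 1 / 2 - 1 by norm_num, Real.rpow_sub_one h4.ne']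
    ring
  · rw [SchwartzMap.compCLMOfContinuousLinearEquiv_apply, Function.comp_apply, gaussian_apply]
    have h5 : ‖matrixEquiv hL y‖ ^ 2 = inner ℝ y ((L.transpose * L).toEuclideanLin y) := by
      rw [toEuclideanLin_mul_apply, ← inner_toEuclideanLin_left, real_inner_self_eq_norm_sq]
      rfl
    rw [h5, inner_toEuclideanLin_eq_sum hH]
    push_cast
    rfl

end GaussianImages

/-! ### Irreducibility of the Schrödinger representation -/

section Irreducible

variable {d : ℕ}

theorem toTemperedDistributionCLM_apply_eq (u φ : 𝓢(Rd d, ℂ)) :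
    SchwartzMap.toTemperedDistributionCLM (Rd d) ℂ volume u φ = ∫ x, u x * φ x := by
  refine (SchwartzMap.toTemperedDistributionCLM_apply_apply volume u φ).trans ?_
  simp only [smul_eq_mul, mul_comm]

theorem toTemperedDistribution_smul_apply (c : ℂ) (F : L2 d) (φ : 𝓢(Rd d, ℂ)) :
    Lp.toTemperedDistribution (c • F) φ = c * Lp.toTemperedDistribution F φ :=
  congrArg (fun f : 𝓢'(Rd d, ℂ) => f φ)
    (map_smul (Lp.toTemperedDistributionCLM ℂ (volume : Measure (Rd d)) 2) c F)

theorem schrodinger_toL2 (a b : Rd d) (f : 𝓢(Rd d, ℂ)) :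
    schrodinger a b (toL2 f) = toL2 (schrodingerTranspose (-a, b) f) := by
  refine toTemperedDistribution_injective ?_
  ext φ
  rw [toTemperedDistribution_schrodinger, toTemperedDistribution_toL2, toTemperedDistribution_toL2,
    toTemperedDistributionCLM_apply_eq, toTemperedDistributionCLM_apply_eq,
    ← integral_add_right_eq_self _ a]
  congr with y
  rw [schrodingerTranspose_apply, schrodingerTranspose_apply]
  simp only [add_sub_cancel_right, sub_neg_eq_add, inner_add_left, inner_neg_left]
  rw [show 2 * Real.pi * (inner ℝ y b + inner ℝ a b) - Real.pi * inner ℝ a b =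
    2 * Real.pi * inner ℝ y b - Real.pi * -inner ℝ a b by ring]
  ring

/-- The bilinear form `(f, φ) ↦ ∫ (V f) φ` as a tempered distribution in `f`. -/
noncomputable def pairing (V : L2 d ≃ₗᵢ[ℂ] L2 d) (φ : 𝓢(Rd d, ℂ)) : 𝓢'(Rd d, ℂ) :=
  ContinuousLinearMap.toPointwiseConvergenceCLM ℂ (RingHom.id ℂ) _ _
    ((PointwiseConvergenceCLM.evalCLM (RingHom.id ℂ) ℂ φ) ∘L
      (Lp.toTemperedDistributionCLM ℂ volume 2) ∘L (V : L2 d →L[ℂ] L2 d) ∘L toL2)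

theorem pairing_apply (V : L2 d ≃ₗᵢ[ℂ] L2 d) (φ f : 𝓢(Rd d, ℂ)) :
    pairing V φ f = Lp.toTemperedDistribution (V (toL2 f)) φ := rfl

theorem timeFreqShift_eq_smul (g : 𝓢(Rd d, ℂ)) (x ξ : Rd d) :
    timeFreqShift g x ξ =
      Complex.exp ((-(Real.pi * inner ℝ x ξ) : ℝ) * Complex.I) •
        schrodingerTranspose (x, -ξ) g := by
  rw [schrodingerTranspose, smul_smul, ← Complex.exp_add]
  simp

/-- A unitary operator commuting with the Schrödinger representation moves time-frequency shifts
from the window to the function. -/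
theorem stft_of_commute {V : L2 d ≃ₗᵢ[ℂ] L2 d}
    (hV : ∀ a b f, V (schrodinger a b f) = schrodinger a b (V f)) (f g : 𝓢(Rd d, ℂ)) (x ξ : Rd d) :
    stft g (Lp.toTemperedDistribution (V (toL2 f))) x ξ =
      char ξ x * stft f (pairing V g) (-x) ξ := by
  rw [stft, stft, pairing_apply, timeFreqShift_eq_smul, map_smul,
    ← toTemperedDistribution_schrodinger, ← hV, schrodinger_toL2, timeFreqShift_eq_smul, map_smul,
    map_smul, toTemperedDistribution_smul_apply, smul_eq_mul, ← mul_assoc, char, ← Complex.exp_add]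
  congr 2
  rw [inner_neg_left]
  push_cast
  ring

/-- Moyal's formula evaluated in two ways: with `V` acting on the function `f` and, after moving the
time-frequency shifts, with `V` acting on the window `h`. -/
theorem pairing_mul_eq {V : L2 d ≃ₗᵢ[ℂ] L2 d}
    (hV : ∀ a b f, V (schrodinger a b f) = schrodinger a b (V f)) (f ψ g h : 𝓢(Rd d, ℂ)) :
    Lp.toTemperedDistribution (V (toL2 f)) ψ * ∫ t, g t * h t =
      pairing V g h * ∫ t, f t * ψ t := by
  rw [← integral_stft_mul g h ψ, ← integral_stft_mul f ψ h,
    ← measurePreserving_neg_fst.integral_comp ((Homeomorph.neg (Rd d)).prodCongr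
      (Homeomorph.refl (Rd d))).measurableEmbedding
      (fun z : Rd d × Rd d => stft f (pairing V g) z.1 z.2 * schwartzStft ψ h (z.1, -z.2))]
  refine integral_congr_ae (Eventually.of_forall fun z => ?_)
  simp only
  rw [stft_of_commute hV, schwartzStft_comm h ψ]
  have : char z.2 z.1 * char (-z.2) z.1 = 1 := by
    rw [← char_add_left]; simp [char]
  linear_combination (stft f (pairing V g) (-z.1) z.2 * schwartzStft ψ h (-z.1, -z.2)) * this

theorem integral_gaussian_mul_ne_zero :
    ∫ t : Rd d, (gaussian t : ℂ) * gaussian t ≠ 0 := by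
  have h1 : ∀ t : Rd d, (gaussian t : ℂ) * gaussian t =
      ((Real.exp (-(2 * Real.pi) * ‖t‖ ^ 2) : ℝ) : ℂ) := fun t => by
    rw [gaussian_apply, ← Complex.exp_add, Complex.ofReal_exp]
    congr 1
    push_cast
    ring
  simp only [h1]
  rw [integral_complex_ofReal, GaussianFourier.integral_rexp_neg_mul_sq_norm (by positivity)]
  exact Complex.ofReal_ne_zero.2 (by positivity)

/-- Schur's lemma for the Schrödinger representation: the constant is found by taking Gaussians for
the two windows in `pairing_mul_eq`. -/
theorem exists_smul_of_commute {V : L2 d ≃ₗᵢ[ℂ] L2 d}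
    (hV : ∀ a b f, V (schrodinger a b f) = schrodinger a b (V f)) :
    ∃ c : ℂ, ‖c‖ = 1 ∧ ∀ f, V f = c • f := by
  set c : ℂ := pairing V gaussian gaussian / ∫ t : Rd d, (gaussian t : ℂ) * gaussian t with hc
  have h1 : ∀ f : 𝓢(Rd d, ℂ), V (toL2 f) = c • toL2 f := fun f => by
    refine toTemperedDistribution_injective ?_
    ext ψ
    have h2 := pairing_mul_eq hV f ψ gaussian gaussian
    rw [toTemperedDistribution_smul_apply, toTemperedDistribution_toL2,
      toTemperedDistributionCLM_apply_eq, hc, div_mul_eq_mul_div,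
      eq_div_iff integral_gaussian_mul_ne_zero]
    exact h2
  -- Schwartz functions are dense in `L²`.
  have h2 : ∀ f, V f = c • f := fun f =>
    denseRange_toL2.induction_on (p := fun f : L2 d => V f = c • f) f
      (isClosed_eq V.continuous (continuous_const_smul c)) h1
  refine ⟨c, ?_, h2⟩
  have h3 : toL2 (gaussian : 𝓢(Rd d, ℂ)) ≠ 0 := fun h0 => by
    refine integral_gaussian_mul_ne_zero (d := d) ?_
    rw [← toTemperedDistributionCLM_apply_eq, ← toTemperedDistribution_toL2, h0]
    exact (congrArg (fun F => Lp.toTemperedDistribution F (gaussian : 𝓢(Rd d, ℂ)))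
      (zero_smul ℂ (0 : L2 d)).symm).trans
      ((toTemperedDistribution_smul_apply 0 0 gaussian).trans (zero_mul _))
  have h4 := V.norm_map (toL2 gaussian)
  rw [h2, norm_smul] at h4
  exact mul_right_cancel₀ (norm_ne_zero_iff.2 h3) (h4.trans (one_mul _).symm)

/-- Weak-* density of the Schwartz functions in the tempered distributions. -/
theorem denseRange_toTemperedDistribution :
    DenseRange fun u : 𝓢(Rd d, ℂ) => SchwartzMap.toTemperedDistributionCLM (Rd d) ℂ volume u := by
  intro f
  obtain ⟨q, u, -, hu⟩ := exists_seq_approx f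
  refine mem_closure_of_tendsto (b := atTop)
    (f := fun n => SchwartzMap.toTemperedDistributionCLM (Rd d) ℂ volume (u n))
    (PointwiseConvergenceCLM.tendsto_iff_forall_tendsto.2 fun φ => ?_)
    (Eventually.of_forall fun n => Set.mem_range_self _)
  refine tendsto_of_norm_sub_le (K := q φ) fun n => ?_
  rw [toTemperedDistributionCLM_apply_eq]
  exact hu n φ

/-- A metaplectic operator is determined by its symplectic matrix up to a unimodular factor. -/
theorem Implements.exists_smul {M : Matrix (Fin d ⊕ Fin d) (Fin d ⊕ Fin d) ℝ}
    {S R : 𝓢(Rd d, ℂ) →L[ℂ] 𝓢(Rd d, ℂ)} {N : Rd d × Rd d → Rd d × Rd d} (h : Implements M S R N)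
    {T : 𝓢'(Rd d, ℂ) →L[ℂ] 𝓢'(Rd d, ℂ)} (hT : IsMetaplectic M T) :
    ∃ c : ℂ, ‖c‖ = 1 ∧ ∀ f φ, T f φ = c * f (S φ) := by
  obtain ⟨U, hU, hTU⟩ := hT
  obtain ⟨c, hc, hV⟩ := exists_smul_of_commute (V := U.trans h.unitary.symm) fun a b f => by
    rw [LinearIsometryEquiv.trans_apply, LinearIsometryEquiv.trans_apply, hU,
      LinearIsometryEquiv.symm_apply_eq, h.intertwines, LinearIsometryEquiv.apply_symm_apply]
  have h1 : ∀ f, U f = c • h.unitary f := fun f => by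
    have := hV f
    rw [LinearIsometryEquiv.trans_apply, LinearIsometryEquiv.symm_apply_eq, map_smul] at this
    exact this
  have h2 : (T : 𝓢'(Rd d, ℂ) → 𝓢'(Rd d, ℂ)) =
      (c • distribution S : 𝓢'(Rd d, ℂ) →L[ℂ] 𝓢'(Rd d, ℂ)) := by
    refine denseRange_toTemperedDistribution.equalizer T.continuous
      (c • distribution S : 𝓢'(Rd d, ℂ) →L[ℂ] 𝓢'(Rd d, ℂ)).continuous (funext fun u => ?_)
    simp only [Function.comp_apply]
    rw [← toTemperedDistribution_toL2, hTU, h1]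
    ext φ
    rw [toTemperedDistribution_smul_apply, ← h.distribution_eq]
    rfl
  exact ⟨c, hc, fun f φ => by rw [h2]; rfl⟩

end Irreducible

/-! ### Amalgam norms under metaplectic operators -/

section Estimate

variable {d : ℕ}

theorem measurable_enorm_stft (g : 𝓢(Rd d, ℂ)) (f : 𝓢'(Rd d, ℂ)) :
    Measurable fun z : Rd d × Rd d => ‖stft g f z.1 z.2‖ₑ :=
  (measurable_stft g f).enorm

theorem amalgamNorm_eq (g : 𝓢(Rd d, ℂ)) (p q : ℝ≥0∞) (f : 𝓢'(Rd d, ℂ)) :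
    amalgamNorm g p q f =
      eLpNorm (fun x => eLpNorm (fun ξ => ‖stft g f x ξ‖ₑ) p volume) q volume := by
  simp only [amalgamNorm, localNorm, eLpNorm_enorm]

/-- Young's inequality for a convolution with an integrable function in a mixed norm space. -/
theorem eLpNorm_eLpNorm_convolution_le {K G : Rd d × Rd d → ℝ≥0∞} (hK : Measurable K)
    (hG : Measurable G) {p q : ℝ≥0∞} (hp : 1 ≤ p) (hq : 1 ≤ q) :
    eLpNorm (fun x => eLpNorm (fun ξ => ∫⁻ w, K w * G (x + w.1, ξ - w.2)) p volume) q volume ≤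
      (∫⁻ w, K w) * eLpNorm (fun x => eLpNorm (fun ξ => G (x, ξ)) p volume) q volume := by
  have hp0 : p ≠ 0 := (zero_lt_one.trans_le hp).ne'
  have hq0 : q ≠ 0 := (zero_lt_one.trans_le hq).ne'
  let F : (Rd d × Rd d) × (Rd d × Rd d) → ℝ≥0∞ := fun w =>
    K w.2 * G (w.1.1 + w.2.1, w.1.2 - w.2.2)
  have hF : Measurable F := (hK.comp measurable_snd).mul (hG.comp (by fun_prop))
  refine (eLpNorm_eLpNorm_lintegral_le hF hq hp).trans (le_of_eq ?_)
  rw [← lintegral_mul_const _ hK]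
  refine lintegral_congr fun w => ?_
  have h1 : ∀ x, eLpNorm (fun ξ => F ((x, ξ), w)) p volume =
      K w * eLpNorm (fun ξ => G (x + w.1, ξ)) p volume := fun x => by
    have hm : Measurable fun ξ => G (x + w.1, ξ) := hG.comp measurable_prodMk_left
    rw [← eLpNorm_comp_add_right (-w.2) hm p]
    exact eLpNorm_const_mul_ennreal (K w) hp0 (hm.comp (measurable_add_const (-w.2)))
  have hm : Measurable fun x => eLpNorm (fun ξ => G (x, ξ)) p volume :=
    measurable_eLpNorm_left hG hp0
  simp only [h1]
  rw [← eLpNorm_comp_add_right w.1 hm q]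
  exact eLpNorm_const_mul_ennreal (K w) hq0 (hm.comp (measurable_add_const w.1))

/-- Change of window in the amalgam spaces. -/
theorem amalgamNorm_mul_le (g h γ : 𝓢(Rd d, ℂ)) (f : 𝓢'(Rd d, ℂ)) {p q : ℝ≥0∞} (hp : 1 ≤ p)
    (hq : 1 ≤ q) :
    amalgamNorm γ p q f * ‖∫ t, g t * h t‖ₑ ≤ modNorm h γ * amalgamNorm g p q f := by
  have hp0 : p ≠ 0 := (zero_lt_one.trans_le hp).ne'
  have hq0 : q ≠ 0 := (zero_lt_one.trans_le hq).ne'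
  have hH := measurable_enorm_schwartzStft h γ
  have h2 := enorm_stft_mul_le g h γ f
  rw [amalgamNorm_eq, amalgamNorm_eq]
  generalize ‖∫ t, g t * h t‖ₑ = κ at h2 ⊢
  have hG := measurable_enorm_stft γ f
  have hg := measurable_enorm_stft g f
  have h3 := eLpNorm_eLpNorm_convolution_le hH hg hp hq
  refine le_trans ?_ h3
  rw [mul_comm, ← eLpNorm_const_mul_ennreal _ hq0 (measurable_eLpNorm_left hG hp0)]
  refine eLpNorm_mono_enorm fun x => ?_
  simp only [enorm_eq_self]
  have h4 : Measurable fun ξ => ‖stft γ f x ξ‖ₑ :=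
    Measurable.of_uncurry_left (f := fun x ξ => ‖stft γ f x ξ‖ₑ) hG
  rw [← eLpNorm_const_mul_ennreal _ hp0 h4]
  refine eLpNorm_mono_enorm fun ξ => ?_
  simp only [enorm_eq_self]
  rw [mul_comm]
  refine (h2 x ξ).trans (le_of_eq ?_)
  have h5 : Measurable fun w : Rd d × Rd d =>
      ‖schwartzStft h γ w‖ₑ * ‖stft g f (x + w.1) (ξ - w.2)‖ₑ := hH.mul
    (hg.comp (f := fun w : Rd d × Rd d => (x + w.1, ξ - w.2)) (by fun_prop))
  rw [← lintegral_sub_sub_eq _ h5 x ξ]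
  refine lintegral_congr fun z => ?_
  simp only [add_sub_cancel, sub_sub_cancel]
  rw [mul_comm]

/-- The covariance of `S` under time-frequency shifts turns the mixed norm in `(x, ξ)` into the
mixed norm in the opposite order. -/
theorem amalgamNorm_apply_le {B Q₁ Q₂ : Matrix (Fin d) (Fin d) ℝ} (hB : B.det ≠ 0)
    {M : Matrix (Fin d ⊕ Fin d) (Fin d ⊕ Fin d) ℝ} {S R : 𝓢(Rd d, ℂ) →L[ℂ] 𝓢(Rd d, ℂ)}
    {N : Rd d × Rd d → Rd d × Rd d} (h : Implements M S R N)
    (hN : ∀ x ξ, N (x, ξ) = (B.transpose.toEuclideanLin (ξ + Q₁.toEuclideanLin x),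
      -B⁻¹.toEuclideanLin x +
        Q₂.toEuclideanLin (B.transpose.toEuclideanLin (ξ + Q₁.toEuclideanLin x))))
    {T : 𝓢'(Rd d, ℂ) →L[ℂ] 𝓢'(Rd d, ℂ)} (hT : IsMetaplectic M T) {p q : ℝ≥0∞} (hp : 1 ≤ p)
    (hpq : p ≤ q) (g : 𝓢(Rd d, ℂ)) (f : 𝓢'(Rd d, ℂ)) :
    amalgamNorm g p q (T f) ≤
      ENNReal.ofReal (|B.det| ^ ((q⁻¹).toReal - (p⁻¹).toReal)) * amalgamNorm (S g) q p f := by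
  obtain ⟨c, hc, hTS⟩ := h.exists_smul hT
  have h1 : ∀ x ξ, ‖stft g (T f) x ξ‖ₑ = ‖stft (S g) f (N (x, ξ)).1 (N (x, ξ)).2‖ₑ := fun x ξ => by
    rw [stft, hTS, enorm_mul, ← ofReal_norm c, hc, ENNReal.ofReal_one, one_mul]
    exact h.enorm_apply_eq f g (x, ξ)
  have hd : 0 < |B.det| := abs_pos.2 hB
  have hM : LinearMap.det B.transpose.toEuclideanLin = B.det := by
    rw [det_toEuclideanLin, Matrix.det_transpose]
  have hD : |LinearMap.det (-B⁻¹).toEuclideanLin| = |B.det|⁻¹ := by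
    rw [det_toEuclideanLin, Matrix.det_neg, Matrix.det_nonsing_inv, Ring.inverse_eq_inv, abs_mul,
      abs_pow, abs_neg, abs_one, one_pow, one_mul, abs_inv]
  have hD0 : LinearMap.det (-B⁻¹).toEuclideanLin ≠ 0 := by
    rw [← abs_pos, hD]; positivity
  have h2 := eLpNorm_eLpNorm_comp_le B.transpose.toEuclideanLin (-B⁻¹).toEuclideanLin
    Q₂.toEuclideanLin Q₁.toEuclideanLin (by rwa [hM]) hD0 (measurable_enorm_stft (S g) f) hp hpq
  rw [hM, hD, ← mul_assoc, ENNReal.ofReal_rpow_of_pos hd,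
    ENNReal.ofReal_rpow_of_pos (inv_pos.2 hd), ← ENNReal.ofReal_mul (by positivity),
    Real.inv_rpow hd.le, ← Real.rpow_neg hd.le, neg_neg, ← Real.rpow_add hd, ← amalgamNorm_eq,
    neg_add_eq_sub] at h2
  rw [amalgamNorm_eq]
  simp only [h1, hN]
  simpa only [map_neg, LinearMap.neg_apply] using h2

/-- A window is dual to its complex conjugate. -/
theorem IsWindow.enorm_integral {g : 𝓢(Rd d, ℂ)} (hg : IsWindow g) :
    ‖∫ t, g t * conj g t‖ₑ = 1 := by
  have h1 : ‖toL2 g‖ = 1 := by rw [norm_toL2, hg.norm_one, ENNReal.toReal_one]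
  have h2 : ∫ t, g t * conj g t = 1 := by
    have h3 := inner_self_eq_norm_sq_to_K (𝕜 := ℂ) (toL2 g)
    rw [inner_toL2, h1] at h3
    simpa only [RCLike.inner_apply, conj_apply, RCLike.ofReal_one, one_pow] using h3
  rw [h2, enorm_one]

/-- The constant of the change of windows between the window `g` and a Gaussian. -/
noncomputable def windowConst (g : 𝓢(Rd d, ℂ)) : ℝ≥0∞ :=
  modNorm gaussian (conj g) * modNorm gaussian g / ‖∫ t : Rd d, (gaussian t : ℂ) * gaussian t‖ₑ ^ 2

theorem windowConst_lt_top (g : 𝓢(Rd d, ℂ)) : windowConst g < ∞ :=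
  ENNReal.div_lt_top (ENNReal.mul_lt_top (modNorm_lt_top _ _) (modNorm_lt_top _ _)).ne
    (pow_ne_zero _ (enorm_ne_zero.2 integral_gaussian_mul_ne_zero))

/-- The estimate of the image of the window `g` reduces to the one for a Gaussian. -/
theorem Implements.modNorm_conj_le {M : Matrix (Fin d ⊕ Fin d) (Fin d ⊕ Fin d) ℝ}
    {S R : 𝓢(Rd d, ℂ) →L[ℂ] 𝓢(Rd d, ℂ)} {N : Rd d × Rd d → Rd d × Rd d} (h : Implements M S R N)
    (g : 𝓢(Rd d, ℂ)) :
    modNorm (conj g) (S g) ≤ windowConst g * modNorm gaussian (S gaussian) := by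
  rw [windowConst, div_eq_mul_inv, mul_right_comm, ← div_eq_mul_inv]
  refine (ENNReal.le_div_iff_mul_le (Or.inl ?_) (Or.inl ?_)).2
    (h.modNorm_window_le gaussian (conj g) g)
  · exact pow_ne_zero _ (enorm_ne_zero.2 integral_gaussian_mul_ne_zero)
  · exact ENNReal.pow_ne_top enorm_ne_top

/-- The `M¹` norm of the image of a window depends on the symplectic matrix only, as any two
operators implementing it differ by a unimodular factor. -/
theorem Implements.modNorm_congr {M : Matrix (Fin d ⊕ Fin d) (Fin d ⊕ Fin d) ℝ}
    {S S' R R' : 𝓢(Rd d, ℂ) →L[ℂ] 𝓢(Rd d, ℂ)} {N N' : Rd d × Rd d → Rd d × Rd d}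
    (h : Implements M S R N) (h' : Implements M S' R' N') (φ ψ : 𝓢(Rd d, ℂ)) :
    modNorm φ (S ψ) = modNorm φ (S' ψ) := by
  obtain ⟨c, hc, hS⟩ := h.exists_smul h'.isMetaplectic
  refine lintegral_congr fun z => ?_
  have h1 : ∀ L : 𝓢(Rd d, ℂ) →L[ℂ] 𝓢(Rd d, ℂ), schwartzStft φ (L ψ) z =
      SchwartzMap.toTemperedDistributionCLM (Rd d) ℂ volume (timeFreqShift φ z.1 z.2) (L ψ) :=
    fun L => by
      rw [toTemperedDistributionCLM_apply_eq, schwartzStft]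
      congr with t
      ring
  have h2 := hS (SchwartzMap.toTemperedDistributionCLM (Rd d) ℂ volume (timeFreqShift φ z.1 z.2)) ψ
  rw [distribution_apply] at h2
  rw [h1, h1, h2, enorm_mul, ← ofReal_norm c, hc, ENNReal.ofReal_one, one_mul]

/-- Normalization of the constant in `Implements.modNorm_comp_le` for the Gaussian. -/
theorem Implements.modNorm_gaussian_comp_le {M₂ : Matrix (Fin d ⊕ Fin d) (Fin d ⊕ Fin d) ℝ}
    {S₁ S₂ R₂ : 𝓢(Rd d, ℂ) →L[ℂ] 𝓢(Rd d, ℂ)} {N₂ : Rd d × Rd d → Rd d × Rd d}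
    (h₂ : Implements M₂ S₂ R₂ N₂) {a b : ℝ≥0∞} (ha : modNorm gaussian (S₁ gaussian) ≤ a)
    (hb : modNorm gaussian (S₂ gaussian) ≤ b) :
    modNorm gaussian (S₂ (S₁ gaussian)) ≤
      a * b / ‖∫ t : Rd d, (gaussian t : ℂ) * gaussian t‖ₑ := by
  refine (ENNReal.le_div_iff_mul_le (Or.inl (enorm_ne_zero.2 integral_gaussian_mul_ne_zero))
    (Or.inl enorm_ne_top)).2 ?_
  exact (h₂.modNorm_comp_le gaussian).trans (mul_le_mul' ha hb)

end Estimate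

/-! ### Factorization of symplectic matrices -/

section Factorization

variable {d : ℕ} {A B C D : Matrix (Fin d) (Fin d) ℝ}

open Matrix

theorem isSymm_mul_inv {X Y : Matrix (Fin d) (Fin d) ℝ} (hX : X.det ≠ 0)
    (h : Xᵀ * Y = Yᵀ * X) : (Y * X⁻¹).IsSymm := by
  have hu : IsUnit X.det := isUnit_iff_ne_zero.2 hX
  have hu' : IsUnit Xᵀ.det := by rwa [det_transpose]
  rw [IsSymm, transpose_mul, transpose_nonsing_inv]
  calc Xᵀ⁻¹ * Yᵀ = Xᵀ⁻¹ * (Yᵀ * X) * X⁻¹ := by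
        rw [mul_assoc, mul_assoc, mul_nonsing_inv _ hu, mul_one]
    _ = Y * X⁻¹ := by rw [← h, nonsing_inv_mul_cancel_left _ _ hu']

theorem isSymm_inv_mul {X Y : Matrix (Fin d) (Fin d) ℝ} (hX : X.det ≠ 0)
    (h : X * Yᵀ = Y * Xᵀ) : (X⁻¹ * Y).IsSymm := by
  have h1 := isSymm_mul_inv (X := Xᵀ) (Y := Yᵀ) (by rwa [det_transpose])
    (by simpa only [transpose_transpose] using h)
  rw [← transpose_nonsing_inv, ← transpose_mul] at h1
  simpa using h1.transpose

theorem mul_transpose_comm_of_mem (h : fromBlocks A B C D ∈ symplecticGroup (Fin d) ℝ) :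
    A * Bᵀ = B * Aᵀ := by
  have h1 := SymplecticGroup.transpose_mem h
  rw [fromBlocks_transpose] at h1
  simpa only [transpose_transpose] using (SymplecticGroup.fromBlocks_mem_iff.1 h1).1

theorem isSymm_lower (h : fromBlocks A B C D ∈ symplecticGroup (Fin d) ℝ) (hB : B.det ≠ 0) :
    (D * B⁻¹).IsSymm :=
  isSymm_mul_inv hB (SymplecticGroup.fromBlocks_mem_iff.1 h).2.1

theorem isSymm_upper (h : fromBlocks A B C D ∈ symplecticGroup (Fin d) ℝ) (hB : B.det ≠ 0) :
    (B⁻¹ * A).IsSymm :=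
  isSymm_inv_mul hB (mul_transpose_comm_of_mem h).symm

theorem isSymm_lower' (h : fromBlocks A B C D ∈ symplecticGroup (Fin d) ℝ) (hA : A.det ≠ 0) :
    (C * A⁻¹).IsSymm :=
  isSymm_mul_inv hA (SymplecticGroup.fromBlocks_mem_iff.1 h).1

theorem isSymm_upper' (h : fromBlocks A B C D ∈ symplecticGroup (Fin d) ℝ) (hA : A.det ≠ 0) :
    (A⁻¹ * B).IsSymm :=
  isSymm_inv_mul hA (mul_transpose_comm_of_mem h)

/-- Factorization of a symplectic matrix with invertible upper right block (a free symplectic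
matrix). -/
theorem fromBlocks_eq_of_det_ne_zero (h : fromBlocks A B C D ∈ symplecticGroup (Fin d) ℝ)
    (hB : B.det ≠ 0) :
    fromBlocks 1 0 (D * B⁻¹) 1 * (fromBlocks B 0 0 (B⁻¹)ᵀ *
      (fromBlocks 0 1 (-1) 0 * fromBlocks 1 0 (B⁻¹ * A) 1)) = fromBlocks A B C D := by
  have hu : IsUnit B.det := isUnit_iff_ne_zero.2 hB
  have h3 := (SymplecticGroup.fromBlocks_mem_iff.1 h).2.2
  have h4 : D * B⁻¹ * A - (B⁻¹)ᵀ = C := by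
    have h5 : Cᵀ = (Aᵀ * D - 1) * B⁻¹ := by
      rw [← h3, sub_sub_cancel, mul_nonsing_inv_cancel_right _ _ hu]
    have h6 := isSymm_lower h hB
    rw [← transpose_transpose C, h5, sub_mul, one_mul, transpose_sub, mul_assoc Aᵀ,
      transpose_mul Aᵀ, h6.eq, transpose_transpose]
  simp only [fromBlocks_multiply]
  simp only [Matrix.zero_mul, Matrix.mul_zero, Matrix.one_mul, Matrix.mul_one, add_zero, zero_add,
    Matrix.mul_neg, neg_zero]
  rw [mul_nonsing_inv_cancel_left _ _ hu, nonsing_inv_mul_cancel_right _ _ hu, ← sub_eq_add_neg, h4]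

/-- Factorization of a symplectic matrix with invertible upper left block. -/
theorem fromBlocks_eq_of_det_ne_zero' (h : fromBlocks A B C D ∈ symplecticGroup (Fin d) ℝ)
    (hA : A.det ≠ 0) :
    fromBlocks 1 0 (C * A⁻¹) 1 * (fromBlocks A 0 0 (A⁻¹)ᵀ *
      (fromBlocks 0 (-1) 1 0 * (fromBlocks 1 0 (-(A⁻¹ * B)) 1 * fromBlocks 0 1 (-1) 0))) =
        fromBlocks A B C D := by
  have hu : IsUnit A.det := isUnit_iff_ne_zero.2 hA
  have h3 := (SymplecticGroup.fromBlocks_mem_iff.1 h).2.2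
  have h4 : C * A⁻¹ * B + (A⁻¹)ᵀ = D := by
    have hu' : IsUnit Aᵀ.det := by rwa [det_transpose]
    have h5 : D = Aᵀ⁻¹ * (1 + Cᵀ * B) := by
      rw [← h3, sub_add_cancel, nonsing_inv_mul_cancel_left _ _ hu']
    have h6 := (isSymm_lower' h hA).eq
    rw [transpose_mul] at h6
    rw [h5, mul_add, mul_one, ← h6, transpose_nonsing_inv, mul_assoc, add_comm]
  simp only [fromBlocks_multiply]
  simp only [Matrix.zero_mul, Matrix.mul_zero, Matrix.one_mul, Matrix.mul_one, add_zero, zero_add,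
    Matrix.neg_mul, Matrix.mul_neg, neg_neg, neg_zero]
  rw [mul_nonsing_inv_cancel_left _ _ hu, nonsing_inv_mul_cancel_right _ _ hu, h4]

theorem toC_mul (X Y : Matrix (Fin d) (Fin d) ℝ) : toC (X * Y) = toC X * toC Y :=
  Matrix.map_mul (f := Complex.ofRealHom)

theorem norm_det_toC (X : Matrix (Fin d) (Fin d) ℝ) : ‖(toC X).det‖ = |X.det| := by
  have h : (toC X).det = (X.det : ℂ) := (RingHom.map_det Complex.ofRealHom X).symm
  rw [h, Complex.norm_real, Real.norm_eq_abs]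

theorem norm_det_add_smul_left {X : Matrix (Fin d) (Fin d) ℝ} (hX : X.det ≠ 0)
    (Y : Matrix (Fin d) (Fin d) ℝ) :
    ‖(toC X + Complex.I • toC Y).det‖ = |X.det| * ‖(1 + Complex.I • toC (X⁻¹ * Y)).det‖ := by
  have h : toC X + Complex.I • toC Y = toC X * (1 + Complex.I • toC (X⁻¹ * Y)) := by
    rw [mul_add, mul_one, Matrix.mul_smul, ← toC_mul,
      mul_nonsing_inv_cancel_left _ _ (isUnit_iff_ne_zero.2 hX)]
  rw [h, det_mul, norm_mul, norm_det_toC]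

theorem norm_det_add_smul_right {X : Matrix (Fin d) (Fin d) ℝ} (hX : X.det ≠ 0)
    (Y : Matrix (Fin d) (Fin d) ℝ) :
    ‖(toC X + Complex.I • toC Y).det‖ = |X.det| * ‖(1 + Complex.I • toC (Y * X⁻¹)).det‖ := by
  have h : toC X + Complex.I • toC Y = (1 + Complex.I • toC (Y * X⁻¹)) * toC X := by
    rw [add_mul, one_mul, Matrix.smul_mul, ← toC_mul,
      nonsing_inv_mul_cancel_right _ _ (isUnit_iff_ne_zero.2 hX)]
  rw [h, det_mul, norm_mul, norm_det_toC, mul_comm]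

/-- Since `Y + iX = i (X - iY)`, the roles of the two summands can be exchanged. -/
theorem norm_det_smul_add {X : Matrix (Fin d) (Fin d) ℝ} (hX : X.det ≠ 0)
    (Y : Matrix (Fin d) (Fin d) ℝ) :
    ‖(toC Y + Complex.I • toC X).det‖ = |X.det| * ‖(1 + Complex.I • toC (-(X⁻¹ * Y))).det‖ := by
  have h : toC Y + Complex.I • toC X = Complex.I • (toC X + Complex.I • toC (-Y)) := by
    have h1 : toC (-Y) = -toC Y := by ext i j; simp
    rw [h1, smul_add, smul_smul, Complex.I_mul_I, neg_one_smul, neg_neg, add_comm]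
  rw [h, det_smul, norm_mul, norm_pow, Complex.norm_I, one_pow, one_mul,
    norm_det_add_smul_left hX, Matrix.mul_neg]

/-- The constant `α` is the Jacobian factor times the product of the bounds for the three nontrivial
factors of a free symplectic matrix. -/
theorem alpha_eq (hB : B.det ≠ 0) (p q : ℝ≥0∞) :
    alpha A B D p q = |B.det| ^ ((q⁻¹).toReal - (p⁻¹).toReal) *
      (‖(1 + Complex.I • toC (D * B⁻¹)).det‖ ^ (1 / 2 : ℝ) *
        (‖(1 + toC B.transpose * toC B).det‖ ^ (1 / 2 : ℝ) * |B.det| ^ (-(1 / 2) : ℝ)) *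
        ‖(1 + Complex.I • toC (B⁻¹ * A)).det‖ ^ (1 / 2 : ℝ)) := by
  have hb : 0 < |B.det| := abs_pos.2 hB
  rw [alpha, det_mul, det_mul, norm_mul, norm_mul, norm_det_add_smul_left hB,
    norm_det_add_smul_right hB,
    show (q⁻¹).toReal - (p⁻¹).toReal - 3 / 2 =
      ((q⁻¹).toReal - (p⁻¹).toReal) + (-(1 / 2) + (-(1 / 2) + -(1 / 2))) by ring,
    Real.rpow_add hb, Real.rpow_add hb (-(1 / 2)), Real.rpow_add hb (-(1 / 2)),
    Real.mul_rpow (by positivity) (by positivity), Real.mul_rpow (by positivity) (by positivity),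
    Real.mul_rpow (by positivity) (by positivity), Real.mul_rpow (by positivity) (by positivity)]
  have h1 : |B.det| ^ (-(1 / 2) : ℝ) * |B.det| ^ (1 / 2 : ℝ) = 1 := by
    rw [← Real.rpow_add hb, neg_add_cancel, Real.rpow_zero]
  generalize |B.det| ^ (-(1 / 2) : ℝ) = s at h1 ⊢
  generalize |B.det| ^ (1 / 2 : ℝ) = t at h1 ⊢
  generalize |B.det| ^ ((q⁻¹).toReal - (p⁻¹).toReal) = r
  generalize ‖(1 + Complex.I • toC (D * B⁻¹)).det‖ ^ (1 / 2 : ℝ) = x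
  generalize ‖(1 + toC B.transpose * toC B).det‖ ^ (1 / 2 : ℝ) = y
  generalize ‖(1 + Complex.I • toC (B⁻¹ * A)).det‖ ^ (1 / 2 : ℝ) = z
  linear_combination (r * s * x * y * z) * (s * t + 1) * h1

/-- The constant `β` is the Jacobian factor times the product of the bounds for the factors of a
symplectic matrix with invertible upper left block. -/
theorem beta_eq (hA : A.det ≠ 0) :
    beta A B C = |B.det|⁻¹ * (‖(1 + Complex.I • toC (C * A⁻¹)).det‖ ^ (1 / 2 : ℝ) *
        (‖(1 + toC A.transpose * toC A).det‖ ^ (1 / 2 : ℝ) * |A.det| ^ (-(1 / 2) : ℝ)) *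
        ‖(1 + Complex.I • toC (-(A⁻¹ * B))).det‖ ^ (1 / 2 : ℝ)) := by
  have hb : 0 < |A.det| := abs_pos.2 hA
  rw [beta, det_mul, det_mul, norm_mul, norm_mul, norm_det_smul_add hA,
    norm_det_add_smul_right hA,
    show (-3 / 2 : ℝ) = -(1 / 2) + (-(1 / 2) + -(1 / 2)) by ring,
    Real.rpow_add hb (-(1 / 2)), Real.rpow_add hb (-(1 / 2)),
    Real.mul_rpow (by positivity) (by positivity), Real.mul_rpow (by positivity) (by positivity),
    Real.mul_rpow (by positivity) (by positivity), Real.mul_rpow (by positivity) (by positivity)]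
  have h1 : |A.det| ^ (-(1 / 2) : ℝ) * |A.det| ^ (1 / 2 : ℝ) = 1 := by
    rw [← Real.rpow_add hb, neg_add_cancel, Real.rpow_zero]
  generalize |A.det| ^ (-(1 / 2) : ℝ) = s at h1 ⊢
  generalize |A.det| ^ (1 / 2 : ℝ) = t at h1 ⊢
  generalize |B.det|⁻¹ = r
  generalize ‖(1 + Complex.I • toC (C * A⁻¹)).det‖ ^ (1 / 2 : ℝ) = x
  generalize ‖(1 + toC A.transpose * toC A).det‖ ^ (1 / 2 : ℝ) = y
  generalize ‖(1 + Complex.I • toC (-(A⁻¹ * B))).det‖ ^ (1 / 2 : ℝ) = z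
  linear_combination (r * s * x * y * z) * (s * t + 1) * h1

end Factorization

/-! ### The metaplectic operators of a factorized symplectic matrix -/

section Factorized

variable {d : ℕ} {A B C D : Matrix (Fin d) (Fin d) ℝ}

/-- The operator on Schwartz functions, the composition of two chirps, a dilation and a Fourier
transform, whose transpose is `μ(A B; C D)` for invertible `B`. -/
noncomputable def freeOp (A D : Matrix (Fin d) (Fin d) ℝ) (hB : B.det ≠ 0) :
    𝓢(Rd d, ℂ) →L[ℂ] 𝓢(Rd d, ℂ) :=
  ((chirp (B⁻¹ * A) ∘L FourierTransform.fourierInvCLM ℂ 𝓢(Rd d, ℂ)) ∘L dilation hB) ∘L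
    chirp (D * B⁻¹)

theorem exists_implements_freeOp (h : Matrix.fromBlocks A B C D ∈ Matrix.symplecticGroup (Fin d) ℝ)
    (hB : B.det ≠ 0) :
    ∃ R N, Implements (Matrix.fromBlocks A B C D) (freeOp A D hB) R N ∧
      ∀ x ξ, N (x, ξ) = (B.transpose.toEuclideanLin (ξ + (D * B⁻¹).toEuclideanLin x),
        -B⁻¹.toEuclideanLin x + (B⁻¹ * A).toEuclideanLin
          (B.transpose.toEuclideanLin (ξ + (D * B⁻¹).toEuclideanLin x))) := by
  have h1 := (implements_chirp (isSymm_lower h hB)).comp ((implements_dilation hB).comp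
    (implements_fourierInv.comp (implements_chirp (isSymm_upper h hB))))
  rw [fromBlocks_eq_of_det_ne_zero h hB] at h1
  exact ⟨_, _, h1, fun x ξ => rfl⟩

/-- The operator on Schwartz functions whose transpose is `μ(A B; C D)` for invertible `A`. It
contains a single Fourier multiplier, written as a chirp between two Fourier transforms. -/
noncomputable def leviOp (B C : Matrix (Fin d) (Fin d) ℝ) (hA : A.det ≠ 0) :
    𝓢(Rd d, ℂ) →L[ℂ] 𝓢(Rd d, ℂ) :=
  (((FourierTransform.fourierInvCLM ℂ 𝓢(Rd d, ℂ) ∘L chirp (-(A⁻¹ * B))) ∘L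
    FourierTransform.fourierCLM ℂ 𝓢(Rd d, ℂ)) ∘L dilation hA) ∘L chirp (C * A⁻¹)

theorem exists_implements_leviOp (h : Matrix.fromBlocks A B C D ∈ Matrix.symplecticGroup (Fin d) ℝ)
    (hA : A.det ≠ 0) :
    ∃ R N, Implements (Matrix.fromBlocks A B C D) (leviOp B C hA) R N := by
  have h1 := (implements_chirp (isSymm_lower' h hA)).comp ((implements_dilation hA).comp
    (implements_fourier.comp ((implements_chirp (isSymm_upper' h hA).neg).comp
      implements_fourierInv)))
  rw [fromBlocks_eq_of_det_ne_zero' h hA] at h1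
  exact ⟨_, _, h1⟩

/-- `√2 ^ d`, the constant in the bound for a chirp, as an extended real number. -/
noncomputable def chirpConst (d : ℕ) : ℝ≥0∞ := ENNReal.ofReal (Real.sqrt 2 ^ d)

/-- `∫ e^{-2π|t|²} dt`, the constant in the submultiplicativity of the `M¹` norms of the images of
the Gaussian. -/
noncomputable def gaussConst (d : ℕ) : ℝ≥0∞ := ‖∫ t : Rd d, (gaussian t : ℂ) * gaussian t‖ₑ

theorem gaussConst_ne_zero : gaussConst d ≠ 0 := enorm_ne_zero.2 integral_gaussian_mul_ne_zero

theorem ofReal_mul_mul {x y : ℝ} (hx : 0 ≤ x) (hy : 0 ≤ y) (z : ℝ) :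
    ENNReal.ofReal (x * y * z) = ENNReal.ofReal x * ENNReal.ofReal y * ENNReal.ofReal z := by
  rw [ENNReal.ofReal_mul (mul_nonneg hx hy), ENNReal.ofReal_mul hx]

theorem modNorm_freeOp_le (h : Matrix.fromBlocks A B C D ∈ Matrix.symplecticGroup (Fin d) ℝ)
    (hB : B.det ≠ 0) :
    modNorm gaussian (freeOp A D hB gaussian) ≤
      (chirpConst d ^ 2 * modNorm (gaussian : 𝓢(Rd d, ℂ)) gaussian / gaussConst d ^ 3) *
      ENNReal.ofReal (‖(1 + Complex.I • toC (D * B⁻¹)).det‖ ^ (1 / 2 : ℝ) *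
        (‖(1 + toC B.transpose * toC B).det‖ ^ (1 / 2 : ℝ) * |B.det| ^ (-(1 / 2) : ℝ)) *
        ‖(1 + Complex.I • toC (B⁻¹ * A)).det‖ ^ (1 / 2 : ℝ)) := by
  have hF : modNorm (gaussian : 𝓢(Rd d, ℂ)) (FourierTransform.fourierInvCLM ℂ 𝓢(Rd d, ℂ) gaussian) ≤
      modNorm (gaussian : 𝓢(Rd d, ℂ)) gaussian := by
    rw [FourierTransform.fourierInvCLM_apply, fourierInv_gaussian]
  have h1 := (implements_dilation hB).modNorm_gaussian_comp_le
    (modNorm_chirp_le (isSymm_lower h hB)) (modNorm_dilation_le hB)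
  have h2 := implements_fourierInv.modNorm_gaussian_comp_le
    (S₁ := dilation hB ∘L chirp (D * B⁻¹)) h1 hF
  have h3 := (implements_chirp (isSymm_upper h hB)).modNorm_gaussian_comp_le
    (S₁ := FourierTransform.fourierInvCLM ℂ 𝓢(Rd d, ℂ) ∘L dilation hB ∘L chirp (D * B⁻¹)) h2
    (modNorm_chirp_le (isSymm_upper h hB))
  refine h3.trans (le_of_eq ?_)
  rw [ENNReal.ofReal_mul (p := Real.sqrt 2 ^ d) (by positivity),
    ENNReal.ofReal_mul (p := Real.sqrt 2 ^ d) (by positivity),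
    ofReal_mul_mul (by positivity) (by positivity)]
  change _ / gaussConst d * _ / gaussConst d * _ / gaussConst d = _
  simp only [div_eq_mul_inv, ENNReal.inv_pow, chirpConst]
  ring

theorem modNorm_leviOp_le (h : Matrix.fromBlocks A B C D ∈ Matrix.symplecticGroup (Fin d) ℝ)
    (hA : A.det ≠ 0) :
    modNorm gaussian (leviOp B C hA gaussian) ≤
      (chirpConst d ^ 2 * modNorm (gaussian : 𝓢(Rd d, ℂ)) gaussian ^ 2 / gaussConst d ^ 4) *
      ENNReal.ofReal (‖(1 + Complex.I • toC (C * A⁻¹)).det‖ ^ (1 / 2 : ℝ) *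
        (‖(1 + toC A.transpose * toC A).det‖ ^ (1 / 2 : ℝ) * |A.det| ^ (-(1 / 2) : ℝ)) *
        ‖(1 + Complex.I • toC (-(A⁻¹ * B))).det‖ ^ (1 / 2 : ℝ)) := by
  have hF : modNorm (gaussian : 𝓢(Rd d, ℂ)) (FourierTransform.fourierInvCLM ℂ 𝓢(Rd d, ℂ) gaussian) ≤
      modNorm (gaussian : 𝓢(Rd d, ℂ)) gaussian := by
    rw [FourierTransform.fourierInvCLM_apply, fourierInv_gaussian]
  have hF' : modNorm (gaussian : 𝓢(Rd d, ℂ)) (FourierTransform.fourierCLM ℂ 𝓢(Rd d, ℂ) gaussian) ≤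
      modNorm (gaussian : 𝓢(Rd d, ℂ)) gaussian := by
    rw [FourierTransform.fourierCLM_apply, fourier_gaussian]
  have hs := (isSymm_upper' h hA).neg
  have h1 := (implements_dilation hA).modNorm_gaussian_comp_le
    (modNorm_chirp_le (isSymm_lower' h hA)) (modNorm_dilation_le hA)
  have h2 := implements_fourier.modNorm_gaussian_comp_le
    (S₁ := dilation hA ∘L chirp (C * A⁻¹)) h1 hF'
  have h3 := (implements_chirp hs).modNorm_gaussian_comp_le
    (S₁ := FourierTransform.fourierCLM ℂ 𝓢(Rd d, ℂ) ∘L dilation hA ∘L chirp (C * A⁻¹)) h2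
    (modNorm_chirp_le hs)
  have h4 := implements_fourierInv.modNorm_gaussian_comp_le
    (S₁ := chirp (-(A⁻¹ * B)) ∘L FourierTransform.fourierCLM ℂ 𝓢(Rd d, ℂ) ∘L dilation hA ∘L
      chirp (C * A⁻¹)) h3 hF
  refine h4.trans (le_of_eq ?_)
  rw [ENNReal.ofReal_mul (p := Real.sqrt 2 ^ d) (by positivity),
    ENNReal.ofReal_mul (p := Real.sqrt 2 ^ d) (by positivity),
    ofReal_mul_mul (by positivity) (by positivity)]
  change _ / gaussConst d * _ / gaussConst d * _ / gaussConst d * _ / gaussConst d = _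
  simp only [div_eq_mul_inv, ENNReal.inv_pow, chirpConst]
  ring

/-- The norm estimate for invertible `B`, with a constant in terms of the image of the Gaussian. The
power of `|det B|` is the Jacobian factor of the interchange of the two mixed norms. -/
theorem amalgamNorm_apply_le_modNorm
    (h : Matrix.fromBlocks A B C D ∈ Matrix.symplecticGroup (Fin d) ℝ) (hB : B.det ≠ 0)
    {T : 𝓢'(Rd d, ℂ) →L[ℂ] 𝓢'(Rd d, ℂ)} (hT : IsMetaplectic (Matrix.fromBlocks A B C D) T)
    {p q : ℝ≥0∞} (hp : 1 ≤ p) (hpq : p ≤ q) {g : 𝓢(Rd d, ℂ)} (hg : IsWindow g) (f : 𝓢'(Rd d, ℂ)) :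
    amalgamNorm g p q (T f) ≤ ENNReal.ofReal (|B.det| ^ ((q⁻¹).toReal - (p⁻¹).toReal)) *
      (windowConst g * modNorm gaussian (freeOp A D hB gaussian) * amalgamNorm g q p f) := by
  obtain ⟨R, N, hI, hN⟩ := exists_implements_freeOp h hB
  refine (amalgamNorm_apply_le hB hI hN hT hp hpq g f).trans ?_
  gcongr
  have h1 := amalgamNorm_mul_le g (conj g) (freeOp A D hB g) f (hp.trans hpq) hp
  rw [hg.enorm_integral, mul_one] at h1
  exact h1.trans (mul_le_mul_left (hI.modNorm_conj_le g) _)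

theorem exists_const_le {K : ℝ≥0∞} (hK : K < ∞) :
    ∃ c : ℝ, 0 < c ∧ ∀ r : ℝ, 0 ≤ r → K * ENNReal.ofReal r ≤ ENNReal.ofReal (c * r) := by
  refine ⟨K.toReal + 1, by positivity, fun r hr => ?_⟩
  rw [ENNReal.ofReal_mul (by positivity)]
  gcongr
  exact ENNReal.le_ofReal_iff_toReal_le hK.ne (by positivity) |>.2 (by linarith)

end Factorized

end Metaplectic

theorem theorem4p1 (d : ℕ) (g : 𝓢(Metaplectic.Rd d, ℂ)) (hg : Metaplectic.IsWindow g) :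
    (∀ p q : ℝ≥0∞, 1 ≤ p → p ≤ q →
      ∃ c : ℝ, 0 < c ∧
        ∀ A B C D : Matrix (Fin d) (Fin d) ℝ,
          Matrix.fromBlocks A B C D ∈ Matrix.symplecticGroup (Fin d) ℝ → B.det ≠ 0 →
          (∃ T, Metaplectic.IsMetaplectic (Matrix.fromBlocks A B C D) T) ∧
          ∀ T, Metaplectic.IsMetaplectic (Matrix.fromBlocks A B C D) T →
            ∀ f ∈ Metaplectic.amalgam g q p,
              T f ∈ Metaplectic.amalgam g p q ∧
              Metaplectic.amalgamNorm g p q (T f) ≤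
                ENNReal.ofReal (c * Metaplectic.alpha A B D p q) *
                  Metaplectic.amalgamNorm g q p f) ∧
    (∃ c : ℝ, 0 < c ∧
      ∀ A B C D : Matrix (Fin d) (Fin d) ℝ,
        Matrix.fromBlocks A B C D ∈ Matrix.symplecticGroup (Fin d) ℝ → A.det ≠ 0 → B.det ≠ 0 →
        (∃ T, Metaplectic.IsMetaplectic (Matrix.fromBlocks A B C D) T) ∧
        ∀ T, Metaplectic.IsMetaplectic (Matrix.fromBlocks A B C D) T →
          ∀ f ∈ Metaplectic.amalgam g ∞ 1,
            T f ∈ Metaplectic.amalgam g 1 ∞ ∧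
            Metaplectic.amalgamNorm g 1 ∞ (T f) ≤
              ENNReal.ofReal (c * Metaplectic.beta A B C) *
                Metaplectic.amalgamNorm g ∞ 1 f) := by
  open Metaplectic in
  have hmod := modNorm_lt_top (gaussian : 𝓢(Rd d, ℂ)) gaussian
  refine ⟨fun p q hp hpq => ?_, ?_⟩
  · obtain ⟨c, hc, hK⟩ := exists_const_le (K := windowConst g * (chirpConst d ^ 2 *
      modNorm (gaussian : 𝓢(Rd d, ℂ)) gaussian / gaussConst d ^ 3))
      (ENNReal.mul_lt_top (windowConst_lt_top g) (ENNReal.div_lt_top (ENNReal.mul_lt_top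
        (ENNReal.pow_lt_top ENNReal.ofReal_lt_top) hmod).ne (pow_ne_zero _ gaussConst_ne_zero)))
    refine ⟨c, hc, fun A B C D h hB => ⟨?_, fun T hT f hf => ?_⟩⟩
    · obtain ⟨R, N, hI, -⟩ := exists_implements_freeOp h hB
      exact ⟨_, hI.isMetaplectic⟩
    · have hle : amalgamNorm g p q (T f) ≤
          ENNReal.ofReal (c * alpha A B D p q) * amalgamNorm g q p f := by
        refine (amalgamNorm_apply_le_modNorm h hB hT hp hpq hg f).trans ?_
        rw [← mul_assoc, ← mul_assoc]
        gcongr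
        refine le_trans ?_ (hK _ (by rw [alpha]; positivity))
        rw [alpha_eq hB, ENNReal.ofReal_mul (by positivity)]
        refine (mul_le_mul_right (modNorm_freeOp_le h hB) _).trans (le_of_eq ?_)
        ring
      exact ⟨hle.trans_lt (ENNReal.mul_lt_top ENNReal.ofReal_lt_top hf), hle⟩
  · obtain ⟨c, hc, hK⟩ := exists_const_le (K := windowConst g * (chirpConst d ^ 2 *
      modNorm (gaussian : 𝓢(Rd d, ℂ)) gaussian ^ 2 / gaussConst d ^ 4))
      (ENNReal.mul_lt_top (windowConst_lt_top g) (ENNReal.div_lt_top (ENNReal.mul_lt_top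
        (ENNReal.pow_lt_top ENNReal.ofReal_lt_top) (ENNReal.pow_lt_top hmod)).ne
        (pow_ne_zero _ gaussConst_ne_zero)))
    refine ⟨c, hc, fun A B C D h hA hB => ?_⟩
    obtain ⟨R, N, hI, -⟩ := exists_implements_freeOp h hB
    obtain ⟨R', N', hI'⟩ := exists_implements_leviOp h hA
    refine ⟨⟨_, hI.isMetaplectic⟩, fun T hT f hf => ?_⟩
    have hle : amalgamNorm g 1 ∞ (T f) ≤
        ENNReal.ofReal (c * beta A B C) * amalgamNorm g ∞ 1 f := by
      refine (amalgamNorm_apply_le_modNorm h hB hT le_rfl le_top hg f).trans ?_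
      rw [← mul_assoc, ← mul_assoc]
      gcongr
      refine le_trans ?_ (hK _ (by rw [beta]; positivity))
      -- The Jacobian factor comes from the factorization through `B`, while the image of the
      -- Gaussian may be computed from the one through `A`.
      rw [hI.modNorm_congr hI', beta_eq hA, ENNReal.ofReal_mul (by positivity)]
      refine (mul_le_mul_right (modNorm_leviOp_le h hA) _).trans (le_of_eq ?_)
      have h1 : |B.det| ^ (((∞ : ℝ≥0∞)⁻¹).toReal - ((1 : ℝ≥0∞)⁻¹).toReal) = |B.det|⁻¹ := by
        simp [Real.rpow_neg_one]
      rw [h1]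
      ring
    exact ⟨hle.trans_lt (ENNReal.mul_lt_top ENNReal.ofReal_lt_top hf), hle⟩
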